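/- **Setting.** Let $T>0$, $\alpha>\frac13$, $\varepsilon,L>0$, $m,d\ge 0$. For a two-parameter map $g$ write $\|g\|_{\mu}=\sup_{0\le s<t\le T}|g_{st}|/|t-s|^{\mu}$ (and similarly on subintervals), and $\delta z_{st}=z_t-z_s$. *Rough paths.* $(\zeta,\zeta^2)$ is a geometric $\alpha$-Hölder rough path on $[0,T]$: $\zeta:[0,T]\to\mathbb R^d$ with $\zeta_0=0$, $\|\delta\zeta\|_\alpha<\infty$, $\|\zeta^2\|_{2\alpha}<\infty$ and, for $s\le u\le t$, $\zeta^{2;ij}_{st}-\zeta^{2;ij}_{su}-\zeta^{2;ij}_{ut}=\delta\zeta^i_{su}\,\delta\zeta^j_{ut}$ and $\zeta^{2;ij}_{st}+\zeta^{2;ji}_{st}=\delta\zeta^i_{st}\,\delta\zeta^j_{st}$. Let $\zeta^n:[0,T]\to\mathbb R^d$ be continuously differentiable paths with canonical lifts $\zeta^{n,2;ij}_{st}=\int_s^t\delta\zeta^{n,i}_{su}\,d\zeta^{n,j}_u$, such that $\|\delta\zeta^n-\delta\zeta\|_\alpha+\|\zeta^{n,2}-\zeta^2\|_{2\alpha}\to0$.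 *Controls.* Let $U$ be a separable metric space with its Borel $\sigma$-algebra (for instance a subset of $\mathbb R^k$), $\mathcal P_2(U)$ the probability measures on $U$ with finite second moment, with the Wasserstein distance $W_2$, and $\mathcal K\subset\mathcal P_2(U)$ nonempty and compact. Let $\mathcal V^{\varepsilon,L}([s,T])$ be the set of $\gamma:[s,T]\to\mathcal K$ with $W_2(\gamma_r,\gamma_t)\le L|t-r|^{\varepsilon}$ for all $r,t\in[s,T]$. *Coefficients.* * $b:[0,T]\times\mathbb R^m\times U\to\mathbb R^m$ is bounded; $C^1$ in $x$ with bounded derivative; Lipschitz in $a\in U$ near each point with one constant $C$, i.e. for all $t,x,a$ one has $|b(t,x,a')-b(t,x,a)|\le C\,d(a',a)$ for all $a'$ in a neighbourhood of $a$ that may depend on $t,x$; and, for each $x$, uniformly continuous in $t$, uniformly over $a\in U$. * $\sigma:[0,T]\times\mathbb R^m\to\mathbb R^{m\times d}$ is of class $C_b^{1,3}$: $C^1$ in $t$ and $C^3$ in $x$, with $\sigma$, $\partial_t\sigma$ and $\nabla_x^k\sigma$ ($k\le3$) bounded on $[0,T]\times\mathbb R^m$. * $F:[0,T]\times\mathbb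 R^m\times\mathcal K\to\mathbb R$ is bounded, measurable in $t$, Lipschitz in $x$ and Lipschitz in $\gamma\in\mathcal K$ for $W_2$, with constants uniform in the other variables; $G:\mathbb R^m\to\mathbb R$ is bounded and continuous. *State equations.* For $s\in[0,T]$, $y\in\mathbb R^m$, $\gamma\in\mathcal V^{\varepsilon,L}([s,T])$ consider on $[s,T]$ $$x_t=y+\int_s^t\!\int_U b(r,x_r,a)\,\gamma_r(da)\,dr+\int_s^t\sigma(r,x_r)\,d\zeta_r .\tag{1}$$ A solution of (1) is a path $x$ such that, for some $\kappa\in(\frac13,\alpha)$, the couple $(x,\sigma(\cdot,x))$ is weakly controlled by $\zeta$ on $[s,T]$ with exponent $\kappa$ (a couple $(z,z^\zeta)$ is so controlled if $z,z^\zeta$ are $\kappa$-Hölder and $\rho_{rt}=\delta z_{rt}-z^\zeta_r\delta\zeta_{rt}$ has $\|\rho\|_{2\kappa}<\infty$), and (1) holds with the last integral the rough integral of the weakly controlled couple $(\mu,\mu^\zeta)=(\sigma(\cdot,x),\nabla\sigma(\cdot,x)\sigma(\cdot,x))$, i.e. for $s\le r\le t\le T$ $$\int_r^t\mu\,d\zeta=\mu_r\delta\zeta_{rt}+\mu^\zeta_r\zeta^2_{rt}+\Lambda_{rt},$$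 where, with $\rho^{\mu}=\delta\mu-\mu^\zeta\delta\zeta$, $\Lambda$ is the unique two-parameter map with $\|\Lambda\|_{3\kappa}<\infty$ and $\Lambda_{rt}-\Lambda_{ru}-\Lambda_{ut}=\rho^{\mu}_{ru}\delta\zeta_{ut}+\delta\mu^\zeta_{ru}\,\zeta^2_{ut}$ for $r\le u\le t$. When $\zeta$ is replaced by the $C^1$ path $\zeta^n$, (1) is an ordinary integral equation for a continuous path. **Theorem.** Under these assumptions, for all $s\in[0,T]$, $y\in\mathbb R^m$ and $\gamma\in\mathcal V^{\varepsilon,L}([s,T])$, equation (1) driven by $(\zeta,\zeta^2)$ has a unique solution $x^{s,y,\gamma}$, and, for every $n$, equation (1) driven by $\zeta^n$ has a unique continuous solution $x^{s,y,\gamma,n}$. Moreover the value functions $$V(s,y)=\sup_{\gamma\in\mathcal V^{\varepsilon,L}([s,T])}\Big\{\int_s^TF(r,x^{s,y,\gamma}_r,\gamma_r)\,dr+G(x^{s,y,\gamma}_T)\Big\},$$ $$V^n(s,y)=\sup_{\gamma\in\mathcal V^{\varepsilon,L}([s,T])}\Big\{\int_s^TF(r,x^{s,y,\gamma,n}_r,\gamma_r)\,dr+G(x^{s,y,\gamma,n}_T)\Big\}$$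 satisfy $V^n\to V$ locally uniformly on $[0,T]\times\mathbb R^m$ as $n\to\infty$. -/

import Mathlib

open MeasureTheory Set Filter Topology
open scoped ENNReal

noncomputable section

namespace RoughControl

/-- `ℝⁿ` with its Euclidean norm. -/
abbrev E (n : ℕ) : Type := EuclideanSpace ℝ (Fin n)

section Increments

variable {W : Type*} [NormedAddCommGroup W] [NormedSpace ℝ W]

/-- The increment `δz_{st} = z_t - z_s` of a path. -/
def inc (z : ℝ → W) (s t : ℝ) : W := z t - z s

/-- `δg_{sut} = g_{st} - g_{su} - g_{ut}` for a two-parameter map. -/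
def delta (g : ℝ → ℝ → W) (s u t : ℝ) : W := g s t - g s u - g u t

/-- The Hölder norm `sup_{a ≤ s < t ≤ b} |g_{st}| / |t - s|^μ`, with values in `[0, ∞]`. -/
def holderNorm (a b μ : ℝ) (g : ℝ → ℝ → W) : ℝ≥0∞ :=
  ⨆ (s : ℝ) (t : ℝ) (_ : a ≤ s ∧ s < t ∧ t ≤ b), ENNReal.ofReal (‖g s t‖ / (t - s) ^ μ)

/-- `g = Λ(h)` on `[a, b]`: `δg = h` and `g` has finite `θ`-Hölder norm
(for `θ > 1` there is at most one such `g` on the simplex `a ≤ s ≤ t ≤ b`). -/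
def IsSewing (a b θ : ℝ) (h : ℝ → ℝ → ℝ → W) (g : ℝ → ℝ → W) : Prop :=
  (∀ s u t, a ≤ s → s ≤ u → u ≤ t → t ≤ b → delta g s u t = h s u t) ∧
    holderNorm a b θ g < ∞

end Increments

section RoughPaths

variable {d : ℕ}

/-- `(ζ, A)` is a geometric `α`-Hölder rough path on `[0, T]` started at `0`, where
`A s t i j` stands for `∫_s^t (ζ^i_u - ζ^i_s) dζ^j_u`. -/
structure IsGeometricRoughPath (T α : ℝ) (ζ : ℝ → E d) (A : ℝ → ℝ → Fin d → Fin d → ℝ) :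
    Prop where
  zero : ζ 0 = 0
  holder_path : holderNorm 0 T α (inc ζ) < ∞
  holder_area : holderNorm 0 T (2 * α) A < ∞
  chen : ∀ s u t, 0 ≤ s → s ≤ u → u ≤ t → t ≤ T → ∀ i j,
    delta A s u t i j = inc ζ s u i * inc ζ u t j
  geometric : ∀ s t, 0 ≤ s → s ≤ t → t ≤ T → ∀ i j,
    A s t i j + A s t j i = inc ζ s t i * inc ζ s t j

/-- The `α`-Hölder rough path distance on `[0, T]`. -/
def roughDist (T α : ℝ) (ζ₁ : ℝ → E d) (A₁ : ℝ → ℝ → Fin d → Fin d → ℝ)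
    (ζ₂ : ℝ → E d) (A₂ : ℝ → ℝ → Fin d → Fin d → ℝ) : ℝ≥0∞ :=
  holderNorm 0 T α (fun s t => inc ζ₁ s t - inc ζ₂ s t) +
    holderNorm 0 T (2 * α) (fun s t => A₁ s t - A₂ s t)

/-- The time derivative on `[0, T]` of a differentiable path. -/
def pathDeriv (T : ℝ) (ζ : ℝ → E d) (t : ℝ) : E d := derivWithin ζ (Icc 0 T) t

/-- The canonical lift of a `C¹` path: its iterated integrals
`∫_s^t (ζ^i_u - ζ^i_s) dζ^j_u`. -/
def canonicalArea (T : ℝ) (ζ : ℝ → E d) (s t : ℝ) (i j : Fin d) : ℝ :=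
  ∫ u in s..t, inc ζ s u i * pathDeriv T ζ u j

variable {W : Type*} [NormedAddCommGroup W] [NormedSpace ℝ W]

/-- The remainder `ρ_{st} = δz_{st} - z^ζ_s δζ_{st}`. -/
def remainder (ζ : ℝ → E d) (z : ℝ → W) (z' : ℝ → E d →L[ℝ] W) (s t : ℝ) : W :=
  inc z s t - z' s (inc ζ s t)

/-- The couple `(z, z')` is weakly controlled by `ζ` on `[a, b]` with exponent `κ`. -/
structure IsControlled (a b κ : ℝ) (ζ : ℝ → E d) (z : ℝ → W) (z' : ℝ → E d →L[ℝ] W) :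
    Prop where
  holder_path : holderNorm a b κ (inc z) < ∞
  holder_deriv : holderNorm a b κ (inc z') < ∞
  holder_remainder : holderNorm a b (2 * κ) (remainder ζ z z') < ∞

/-- The contraction `∑_{i,j} B(e_i)(e_j) A^{ij}` (in `B v w`, the vector `v` is the direction of
the derivative along `ζ`, and `w` the direction of integration). -/
def contract (B : E d →L[ℝ] E d →L[ℝ] W) (A : Fin d → Fin d → ℝ) : W :=
  ∑ i, ∑ j, A i j • B (EuclideanSpace.single i 1) (EuclideanSpace.single j 1)

/-- `I s t = ∫_s^t μ_u dζ_u` for all `a ≤ s ≤ t ≤ b`, as the rough integral of the weakly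
controlled path `(μ, μ')`, namely
`I = μ δζ + μ' A + Λ(ρ δζ + δμ' A)` with `ρ` the remainder of `(μ, μ')`. -/
def IsRoughIntegral (a b κ : ℝ) (ζ : ℝ → E d) (A : ℝ → ℝ → Fin d → Fin d → ℝ)
    (μ : ℝ → E d →L[ℝ] W) (μ' : ℝ → E d →L[ℝ] E d →L[ℝ] W) (I : ℝ → ℝ → W) : Prop :=
  IsControlled a b κ ζ μ μ' ∧
    ∃ g : ℝ → ℝ → W,
      IsSewing a b (3 * κ)
        (fun s u t => remainder ζ μ μ' s u (inc ζ u t) + contract (inc μ' s u) (A u t)) g ∧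
      ∀ s t, a ≤ s → s ≤ t → t ≤ b →
        I s t = μ s (inc ζ s t) + contract (μ' s) (A s t) + g s t

end RoughPaths

section Wasserstein

variable (U : Type*) [MetricSpace U] [MeasurableSpace U]

/-- Probability measures on `U` with finite second moments. -/
def P2 : Type _ :=
  {m : Measure U // IsProbabilityMeasure m ∧ ∃ a₀ : U, ∫⁻ a, edist a a₀ ^ 2 ∂m < ∞}

variable {U}

/-- The Wasserstein-2 distance. -/
def W2 (m₁ m₂ : P2 U) : ℝ≥0∞ :=
  ⨅ (π : Measure (U × U)) (_ : π.map Prod.fst = m₁.1 ∧ π.map Prod.snd = m₂.1),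
    (∫⁻ p, edist p.1 p.2 ^ 2 ∂π) ^ (1 / 2 : ℝ)

/-- The topology of the Wasserstein-2 distance, generated by its open balls. -/
instance : TopologicalSpace (P2 U) :=
  TopologicalSpace.generateFrom
    {s | ∃ (m : P2 U) (r : ℝ≥0∞), 0 < r ∧ s = {m' | W2 m m' < r}}

/-- The class `𝒱^{ε,L}([s, T])` of `𝒦`-valued paths that are `ε`-Hölder with constant `L`
for the Wasserstein-2 distance. -/
def controls (K : Set (P2 U)) (ε L s T : ℝ) : Set (ℝ → P2 U) :=
  {γ | (∀ r ∈ Icc s T, γ r ∈ K) ∧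
    ∀ r ∈ Icc s T, ∀ t ∈ Icc s T, W2 (γ r) (γ t) ≤ ENNReal.ofReal (L * |t - r| ^ ε)}

end Wasserstein

section Coefficients

variable {m d : ℕ} {U : Type*} [MetricSpace U] [MeasurableSpace U]

/-- The drift: `b ∈ C_b^{0,1,1}([0, T] × ℝᵐ × U; ℝᵐ)`, uniformly continuous in time.
As `U` is a metric space, the bound on the first derivative in `a` is expressed by the metric:
`b` is Lipschitz in `a` near every point, with one constant (if `U` is an open subset of `ℝᵏ` and
`b` is `C¹` in `a`, this says that the derivative in `a` is bounded). -/
def DriftRegular (T : ℝ) (b : ℝ → E m → U → E m) : Prop :=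
  (∃ C : ℝ, ∀ t ∈ Icc (0 : ℝ) T, ∀ a : U,
    ContDiff ℝ 1 (fun x => b t x a) ∧
    ∀ x, ‖b t x a‖ ≤ C ∧ ‖fderiv ℝ (fun x' => b t x' a) x‖ ≤ C ∧
      ∀ᶠ a' in 𝓝 a, ‖b t x a' - b t x a‖ ≤ C * dist a' a) ∧
  ∀ x : E m, ∀ η > 0, ∃ δ > 0, ∀ t ∈ Icc (0 : ℝ) T, ∀ t' ∈ Icc (0 : ℝ) T, |t - t'| < δ →
    ∀ a : U, ‖b t x a - b t' x a‖ ≤ η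

/-- The diffusion coefficient: `σ ∈ C_b^{1,3}([0, T] × ℝᵐ; ℝ^{m,d})`. -/
def DiffusionRegular (T : ℝ) (σ : ℝ → E m → E d →L[ℝ] E m) : Prop :=
  ∃ C : ℝ,
    (∀ t ∈ Icc (0 : ℝ) T, ContDiff ℝ 3 (σ t) ∧
      ∀ x, ∀ k : ℕ, k ≤ 3 → ‖iteratedFDeriv ℝ k (σ t) x‖ ≤ C) ∧
    ∀ x, ContDiffOn ℝ 1 (fun t => σ t x) (Icc 0 T) ∧
      ∀ t ∈ Icc (0 : ℝ) T, ‖derivWithin (fun t' => σ t' x) (Icc 0 T) t‖ ≤ C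

/-- The running reward `F : [0, T] × ℝᵐ × 𝒦 → ℝ`: bounded, measurable in time,
Lipschitz in `x` and (for the Wasserstein-2 distance) in the measure. -/
def RewardRegular (T : ℝ) (K : Set (P2 U)) (F : ℝ → E m → P2 U → ℝ) : Prop :=
  (∀ x, ∀ ν ∈ K, AEStronglyMeasurable (fun t => F t x ν) (volume.restrict (Icc 0 T))) ∧
  ∃ C : ℝ, ∀ t ∈ Icc (0 : ℝ) T,
    (∀ x, ∀ ν ∈ K, |F t x ν| ≤ C) ∧
    (∀ x x', ∀ ν ∈ K, |F t x ν - F t x' ν| ≤ C * ‖x - x'‖) ∧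
    (∀ x, ∀ ν ∈ K, ∀ ν' ∈ K,
      ENNReal.ofReal |F t x ν - F t x ν'| ≤ ENNReal.ofReal C * W2 ν ν')

end Coefficients

section ControlProblem

variable {m d : ℕ} {U : Type*} [MetricSpace U] [MeasurableSpace U]

/-- The relaxed drift `∫_U b(r, x_r, a) γ_r(da)`. -/
def relaxedDrift (b : ℝ → E m → U → E m) (γ : ℝ → P2 U) (x : ℝ → E m) (r : ℝ) : E m :=
  ∫ a, b r (x r) a ∂(γ r).1

/-- On `[s, T]`, `x` solves
`x_t = y + ∫_s^t ∫_U b(r, x_r, a) γ_r(da) dr + ∫_s^t σ(r, x_r) dζ_r`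
in the sense of controlled rough paths: for some `κ ∈ (1/3, α)` the couple `(x, σ(·, x))` is
weakly controlled by `ζ`, and the last integral is the rough integral of `σ(·, x)`, whose
derivative along `ζ` is `∇σ(·, x) σ(·, x)`. -/
def IsRoughSolution (T α : ℝ) (b : ℝ → E m → U → E m) (σ : ℝ → E m → E d →L[ℝ] E m)
    (ζ : ℝ → E d) (A : ℝ → ℝ → Fin d → Fin d → ℝ) (s : ℝ) (y : E m) (γ : ℝ → P2 U)
    (x : ℝ → E m) : Prop :=
  x s = y ∧ ∃ κ : ℝ, 1 / 3 < κ ∧ κ < α ∧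
    IsControlled s T κ ζ x (fun r => σ r (x r)) ∧
    IsRoughIntegral s T κ ζ A (fun r => σ r (x r))
      (fun r => (fderiv ℝ (σ r) (x r)).comp (σ r (x r)))
      (fun r t => inc x r t - ∫ u in r..t, relaxedDrift b γ x u)

/-- On `[s, T]`, `x` is continuous and solves the ordinary integral equation
`x_t = y + ∫_s^t ∫_U b(r, x_r, a) γ_r(da) dr + ∫_s^t σ(r, x_r) dζ_r` driven by a `C¹` path `ζ`. -/
def IsClassicalSolution (T : ℝ) (b : ℝ → E m → U → E m) (σ : ℝ → E m → E d →L[ℝ] E m)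
    (ζ : ℝ → E d) (s : ℝ) (y : E m) (γ : ℝ → P2 U) (x : ℝ → E m) : Prop :=
  ContinuousOn x (Icc s T) ∧ ∀ t ∈ Icc s T,
    x t = y + (∫ r in s..t, relaxedDrift b γ x r) +
      ∫ r in s..t, σ r (x r) (pathDeriv T ζ r)

/-- The objective `J_{sT} = ∫_s^T F(r, x_r, γ_r) dr + G(x_T)`. -/
def objective (T : ℝ) (F : ℝ → E m → P2 U → ℝ) (G : E m → ℝ) (s : ℝ) (γ : ℝ → P2 U)
    (x : ℝ → E m) : ℝ :=
  (∫ r in s..T, F r (x r) (γ r)) + G (x T)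

/-- The value `V(s, y) = sup_γ J_{sT}(γ, y)` of the control problem driven by the rough path
`(ζ, A)`, over the admissible controls `γ` on `[s, T]` and their state paths. -/
def roughValue (T α : ℝ) (b : ℝ → E m → U → E m) (σ : ℝ → E m → E d →L[ℝ] E m)
    (F : ℝ → E m → P2 U → ℝ) (G : E m → ℝ) (K : Set (P2 U)) (ε L : ℝ)
    (ζ : ℝ → E d) (A : ℝ → ℝ → Fin d → Fin d → ℝ) (s : ℝ) (y : E m) : ℝ :=
  sSup {J | ∃ γ ∈ controls K ε L s T, ∃ x, IsRoughSolution T α b σ ζ A s y γ x ∧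
    J = objective T F G s γ x}

/-- The value of the control problem driven by a `C¹` path `ζ`. -/
def classicalValue (T : ℝ) (b : ℝ → E m → U → E m) (σ : ℝ → E m → E d →L[ℝ] E m)
    (F : ℝ → E m → P2 U → ℝ) (G : E m → ℝ) (K : Set (P2 U)) (ε L : ℝ)
    (ζ : ℝ → E d) (s : ℝ) (y : E m) : ℝ :=
  sSup {J | ∃ γ ∈ controls K ε L s T, ∃ x, IsClassicalSolution T b σ ζ s y γ x ∧
    J = objective T F G s γ x}

end ControlProblem

end RoughControl

end

/-! Following Davie, the equation is turned into a statement about one two-parameter map. With $J$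
the increments of the drift integral, put $R_{st}=\delta
x_{st}-J_{st}-\sigma(s,x_s)\,\delta\zeta_{st}-(\nabla\sigma\,\sigma)(s,x_s)\,\zeta^2_{st}$. A path
solves the rough equation exactly when it is continuous and $R$ is of some order larger than one:
$R$ is then the sewing term of the rough integral (`DavieSolution.isControlled`,
`davieSolution_of_isRoughIntegral`). By Chen's relation $\delta R$ is explicit in $\sigma(\cdot,x)$,
$\nabla\sigma\,\sigma$ and the driver. It is of order $2/3+\alpha>1$ up to a term $|t-s|^\alpha|R|$,
which is absorbed on short intervals. Hence $R$ has a bound that depends only on the constants of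
the coefficients and of the driver (`DavieSetup.norm_davieRemainder_le`).

The same argument for the difference of two remainders gives Lipschitz dependence on the initial
value and on the rough driver, first on short intervals and then, by iteration, on $[0,T]$
(`RoughData.exists_norm_sub_le`). It needs mixed space-time regularity of $\sigma$, although
$\sigma$ is only $C^1$ in time. Interpolating between $|\sigma_t-\sigma_s|\le C|t-s|$ and three
bounded space derivatives makes $\nabla\sigma$ $2/3$-Hölder and $\nabla^2\sigma$ $1/3$-Hölder in
time. This is why the order is $2/3+\alpha$ and not $3\alpha$.

Uniqueness is stability with equal data. For existence, the ordinary solutions driven by $\zeta^n$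
satisfy the expansion along the canonical lift. Stability makes them a uniform Cauchy sequence, and
the universal bound on the remainders passes to the limit (`RoughData.exists_davieSolution`).

A control enters the state equation only through the averaged drift, whose bound and Lipschitz
constant do not depend on the control; its continuity in time comes from the weak continuity of
$\gamma$. So $x^n\to x$ uniformly over all $\gamma$, $s$ and $y$, and the suprema are compared
control by control. As $G$ is merely continuous, its uniform continuity on balls is used. Solutions
stay within a fixed distance of $y$, which gives convergence locally uniform in $y$. -/

namespace RoughControl

/-! ### Sewing estimates for two-parameter maps -/

section Sewing

variable {W : Type*} [NormedAddCommGroup W]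

theorem norm_le_holderNorm_toReal {a b μ : ℝ} {g : ℝ → ℝ → W} (h : holderNorm a b μ g ≠ ∞)
    {s t : ℝ} (hs : a ≤ s) (hst : s < t) (ht : t ≤ b) :
    ‖g s t‖ ≤ (holderNorm a b μ g).toReal * (t - s) ^ μ := by
  have h1 : ENNReal.ofReal (‖g s t‖ / (t - s) ^ μ) ≤ holderNorm a b μ g :=
    le_iSup_of_le s (le_iSup_of_le t (le_iSup_of_le ⟨hs, hst, ht⟩ le_rfl))
  have hpos : 0 < (t - s) ^ μ := Real.rpow_pos_of_pos (sub_pos.2 hst) _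
  rw [← div_le_iff₀ hpos]
  exact (ENNReal.ofReal_le_iff_le_toReal h).1 h1

theorem holderNorm_lt_top {a b μ M : ℝ} {g : ℝ → ℝ → W}
    (h : ∀ s t, a ≤ s → s < t → t ≤ b → ‖g s t‖ ≤ M * (t - s) ^ μ) :
    holderNorm a b μ g < ∞ := by
  refine lt_of_le_of_lt (b := ENNReal.ofReal M) ?_ ENNReal.ofReal_lt_top
  refine iSup_le fun s => iSup_le fun t => iSup_le fun hst => ENNReal.ofReal_le_ofReal ?_
  rw [div_le_iff₀ (Real.rpow_pos_of_pos (sub_pos.2 hst.2.1) _)]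
  exact h s t hst.1 hst.2.1 hst.2.2

/-- The constant of the sewing lemma for the exponent `θ`. -/
noncomputable def sewingConst (θ : ℝ) : ℝ := (1 - 2 ^ (1 - θ))⁻¹

theorem one_le_sewingConst {θ : ℝ} (hθ : 1 < θ) : 1 ≤ sewingConst θ := by
  have h1 : (2 : ℝ) ^ (1 - θ) < 1 := Real.rpow_lt_one_of_one_lt_of_neg (by norm_num) (by linarith)
  have h2 : 0 < (2 : ℝ) ^ (1 - θ) := by positivity
  exact (one_le_inv₀ (by linarith)).2 (by linarith)

theorem two_mul_half_rpow {θ x : ℝ} (hx : 0 ≤ x) :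
    2 * (x / 2) ^ θ = 2 ^ (1 - θ) * x ^ θ := by
  rw [Real.div_rpow hx (by norm_num), Real.rpow_sub (by norm_num), Real.rpow_one]
  ring

/-- A two-parameter map of order `θ' > 1` whose defect of additivity at midpoints is of order
`θ > 1` is itself of order `θ`, with a constant that depends on the defect only. -/
theorem norm_le_of_delta_le {a b θ θ' M P : ℝ} (hθ : 1 < θ) (hθ' : 1 < θ') {g : ℝ → ℝ → W}
    (hg : ∀ s t, a ≤ s → s ≤ t → t ≤ b → ‖g s t‖ ≤ M * (t - s) ^ θ')
    (hd : ∀ s u t, a ≤ s → s ≤ u → u ≤ t → t ≤ b → ‖delta g s u t‖ ≤ P * (t - s) ^ θ)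
    {s t : ℝ} (hs : a ≤ s) (hst : s ≤ t) (ht : t ≤ b) :
    ‖g s t‖ ≤ sewingConst θ * P * (t - s) ^ θ := by
  set q : ℝ := 2 ^ (1 - θ') with hq
  have hq0 : 0 < q := by positivity
  have hq1 : q < 1 := Real.rpow_lt_one_of_one_lt_of_neg (by norm_num) (by linarith)
  -- Bisection turns a constant $c$ into $2^{1-\theta}c+1$; the sewing constant is the fixed point
  -- of this map.
  have hc : 2 ^ (1 - θ) * sewingConst θ + 1 = sewingConst θ := by
    have h1 : (2 : ℝ) ^ (1 - θ) < 1 :=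
      Real.rpow_lt_one_of_one_lt_of_neg (by norm_num) (by linarith)
    have h3 : (1 - (2 : ℝ) ^ (1 - θ)) * sewingConst θ = 1 := mul_inv_cancel₀ (by linarith)
    linarith
  have key : ∀ n : ℕ, ∀ s t, a ≤ s → s ≤ t → t ≤ b →
      ‖g s t‖ ≤ sewingConst θ * P * (t - s) ^ θ + q ^ n * (M * (t - s) ^ θ') := by
    intro n
    induction n with
    | zero =>
      intro s t hs hst ht
      have hP : 0 ≤ P * (t - s) ^ θ := (norm_nonneg _).trans (hd s s t hs le_rfl hst ht)
      have := mul_nonneg (zero_le_one.trans (one_le_sewingConst hθ)) hP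
      have := hg s t hs hst ht
      rw [pow_zero, one_mul]
      linarith
    | succ n ih =>
      intro s t hs hst ht
      have e1 : (s + t) / 2 - s = (t - s) / 2 := by ring
      have e2 : t - (s + t) / 2 = (t - s) / 2 := by ring
      have h1 := ih s ((s + t) / 2) hs (by linarith) (by linarith)
      have h2 := ih ((s + t) / 2) t (by linarith) (by linarith) ht
      have h3 := hd s ((s + t) / 2) t hs (by linarith) (by linarith) ht
      rw [e1] at h1
      rw [e2] at h2
      have h4 : g s t = g s ((s + t) / 2) + g ((s + t) / 2) t + delta g s ((s + t) / 2) t := by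
        simp only [delta]; abel
      have h5 : ‖g s t‖ ≤ ‖g s ((s + t) / 2)‖ + ‖g ((s + t) / 2) t‖
          + ‖delta g s ((s + t) / 2) t‖ := by
        rw [h4]; exact norm_add₃_le
      have h6 := two_mul_half_rpow (θ := θ) (sub_nonneg.2 hst)
      have h7 := two_mul_half_rpow (θ := θ') (sub_nonneg.2 hst)
      calc ‖g s t‖ ≤ sewingConst θ * P * (2 * ((t - s) / 2) ^ θ)
            + q ^ n * (M * (2 * ((t - s) / 2) ^ θ')) + P * (t - s) ^ θ := by linarith
        _ = (2 ^ (1 - θ) * sewingConst θ + 1) * P * (t - s) ^ θ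
            + q ^ (n + 1) * (M * (t - s) ^ θ') := by rw [h6, h7, ← hq]; ring
        _ = _ := by rw [hc]
  -- The a priori bound only has to exist: each bisection multiplies its contribution by $q<1$.
  have hlim : Tendsto (fun n : ℕ => sewingConst θ * P * (t - s) ^ θ
      + q ^ n * (M * (t - s) ^ θ')) atTop
      (𝓝 (sewingConst θ * P * (t - s) ^ θ + 0 * (M * (t - s) ^ θ'))) :=
    ((tendsto_pow_atTop_nhds_zero_of_lt_one hq0.le hq1).mul_const _).const_add _
  rw [zero_mul, add_zero] at hlim
  exact ge_of_tendsto' hlim fun n => key n s t hs hst ht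

/-- A bound that improves itself by an affine contraction of ratio `1/2`. -/
theorem le_two_mul_of_forall_le {x P M : ℝ} {S : Set ℝ} (hM : M ∈ S)
    (hS : ∀ y ∈ S, P + y / 2 ∈ S) (hx : ∀ y ∈ S, x ≤ y) : x ≤ 2 * P := by
  have key : ∀ n : ℕ, 2 * P + (1 / 2 : ℝ) ^ n * (M - 2 * P) ∈ S := by
    intro n
    induction n with
    | zero => simpa using hM
    | succ n ih =>
      have h := hS _ ih
      have e : P + (2 * P + (1 / 2 : ℝ) ^ n * (M - 2 * P)) / 2
          = 2 * P + (1 / 2 : ℝ) ^ (n + 1) * (M - 2 * P) := by ring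
      rwa [e] at h
  have hlim : Tendsto (fun n : ℕ => 2 * P + (1 / 2 : ℝ) ^ n * (M - 2 * P)) atTop
      (𝓝 (2 * P + 0 * (M - 2 * P))) :=
    ((tendsto_pow_atTop_nhds_zero_of_lt_one (by norm_num) (by norm_num)).mul_const _).const_add _
  rw [zero_mul, add_zero] at hlim
  exact ge_of_tendsto' hlim fun n => hx _ (key n)

/-- Sewing with a defect of additivity that depends linearly on the map itself: on short
intervals this dependence is absorbed. -/
theorem norm_le_of_delta_le_self {a b α θ θ' M P Q : ℝ} (hα : 0 ≤ α) (hθ : 1 < θ)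
    (hθ' : 1 < θ') (hαθ : θ ≤ 1 + α) (hab : b - a ≤ 1) (hP : 0 ≤ P) (hQ : 0 ≤ Q)
    (hsmall : sewingConst θ * Q * (b - a) ^ α ≤ 1 / 2) {g : ℝ → ℝ → W}
    (hg : ∀ s t, a ≤ s → s ≤ t → t ≤ b → ‖g s t‖ ≤ M * (t - s) ^ θ')
    (hd : ∀ s u t, a ≤ s → s ≤ u → u ≤ t → t ≤ b →
      ‖delta g s u t‖ ≤ P * (t - s) ^ θ + Q * (t - s) ^ α * ‖g s u‖)
    {s t : ℝ} (hs : a ≤ s) (hst : s ≤ t) (ht : t ≤ b) :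
    ‖g s t‖ ≤ 2 * (sewingConst θ * P) * (t - s) ^ θ := by
  have hc := one_le_sewingConst hθ
  wlog hM0 : 0 ≤ M generalizing M
  · refine this (M := 0) (fun s t hs hst ht => ?_) le_rfl
    exact (hg s t hs hst ht).trans (mul_le_mul_of_nonneg_right (not_le.1 hM0).le
      (Real.rpow_nonneg (sub_nonneg.2 hst) _))
  -- The admissible constants at order $\theta$. The set is nonempty because the self-dependent part
  -- of the defect has order $\alpha+\theta'\ge\theta$. It is then improved by $y\mapsto cP+y/2$,
  -- with $c$ the sewing constant.
  let S : Set ℝ := {y | 0 ≤ y ∧ ∀ s t, a ≤ s → s ≤ t → t ≤ b → ‖g s t‖ ≤ y * (t - s) ^ θ}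
  have hfirst : sewingConst θ * (P + Q * M) ∈ S := by
    refine ⟨by positivity, fun s t hs hst ht => ?_⟩
    refine norm_le_of_delta_le hθ hθ' hg (fun s u t hs hsu hut ht => ?_) hs hst ht
    rcases hsu.eq_or_lt with rfl | hsu
    · rcases hut.eq_or_lt with rfl | hut
      · have h0 : g s s = 0 := by
          have h := hg s s hs le_rfl ht
          rw [sub_self, Real.zero_rpow (by linarith), mul_zero] at h
          simpa using h
        simp [delta, h0, Real.zero_rpow (by linarith : θ ≠ 0)]
      have h0 : g s s = 0 := by
        have h := hg s s hs le_rfl (hut.le.trans ht)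
        rw [sub_self, Real.zero_rpow (by linarith), mul_zero] at h
        simpa using h
      have : delta g s s t = 0 := by simp [delta, h0]
      rw [this, norm_zero]
      exact mul_nonneg (by positivity) (Real.rpow_nonneg (by linarith) _)
    have hpos : 0 < t - s := by linarith
    have h1 := hd s u t hs hsu.le hut ht
    have h2 := hg s u hs hsu.le (hut.trans ht)
    have h3 : (u - s) ^ θ' ≤ (t - s) ^ θ' :=
      Real.rpow_le_rpow (by linarith) (by linarith) (by linarith)
    have h4 : (t - s) ^ α * (t - s) ^ θ' ≤ (t - s) ^ θ := by
      rw [← Real.rpow_add hpos]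
      exact Real.rpow_le_rpow_of_exponent_ge hpos (by linarith) (by linarith)
    have h5 : 0 ≤ Q * (t - s) ^ α := mul_nonneg hQ (Real.rpow_nonneg hpos.le _)
    calc ‖delta g s u t‖ ≤ P * (t - s) ^ θ + Q * (t - s) ^ α * (M * (t - s) ^ θ') :=
          h1.trans (by gcongr; exact h2.trans (by gcongr))
      _ = P * (t - s) ^ θ + Q * M * ((t - s) ^ α * (t - s) ^ θ') := by ring
      _ ≤ P * (t - s) ^ θ + Q * M * (t - s) ^ θ := by gcongr
      _ = _ := by ring
  have hpos : 0 ≤ (t - s) ^ θ := Real.rpow_nonneg (sub_nonneg.2 hst) _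
  rcases hpos.eq_or_lt with h0 | hpos
  · have := hfirst.2 s t hs hst ht
    rw [← h0, mul_zero] at this ⊢
    exact this
  rw [← div_le_iff₀ hpos]
  refine le_two_mul_of_forall_le hfirst ?_ fun y hy => by
    rw [div_le_iff₀ hpos]; exact hy.2 s t hs hst ht
  rintro y ⟨hy0, hy⟩
  refine ⟨by positivity, fun s t hs hst ht => ?_⟩
  -- An admissible $y$ bounds the self-dependent term by $Q(b-a)^\alpha y$ at order $\theta$; sewing
  -- multiplies this by the sewing constant, and `hsmall` leaves at most $y/2$.
  have hba : 0 ≤ (b - a) ^ α := Real.rpow_nonneg (by linarith) _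
  have h := norm_le_of_delta_le (P := P + Q * (b - a) ^ α * y) hθ hθ' hg
    (fun s u t hs hsu hut ht => ?_) hs hst ht
  · refine h.trans (mul_le_mul_of_nonneg_right ?_ (Real.rpow_nonneg (sub_nonneg.2 hst) _))
    have := mul_le_mul_of_nonneg_right hsmall hy0
    nlinarith
  · have hts : 0 ≤ t - s := by linarith
    calc ‖delta g s u t‖ ≤ P * (t - s) ^ θ + Q * (t - s) ^ α * ‖g s u‖ := hd s u t hs hsu hut ht
      _ ≤ P * (t - s) ^ θ + Q * (b - a) ^ α * (y * (t - s) ^ θ) := by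
          have h1 : ‖g s u‖ ≤ y * (t - s) ^ θ := (hy s u hs hsu (hut.trans ht)).trans (by
            gcongr)
          have h2 : (t - s) ^ α ≤ (b - a) ^ α := Real.rpow_le_rpow hts (by linarith) hα
          gcongr
      _ = _ := by ring

end Sewing

/-! ### Contraction of the second derivative along the driver with the area -/

section Contract

variable {d : ℕ} {W : Type*} [NormedAddCommGroup W] [NormedSpace ℝ W]

/-- The sum of the absolute values of the entries. -/
def entrySum (A : Fin d → Fin d → ℝ) : ℝ := ∑ i, ∑ j, |A i j|

theorem entrySum_nonneg (A : Fin d → Fin d → ℝ) : 0 ≤ entrySum A := by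
  unfold entrySum; positivity

theorem entrySum_le (A : Fin d → Fin d → ℝ) : entrySum A ≤ d ^ 2 * ‖A‖ := by
  have : ∀ i j, |A i j| ≤ ‖A‖ := fun i j => (norm_le_pi_norm (A i) j).trans (norm_le_pi_norm A i)
  calc entrySum A ≤ ∑ _i : Fin d, ∑ _j : Fin d, ‖A‖ :=
        Finset.sum_le_sum fun i _ => Finset.sum_le_sum fun j _ => this i j
    _ = d ^ 2 * ‖A‖ := by simp; ring

theorem norm_contract_le (B : E d →L[ℝ] E d →L[ℝ] W) (A : Fin d → Fin d → ℝ) :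
    ‖contract B A‖ ≤ ‖B‖ * entrySum A := by
  unfold contract entrySum
  rw [Finset.mul_sum]
  refine (norm_sum_le _ _).trans (Finset.sum_le_sum fun i _ => ?_)
  rw [Finset.mul_sum]
  refine (norm_sum_le _ _).trans (Finset.sum_le_sum fun j _ => ?_)
  rw [norm_smul, Real.norm_eq_abs, mul_comm]
  refine mul_le_mul_of_nonneg_right ?_ (abs_nonneg _)
  refine (B.le_opNorm₂ _ _).trans ?_
  simp

theorem contract_sub_left (B B' : E d →L[ℝ] E d →L[ℝ] W) (A : Fin d → Fin d → ℝ) :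
    contract (B - B') A = contract B A - contract B' A := by
  simp [contract, smul_sub, Finset.sum_sub_distrib]

theorem contract_sub_right (B : E d →L[ℝ] E d →L[ℝ] W) (A A' : Fin d → Fin d → ℝ) :
    contract B (A - A') = contract B A - contract B A' := by
  simp [contract, sub_smul, Finset.sum_sub_distrib]

/-- Expansion of both vectors in the standard basis. In Chen's relation the defect of the area is
such a rank-one matrix. -/
theorem contract_mul (B : E d →L[ℝ] E d →L[ℝ] W) (v w : E d) :
    contract B (fun i j => v i * w j) = B v w := by
  have hsum : ∀ v : E d, v = ∑ i, v i • EuclideanSpace.single i (1 : ℝ) := fun v => by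
    ext j; simp [Finset.sum_apply, Pi.single_apply]
  conv_rhs => rw [hsum v, hsum w]
  simp only [contract, map_sum, map_smul, _root_.sum_apply,
    _root_.smul_apply, Finset.smul_sum, smul_smul]
  rw [Finset.sum_comm]
  simp only [mul_comm]

end Contract

/-! ### Taylor estimates and interpolation inequalities -/

section Interpolation

variable {X W : Type*} [NormedAddCommGroup X] [NormedSpace ℝ X]
  [NormedAddCommGroup W] [NormedSpace ℝ W]

theorem norm_sub_le_of_fderiv_le {f : X → W} {C : ℝ} (hf : Differentiable ℝ f)
    (hC : ∀ x, ‖fderiv ℝ f x‖ ≤ C) (x y : X) : ‖f x - f y‖ ≤ C * ‖x - y‖ :=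
  convex_univ.norm_image_sub_le_of_norm_fderiv_le (fun x _ => hf x) (fun x _ => hC x)
    (mem_univ y) (mem_univ x)

theorem norm_fderiv_sub_le_of_iteratedFDeriv {f : X → W} {C : ℝ} (hf : ContDiff ℝ 2 f)
    (hC : ∀ x, ‖iteratedFDeriv ℝ 2 f x‖ ≤ C) (x y : X) :
    ‖fderiv ℝ f x - fderiv ℝ f y‖ ≤ C * ‖x - y‖ := by
  have h : ContDiff ℝ 1 (fderiv ℝ f) := hf.fderiv_right (by norm_num)
  refine norm_sub_le_of_fderiv_le (h.differentiable (by norm_num)) (fun x => ?_) x y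
  have := hC x
  rwa [← norm_iteratedFDeriv_fderiv, norm_iteratedFDeriv_one] at this

/-- Mean value inequality for $f-\nabla f(p)$ on the ball of radius $\|v\|+\|w\|$ around $p$, where
$\nabla f$ differs from $\nabla f(p)$ by at most $C(\|v\|+\|w\|)$. -/
theorem norm_taylor_sub_le {f : X → W} {C : ℝ} (hf : Differentiable ℝ f)
    (hC : ∀ x y, ‖fderiv ℝ f x - fderiv ℝ f y‖ ≤ C * ‖x - y‖) (hC0 : 0 ≤ C) (p v w : X) :
    ‖f (p + v) - f (p + w) - fderiv ℝ f p (v - w)‖ ≤ C * (‖v‖ + ‖w‖) * ‖v - w‖ := by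
  have h := (convex_closedBall p (‖v‖ + ‖w‖)).norm_image_sub_le_of_norm_fderiv_le' (𝕜 := ℝ)
    (f := f) (φ := fderiv ℝ f p) (C := C * (‖v‖ + ‖w‖)) (x := p + w) (y := p + v)
    (fun x _ => hf x) (fun x hx => (hC x p).trans (by
      rw [mem_closedBall_iff_norm] at hx; gcongr)) (by simp) (by simp)
  simpa using h

theorem hasFDerivAt_add_right {f : X → W} (hf : Differentiable ℝ f) (x v : X) :
    HasFDerivAt (fun x => f (x + v)) (fderiv ℝ f (x + v)) x := by
  refine ((hf (x + v)).hasFDerivAt.comp x ((hasFDerivAt_id x).add_const v)).congr_fderiv ?_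
  ext u; simp

theorem hasFDerivAt_add_left {f : X → W} (hf : Differentiable ℝ f) (v x : X) :
    HasFDerivAt (fun x => f (v + x)) (fderiv ℝ f (v + x)) x := by
  simpa only [add_comm v] using hasFDerivAt_add_right hf x v

theorem norm_second_difference_le {f : X → W} {C : ℝ} (hf : Differentiable ℝ f)
    (hC : ∀ x y, ‖fderiv ℝ f x - fderiv ℝ f y‖ ≤ C * ‖x - y‖) (p q v : X) :
    ‖f (p + v) - f p - (f (q + v) - f q)‖ ≤ C * ‖p - q‖ * ‖v‖ := by
  have hd : ∀ x, HasFDerivAt (fun x => f (x + v) - f x) (fderiv ℝ f (x + v) - fderiv ℝ f x) x :=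
    fun x => (hasFDerivAt_add_right hf x v).sub (hf x).hasFDerivAt
  have h := norm_sub_le_of_fderiv_le (fun x => (hd x).differentiableAt)
    (C := C * ‖v‖) (fun x => by rw [(hd x).fderiv]; simpa using hC (x + v) x) p q
  calc _ ≤ C * ‖v‖ * ‖p - q‖ := h
    _ = _ := by ring

/-- Mean value inequality for $z\mapsto f(p+z)-f(q+z)$ on the ball of radius $\|v\|$. The hypothesis
on second differences of $\nabla f$ stands for a bounded third derivative; it is what makes Taylor
remainders Lipschitz in the base point. -/
theorem norm_taylor_sub_taylor_le {f : X → W} {C : ℝ} (hf : Differentiable ℝ f)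
    (hC : ∀ p q v, ‖fderiv ℝ f (p + v) - fderiv ℝ f p - (fderiv ℝ f (q + v) - fderiv ℝ f q)‖
      ≤ C * ‖p - q‖ * ‖v‖) (hC0 : 0 ≤ C) (p q v : X) :
    ‖f (p + v) - f p - fderiv ℝ f p v - (f (q + v) - f q - fderiv ℝ f q v)‖
      ≤ C * ‖p - q‖ * ‖v‖ ^ 2 := by
  have hd : ∀ x, HasFDerivAt (fun x => f (p + x) - f (q + x))
      (fderiv ℝ f (p + x) - fderiv ℝ f (q + x)) x :=
    fun x => (hasFDerivAt_add_left hf p x).sub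
      (hasFDerivAt_add_left hf q x)
  have h := (convex_closedBall (0 : X) ‖v‖).norm_image_sub_le_of_norm_hasFDerivWithin_le'
    (𝕜 := ℝ) (f := fun x => f (p + x) - f (q + x)) (φ := fderiv ℝ f p - fderiv ℝ f q)
    (C := C * ‖p - q‖ * ‖v‖) (x := 0) (y := v)
    (fun x _ => (hd x).hasFDerivWithinAt) (fun x hx => by
      have h1 := hC p q x
      rw [mem_closedBall_iff_norm, sub_zero] at hx
      rw [sub_sub_sub_comm]
      exact h1.trans (by gcongr)) (by simp) (by simp)
  simp only [add_zero, sub_zero, _root_.sub_apply] at h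
  calc _ = ‖f (p + v) - f (q + v) - (f p - f q) - (fderiv ℝ f p v - fderiv ℝ f q v)‖ := by
        congr 1; abel
    _ ≤ _ := h
    _ = _ := by ring

/-- Interpolation: a bounded function with a derivative whose second differences are controlled
has a small derivative. -/
theorem norm_fderiv_le_of_norm_le {f : X → W} {A B r : ℝ} (hf : Differentiable ℝ f)
    (hA : ∀ x, ‖f x‖ ≤ A)
    (hB : ∀ p q v, ‖fderiv ℝ f (p + v) - fderiv ℝ f p - (fderiv ℝ f (q + v) - fderiv ℝ f q)‖
      ≤ B * ‖p - q‖ * ‖v‖) (hB0 : 0 ≤ B) (hr : 0 < r) (x : X) :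
    ‖fderiv ℝ f x‖ ≤ (2 * A + B * r ^ 3) / (2 * r) := by
  have hA0 : 0 ≤ A := (norm_nonneg _).trans (hA x)
  refine ContinuousLinearMap.opNorm_le_of_unit_norm (by positivity) fun e he => ?_
  set v := r • e with hv
  have hvn : ‖v‖ = r := by rw [hv, norm_smul, he, mul_one, Real.norm_eq_abs, abs_of_pos hr]
  have h := norm_taylor_sub_taylor_le hf hB hB0 x (x - v) v
  rw [sub_add_cancel, sub_sub_cancel, hvn] at h
  -- In the symmetric difference the quadratic terms cancel, so the error is cubic in the step $r$.
  have hd : ‖f (x + v) - f (x - v) - (2 : ℝ) • fderiv ℝ f x v‖ ≤ B * r ^ 3 := by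
    have hd' : ∀ z, HasFDerivAt (fun z => f (x + z) - f (x - z))
        (fderiv ℝ f (x + z) + fderiv ℝ f (x - z)) z := fun z => by
      have h1 := hasFDerivAt_add_left hf x z
      have h2 := (hf (x - z)).hasFDerivAt.comp z ((hasFDerivAt_id z).const_sub x)
      have h3 := h1.sub h2
      refine h3.congr_fderiv ?_
      ext u; simp
    have h := (convex_closedBall (0 : X) ‖v‖).norm_image_sub_le_of_norm_hasFDerivWithin_le'
      (𝕜 := ℝ) (f := fun z => f (x + z) - f (x - z)) (φ := (2 : ℝ) • fderiv ℝ f x)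
      (C := B * r * r) (x := 0) (y := v)
      (fun z _ => (hd' z).hasFDerivWithinAt) (fun z hz => by
        have h1 := hB x (x - z) z
        rw [mem_closedBall_iff_norm, sub_zero, hvn] at hz
        rw [sub_add_cancel, sub_sub_cancel] at h1
        have e1 : fderiv ℝ f (x + z) + fderiv ℝ f (x - z) - (2 : ℝ) • fderiv ℝ f x
          = fderiv ℝ f (x + z) - fderiv ℝ f x - (fderiv ℝ f x - fderiv ℝ f (x - z)) := by
          rw [two_smul]; abel
        rw [e1]
        exact h1.trans (by gcongr)) (by simp) (by simp)
    simp only [add_zero, sub_zero, sub_self, _root_.smul_apply, hvn] at h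
    exact h.trans_eq (by ring)
  have h2 : ‖(2 : ℝ) • fderiv ℝ f x v‖ ≤ 2 * A + B * r ^ 3 := by
    have e1 : (2 : ℝ) • fderiv ℝ f x v = f (x + v) - f (x - v)
      - (f (x + v) - f (x - v) - (2 : ℝ) • fderiv ℝ f x v) := by abel
    rw [e1]
    have h3 := norm_sub_le (f (x + v) - f (x - v))
      (f (x + v) - f (x - v) - (2 : ℝ) • fderiv ℝ f x v)
    have h4 := norm_sub_le (f (x + v)) (f (x - v))
    linarith [hA (x + v), hA (x - v)]
  rw [hv, map_smul, smul_smul, norm_smul, Real.norm_of_nonneg (by positivity)] at h2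
  rw [le_div_iff₀ (by positivity)]
  linarith

/-- Interpolation: a bounded function with Lipschitz derivative has a small derivative. -/
theorem norm_fderiv_le_of_norm_le' {f : X → W} {A B r : ℝ} (hf : Differentiable ℝ f)
    (hA : ∀ x, ‖f x‖ ≤ A) (hB : ∀ x y, ‖fderiv ℝ f x - fderiv ℝ f y‖ ≤ B * ‖x - y‖)
    (hB0 : 0 ≤ B) (hr : 0 < r) (x : X) : ‖fderiv ℝ f x‖ ≤ (2 * A + B * r ^ 2) / r := by
  have hA0 : 0 ≤ A := (norm_nonneg _).trans (hA x)
  refine ContinuousLinearMap.opNorm_le_of_unit_norm (by positivity) fun e he => ?_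
  set v := r • e with hv
  have hvn : ‖v‖ = r := by rw [hv, norm_smul, he, mul_one, Real.norm_eq_abs, abs_of_pos hr]
  have h := norm_taylor_sub_le hf hB hB0 x v 0
  simp only [add_zero, sub_zero, norm_zero, hvn] at h
  have h2 : ‖fderiv ℝ f x v‖ ≤ 2 * A + B * r ^ 2 := by
    have e1 : fderiv ℝ f x v = f (x + v) - f x - (f (x + v) - f x - fderiv ℝ f x v) := by abel
    rw [e1]
    have h3 := norm_sub_le (f (x + v) - f x) (f (x + v) - f x - fderiv ℝ f x v)
    have h4 := norm_sub_le (f (x + v)) (f x)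
    linarith [hA (x + v), hA x]
  rw [hv, map_smul, norm_smul, Real.norm_of_nonneg hr.le] at h2
  rw [le_div_iff₀ hr]
  linarith

end Interpolation

/-! ### Mixed regularity in space and time -/

section SpaceTime

variable {X Y : Type*} [NormedAddCommGroup X] [NormedAddCommGroup Y]

/-- Boundedness, Lipschitz and Hölder continuity of a function on `[0, T] × X` and of its
increments. -/
structure SpaceTimeRegular (T C : ℝ) (f : ℝ → X → Y) : Prop where
  nonneg : 0 ≤ C
  bound : ∀ t ∈ Icc 0 T, ∀ x, ‖f t x‖ ≤ C
  lip : ∀ t ∈ Icc 0 T, ∀ x y, ‖f t x - f t y‖ ≤ C * ‖x - y‖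
  time : ∀ s ∈ Icc 0 T, ∀ t ∈ Icc 0 T, ∀ x, ‖f t x - f s x‖ ≤ C * |t - s| ^ (2 / 3 : ℝ)
  cross : ∀ s ∈ Icc 0 T, ∀ t ∈ Icc 0 T, ∀ x y,
    ‖f t x - f s x - (f t y - f s y)‖ ≤ C * |t - s| ^ (1 / 3 : ℝ) * ‖x - y‖
  second : ∀ t ∈ Icc 0 T, ∀ p q v,
    ‖f t (p + v) - f t p - (f t (q + v) - f t q)‖ ≤ C * ‖p - q‖ * ‖v‖

/-- Lowering an exponent for increments of a bounded function on an interval of any length: powers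
compare for $h\le1$, and the uniform bound serves for $h\ge1$. -/
theorem le_two_mul_rpow {h C p q x : ℝ} (hh : 0 ≤ h) (hC : 0 ≤ C) (hq : 0 < q) (hqp : q ≤ p)
    (h1 : x ≤ 2 * C * h ^ p) (h2 : x ≤ 2 * C) : x ≤ 2 * C * h ^ q := by
  rcases le_total h 1 with h' | h'
  · rcases hh.eq_or_lt with rfl | hh
    · rw [Real.zero_rpow (by linarith)] at h1 ⊢
      exact h1
    · exact h1.trans (by
        gcongr 2 * C * ?_; exact Real.rpow_le_rpow_of_exponent_ge hh h' hqp)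
  · exact h2.trans (le_mul_of_one_le_right (by positivity) (Real.one_le_rpow h' hq.le))

theorem SpaceTimeRegular.mono {T C C' : ℝ} {f : ℝ → X → Y} (hf : SpaceTimeRegular T C f)
    (hC : C ≤ C') : SpaceTimeRegular T C' f where
  nonneg := hf.nonneg.trans hC
  bound t ht x := (hf.bound t ht x).trans hC
  lip t ht x y := (hf.lip t ht x y).trans (by gcongr)
  time s hs t ht x := (hf.time s hs t ht x).trans (by gcongr)
  cross s hs t ht x y := (hf.cross s hs t ht x y).trans (by gcongr)
  second t ht p q v := (hf.second t ht p q v).trans (by gcongr)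

theorem SpaceTimeRegular.time' {T C : ℝ} {f : ℝ → X → Y} (hf : SpaceTimeRegular T C f)
    {s t : ℝ} (hs : s ∈ Icc 0 T) (ht : t ∈ Icc 0 T) (x : X) :
    ‖f t x - f s x‖ ≤ 2 * C * |t - s| ^ (1 / 3 : ℝ) := by
  have hC := hf.nonneg
  refine le_two_mul_rpow (p := 2 / 3) (abs_nonneg _) hC (by norm_num) (by norm_num) ?_ ?_
  · refine (hf.time s hs t ht x).trans ?_
    gcongr; linarith
  · linarith [norm_sub_le (f t x) (f s x), hf.bound t ht x, hf.bound s hs x]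

end SpaceTime

/-! ### Stability of the mixed regularity under composition of operators -/

section Composition

variable {X Y Z V : Type*} [NormedAddCommGroup X]
  [NormedAddCommGroup Y] [NormedSpace ℝ Y] [NormedAddCommGroup Z] [NormedSpace ℝ Z]
  [NormedAddCommGroup V] [NormedSpace ℝ V]

/-- A discrete Leibniz rule for second differences. -/
theorem norm_comp_four_corner_le (P₁ P₂ P₃ P₄ : Y →L[ℝ] Z) (G₁ G₂ G₃ G₄ : V →L[ℝ] Y) :
    ‖P₁.comp G₁ - P₂.comp G₂ - (P₃.comp G₃ - P₄.comp G₄)‖ ≤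
      ‖P₁ - P₂ - (P₃ - P₄)‖ * ‖G₁‖ + ‖P₂ - P₄‖ * ‖G₁ - G₂‖ + ‖P₃ - P₄‖ * ‖G₁ - G₃‖
        + ‖P₄‖ * ‖G₁ - G₂ - (G₃ - G₄)‖ := by
  have e : P₁.comp G₁ - P₂.comp G₂ - (P₃.comp G₃ - P₄.comp G₄) =
      (P₁ - P₂ - (P₃ - P₄)).comp G₁ + (P₂ - P₄).comp (G₁ - G₂) + (P₃ - P₄).comp (G₁ - G₃)
        + P₄.comp (G₁ - G₂ - (G₃ - G₄)) := by
    simp only [ContinuousLinearMap.comp_sub, ContinuousLinearMap.sub_comp]; abel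
  rw [e]
  refine norm_add₄_le.trans ?_
  gcongr <;> exact ContinuousLinearMap.opNorm_comp_le _ _

theorem norm_comp_sub_comp_le (P P' : Y →L[ℝ] Z) (G G' : V →L[ℝ] Y) :
    ‖P.comp G - P'.comp G'‖ ≤ ‖P - P'‖ * ‖G‖ + ‖P'‖ * ‖G - G'‖ := by
  have e : P.comp G - P'.comp G' = (P - P').comp G + P'.comp (G - G') := by
    simp only [ContinuousLinearMap.comp_sub, ContinuousLinearMap.sub_comp]; abel
  rw [e]
  refine (norm_add_le _ _).trans ?_
  gcongr <;> exact ContinuousLinearMap.opNorm_comp_le _ _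

/-- Meant for $\nabla\sigma$ and $\sigma$, so that $\nabla\sigma\,\sigma$ inherits their regularity.
The factor $6=1+2+2+1$ comes from the cross differences. -/
theorem SpaceTimeRegular.comp {T C : ℝ} {f : ℝ → X → Y →L[ℝ] Z} {g : ℝ → X → V →L[ℝ] Y}
    (hf : SpaceTimeRegular T C f) (hg : SpaceTimeRegular T C g) :
    SpaceTimeRegular T (6 * C ^ 2) (fun t x => (f t x).comp (g t x)) where
  nonneg := by positivity
  bound t ht x := by
    have hC := hf.nonneg
    calc _ ≤ ‖f t x‖ * ‖g t x‖ := ContinuousLinearMap.opNorm_comp_le _ _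
      _ ≤ C * C := by gcongr; exacts [hf.bound t ht x, hg.bound t ht x]
      _ ≤ _ := by nlinarith
  lip t ht x y := by
    have hC := hf.nonneg
    calc _ ≤ _ := norm_comp_sub_comp_le _ _ _ _
      _ ≤ C * ‖x - y‖ * C + C * (C * ‖x - y‖) := by
        gcongr; exacts [hf.lip t ht x y, hg.bound t ht x, hf.bound t ht y, hg.lip t ht x y]
      _ = 2 * C ^ 2 * ‖x - y‖ := by ring
      _ ≤ _ := by gcongr; norm_num
  time s hs t ht x := by
    have hC := hf.nonneg
    calc _ ≤ _ := norm_comp_sub_comp_le _ _ _ _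
      _ ≤ C * |t - s| ^ (2 / 3 : ℝ) * C + C * (C * |t - s| ^ (2 / 3 : ℝ)) := by
        gcongr; exacts [hf.time s hs t ht x, hg.bound t ht x, hf.bound s hs x, hg.time s hs t ht x]
      _ = 2 * C ^ 2 * |t - s| ^ (2 / 3 : ℝ) := by ring
      _ ≤ _ := by gcongr; norm_num
  cross s hs t ht x y := by
    have hC := hf.nonneg
    calc _ ≤ _ := norm_comp_four_corner_le _ _ _ _ _ _ _ _
      _ ≤ C * |t - s| ^ (1 / 3 : ℝ) * ‖x - y‖ * C
          + C * ‖x - y‖ * (2 * C * |t - s| ^ (1 / 3 : ℝ))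
          + 2 * C * |t - s| ^ (1 / 3 : ℝ) * (C * ‖x - y‖)
          + C * (C * |t - s| ^ (1 / 3 : ℝ) * ‖x - y‖) := by
        gcongr
        exacts [hf.cross s hs t ht x y, hg.bound t ht x, hf.lip s hs x y, hg.time' hs ht x,
          hf.time' hs ht y, hg.lip t ht x y, hf.bound s hs y, hg.cross s hs t ht x y]
      _ = _ := by ring
  second t ht p q v := by
    have hC := hf.nonneg
    have e : p + v - (q + v) = p - q := by abel
    have e' : ∀ z : X, z + v - z = v := fun z => by abel
    calc _ ≤ _ := norm_comp_four_corner_le _ _ _ _ _ _ _ _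
      _ ≤ C * ‖p - q‖ * ‖v‖ * C + C * ‖p - q‖ * (C * ‖v‖)
          + C * ‖v‖ * (C * ‖p - q‖) + C * (C * ‖p - q‖ * ‖v‖) := by
        gcongr
        · exact hf.second t ht p q v
        · exact hg.bound t ht _
        · exact hf.lip t ht p q
        · simpa [e'] using hg.lip t ht (p + v) p
        · simpa [e'] using hf.lip t ht (q + v) q
        · simpa [e] using hg.lip t ht (p + v) (q + v)
        · exact hf.bound t ht q
        · exact hg.second t ht p q v
      _ = 4 * C ^ 2 * ‖p - q‖ * ‖v‖ := by ring
      _ ≤ _ := by gcongr; norm_num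

end Composition

/-! ### Regularity of the diffusion coefficient by interpolation -/

section Field

variable {X Y : Type*} [NormedAddCommGroup X] [NormedSpace ℝ X]
  [NormedAddCommGroup Y] [NormedSpace ℝ Y]

/-- The regularity of a vector field and of its derivative in space that the estimates use. -/
structure FieldRegular (T C : ℝ) (σ : ℝ → X → Y) : Prop where
  differentiable : ∀ t ∈ Icc 0 T, Differentiable ℝ (σ t)
  base : SpaceTimeRegular T C σ
  deriv : SpaceTimeRegular T C (fun t => fderiv ℝ (σ t))
  time : ∀ s ∈ Icc 0 T, ∀ t ∈ Icc 0 T, ∀ x, ‖σ t x - σ s x‖ ≤ C * |t - s|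
  cross : ∀ s ∈ Icc 0 T, ∀ t ∈ Icc 0 T, ∀ x y,
    ‖σ t x - σ s x - (σ t y - σ s y)‖ ≤ C * |t - s| ^ (2 / 3 : ℝ) * ‖x - y‖

theorem FieldRegular.mono {T C C' : ℝ} {f : ℝ → X → Y} (hf : FieldRegular T C f)
    (hC : C ≤ C') : FieldRegular T C' f where
  differentiable := hf.differentiable
  base := hf.base.mono hC
  deriv := hf.deriv.mono hC
  time s hs t ht x := (hf.time s hs t ht x).trans (by gcongr)
  cross s hs t ht x y := (hf.cross s hs t ht x y).trans (by gcongr)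

theorem exists_fieldRegular {T C : ℝ} {σ : ℝ → X → Y}
    (hx : ∀ t ∈ Icc 0 T, ContDiff ℝ 3 (σ t) ∧
      ∀ x, ∀ k : ℕ, k ≤ 3 → ‖iteratedFDeriv ℝ k (σ t) x‖ ≤ C)
    (ht : ∀ x, ContDiffOn ℝ 1 (fun t => σ t x) (Icc 0 T) ∧
      ∀ t ∈ Icc (0 : ℝ) T, ‖derivWithin (fun t' => σ t' x) (Icc 0 T) t‖ ≤ C) :
    ∃ C, FieldRegular T C σ := by
  rcases lt_or_ge T 0 with hT | hT
  · have he : Icc 0 T = ∅ := Icc_eq_empty (not_le.2 hT)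
    refine ⟨0, ⟨?_, ⟨le_rfl, ?_, ?_, ?_, ?_, ?_⟩, ⟨le_rfl, ?_, ?_, ?_, ?_, ?_⟩, ?_, ?_⟩⟩ <;>
      simp [he]
  have hC0 : 0 ≤ C := by
    have := (hx 0 ⟨le_rfl, hT⟩).2 0 0 (by norm_num)
    exact (norm_nonneg _).trans this
  have d0 : ∀ t ∈ Icc 0 T, Differentiable ℝ (σ t) := fun t h =>
    (hx t h).1.differentiable (by norm_num)
  have c1 : ∀ t ∈ Icc 0 T, ContDiff ℝ 2 (fderiv ℝ (σ t)) := fun t h =>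
    (hx t h).1.fderiv_right (by norm_num)
  have d1 : ∀ t ∈ Icc 0 T, Differentiable ℝ (fderiv ℝ (σ t)) := fun t h =>
    (c1 t h).differentiable (by norm_num)
  have b0 : ∀ t ∈ Icc 0 T, ∀ x, ‖σ t x‖ ≤ C := fun t h x => by
    simpa using (hx t h).2 x 0 (by norm_num)
  have b1 : ∀ t ∈ Icc 0 T, ∀ x, ‖fderiv ℝ (σ t) x‖ ≤ C := fun t h x => by
    have := (hx t h).2 x 1 (by norm_num)
    rwa [norm_iteratedFDeriv_one] at this
  have l0 := fun t h => norm_sub_le_of_fderiv_le (d0 t h) (b1 t h)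
  have l1 := fun t h => norm_fderiv_sub_le_of_iteratedFDeriv ((hx t h).1.of_le (by norm_num))
    (fun x => (hx t h).2 x 2 (by norm_num))
  have l2 := fun t h => norm_fderiv_sub_le_of_iteratedFDeriv (c1 t h)
    (fun x => by rw [norm_iteratedFDeriv_fderiv]; exact (hx t h).2 x 3 (by norm_num))
  have s0 := fun t h => norm_second_difference_le (d0 t h) (l1 t h)
  have s1 := fun t h => norm_second_difference_le (d1 t h) (l2 t h)
  have time : ∀ s ∈ Icc 0 T, ∀ t ∈ Icc 0 T, ∀ x, ‖σ t x - σ s x‖ ≤ C * |t - s| := by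
    intro s hs t h x
    exact (convex_Icc 0 T).norm_image_sub_le_of_norm_derivWithin_le (f := fun t => σ t x)
      ((ht x).1.differentiableOn (by norm_num)) (ht x).2 hs h
  have fd : ∀ s ∈ Icc 0 T, ∀ t ∈ Icc 0 T, ∀ x,
      HasFDerivAt (fun x => σ t x - σ s x) (fderiv ℝ (σ t) x - fderiv ℝ (σ s) x) x :=
    fun s hs t h x => (d0 t h x).hasFDerivAt.sub (d0 s hs x).hasFDerivAt
  have fdd : ∀ s ∈ Icc 0 T, ∀ t ∈ Icc 0 T, ∀ x,
      HasFDerivAt (fun x => fderiv ℝ (σ t) x - fderiv ℝ (σ s) x)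
        (fderiv ℝ (fderiv ℝ (σ t)) x - fderiv ℝ (fderiv ℝ (σ s)) x) x :=
    fun s hs t h x => (d1 t h x).hasFDerivAt.sub (d1 s hs x).hasFDerivAt
  have pow3 : ∀ h : ℝ, 0 < h → (h ^ (1 / 3 : ℝ)) ^ 3 = h ∧
      h ^ (2 / 3 : ℝ) = (h ^ (1 / 3 : ℝ)) ^ 2 := fun h hh => by
    rw [← Real.rpow_mul_natCast hh.le, ← Real.rpow_mul_natCast hh.le]; norm_num
  -- Interpolation for $\sigma_t-\sigma_s$, of size $C|t-s|$ with second differences of the gradient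
  -- bounded through $\nabla^3\sigma$. The step $r=|t-s|^{1/3}$ balances the two terms.
  have time1 : ∀ s ∈ Icc 0 T, ∀ t ∈ Icc 0 T, ∀ x,
      ‖fderiv ℝ (σ t) x - fderiv ℝ (σ s) x‖ ≤ 2 * C * |t - s| ^ (2 / 3 : ℝ) := by
    intro s hs t h x
    rcases eq_or_ne t s with rfl | hne
    · simp
    have hpos : 0 < |t - s| := abs_pos.2 (sub_ne_zero.2 hne)
    have key := norm_fderiv_le_of_norm_le (fun x => (fd s hs t h x).differentiableAt)
      (B := 2 * C) (time s hs t h) (fun p q v => by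
        simp only [(fd s hs t h _).fderiv]
        have := norm_sub_le (fderiv ℝ (σ t) (p + v) - fderiv ℝ (σ t) p
            - (fderiv ℝ (σ t) (q + v) - fderiv ℝ (σ t) q))
          (fderiv ℝ (σ s) (p + v) - fderiv ℝ (σ s) p
            - (fderiv ℝ (σ s) (q + v) - fderiv ℝ (σ s) q))
        calc _ = _ := by congr 1; abel
          _ ≤ _ := this
          _ ≤ C * ‖p - q‖ * ‖v‖ + C * ‖p - q‖ * ‖v‖ := add_le_add (s1 t h p q v) (s1 s hs p q v)
          _ = _ := by ring)
      (by positivity) (Real.rpow_pos_of_pos hpos (1 / 3)) x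
    rw [(fd s hs t h x).fderiv] at key
    obtain ⟨e1, e2⟩ := pow3 _ hpos
    have hr := Real.rpow_pos_of_pos hpos (1 / 3)
    rw [e2]
    refine key.trans_eq ?_
    rw [div_eq_iff (by positivity)]
    linear_combination (-2 * C) * e1
  -- The same step for $\nabla\sigma_t-\nabla\sigma_s$, now of size $2C|t-s|^{2/3}$ with a Lipschitz
  -- derivative.
  have time2 : ∀ s ∈ Icc 0 T, ∀ t ∈ Icc 0 T, ∀ x,
      ‖fderiv ℝ (fderiv ℝ (σ t)) x - fderiv ℝ (fderiv ℝ (σ s)) x‖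
        ≤ 6 * C * |t - s| ^ (1 / 3 : ℝ) := by
    intro s hs t h x
    rcases eq_or_ne t s with rfl | hne
    · rw [sub_self, sub_self, abs_zero, Real.zero_rpow (by norm_num), mul_zero]
      exact (norm_zero (E := X →L[ℝ] X →L[ℝ] Y)).le
    have hpos : 0 < |t - s| := abs_pos.2 (sub_ne_zero.2 hne)
    have key := norm_fderiv_le_of_norm_le' (fun x => (fdd s hs t h x).differentiableAt)
      (B := 2 * C) (time1 s hs t h) (fun p q => by
        simp only [(fdd s hs t h _).fderiv]
        rw [sub_sub_sub_comm]
        refine (norm_sub_le _ _).trans ?_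
        linarith [l2 t h p q, l2 s hs p q])
      (by positivity) (Real.rpow_pos_of_pos hpos (1 / 3)) x
    rw [(fdd s hs t h x).fderiv] at key
    obtain ⟨e1, e2⟩ := pow3 _ hpos
    have hr := Real.rpow_pos_of_pos hpos (1 / 3)
    refine key.trans_eq ?_
    rw [div_eq_iff (by positivity), e2]
    ring
  have cross : ∀ s ∈ Icc 0 T, ∀ t ∈ Icc 0 T, ∀ x y,
      ‖σ t x - σ s x - (σ t y - σ s y)‖ ≤ 2 * C * |t - s| ^ (2 / 3 : ℝ) * ‖x - y‖ :=
    fun s hs t h x y => norm_sub_le_of_fderiv_le (fun x => (fd s hs t h x).differentiableAt)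
      (fun x => by rw [(fd s hs t h x).fderiv]; exact time1 s hs t h x) x y
  have cross1 : ∀ s ∈ Icc 0 T, ∀ t ∈ Icc 0 T, ∀ x y,
      ‖fderiv ℝ (σ t) x - fderiv ℝ (σ s) x - (fderiv ℝ (σ t) y - fderiv ℝ (σ s) y)‖
        ≤ 6 * C * |t - s| ^ (1 / 3 : ℝ) * ‖x - y‖ :=
    fun s hs t h x y => norm_sub_le_of_fderiv_le (fun x => (fdd s hs t h x).differentiableAt)
      (fun x => by rw [(fdd s hs t h x).fderiv]; exact time2 s hs t h x) x y
  refine ⟨6 * C, d0, ⟨by positivity, fun t h x => (b0 t h x).trans (by linarith),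
    fun t h x y => (l0 t h x y).trans (by gcongr; linarith), ?_, ?_,
    fun t h p q v => (s0 t h p q v).trans (by gcongr; linarith)⟩,
    ⟨by positivity, fun t h x => (b1 t h x).trans (by linarith),
    fun t h x y => (l1 t h x y).trans (by gcongr; linarith),
    fun s hs t h x => (time1 s hs t h x).trans (by gcongr; linarith), cross1,
    fun t h p q v => (s1 t h p q v).trans (by gcongr; linarith)⟩,
    fun s hs t h x => (time s hs t h x).trans (by gcongr; linarith),
    fun s hs t h x y => (cross s hs t h x y).trans (by gcongr; linarith)⟩
  · intro s hs t h x
    have : ‖σ t x - σ s x‖ ≤ 2 * C * |t - s| ^ (2 / 3 : ℝ) := by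
      refine le_two_mul_rpow (p := 1) (abs_nonneg _) hC0 (by norm_num) (by norm_num) ?_ ?_
      · rw [Real.rpow_one]
        exact (time s hs t h x).trans (by gcongr; linarith)
      · linarith [norm_sub_le (σ t x) (σ s x), b0 t h x, b0 s hs x]
    exact this.trans (by gcongr; linarith)
  · intro s hs t h x y
    have : ∀ x, ‖fderiv ℝ (σ t) x - fderiv ℝ (σ s) x‖ ≤ 2 * C * |t - s| ^ (1 / 3 : ℝ) :=
      fun x => le_two_mul_rpow (abs_nonneg _) hC0 (by norm_num) (by norm_num) (time1 s hs t h x)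
        (by linarith [norm_sub_le (fderiv ℝ (σ t) x) (fderiv ℝ (σ s) x), b1 t h x, b1 s hs x])
    have := norm_sub_le_of_fderiv_le (fun x => (fd s hs t h x).differentiableAt)
      (fun x => by rw [(fd s hs t h x).fderiv]; exact this x) x y
    exact this.trans (by gcongr; linarith)

end Field

/-! ### Second order expansion and its a priori estimate -/

section Davie

variable {d : ℕ} {X : Type*} [NormedAddCommGroup X] [NormedSpace ℝ X]

/-- The derivative `∇σ σ` along the driver of the vector field `σ` evaluated on a solution. -/
noncomputable def levyField (σ : ℝ → X → E d →L[ℝ] X) (t : ℝ) (x : X) : E d →L[ℝ] E d →L[ℝ] X :=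
  (fderiv ℝ (σ t) x).comp (σ t x)

/-- The second order expansion of the rough integral of `σ(·, x)`. -/
noncomputable def germ (σ : ℝ → X → E d →L[ℝ] X) (ζ : ℝ → E d) (A : ℝ → ℝ → Fin d → Fin d → ℝ)
    (x : ℝ → X) (s t : ℝ) : X :=
  σ s (x s) (inc ζ s t) + contract (levyField σ s (x s)) (A s t)

/-- The remainder of the second order expansion of a path with drift increments `J`. -/
noncomputable def davieRemainder (σ : ℝ → X → E d →L[ℝ] X) (ζ : ℝ → E d)
    (A : ℝ → ℝ → Fin d → Fin d → ℝ) (J : ℝ → ℝ → X) (x : ℝ → X) (s t : ℝ) : X :=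
  inc x s t - J s t - germ σ ζ A x s t

/-- Bounds on a driver and its area, with Chen's relation. -/
structure DriverBound (a b α N : ℝ) (ζ : ℝ → E d) (A : ℝ → ℝ → Fin d → Fin d → ℝ) : Prop where
  path : ∀ s t, a ≤ s → s ≤ t → t ≤ b → ‖inc ζ s t‖ ≤ N * (t - s) ^ α
  area : ∀ s t, a ≤ s → s ≤ t → t ≤ b → entrySum (A s t) ≤ N * (t - s) ^ (2 * α)
  chen : ∀ s u t, a ≤ s → s ≤ u → u ≤ t → t ≤ b → ∀ i j,
    delta A s u t i j = inc ζ s u i * inc ζ u t j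

/-- A vector field, a driver and drift increments on a short interval, with bounds. -/
structure DavieSetup (T a b α C N : ℝ) (σ : ℝ → X → E d →L[ℝ] X) (ζ : ℝ → E d)
    (A : ℝ → ℝ → Fin d → Fin d → ℝ) (J : ℝ → ℝ → X) : Prop where
  nonneg : 0 ≤ a
  le_end : b ≤ T
  short : b - a ≤ 1
  lt_exponent : 1 / 3 < α
  exponent_le : α ≤ 1 / 2
  one_le_field : 1 ≤ C
  one_le_driver : 1 ≤ N
  field : FieldRegular T C σ
  levy : SpaceTimeRegular T C (levyField σ)
  driver : DriverBound a b α N ζ A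
  drift_add : ∀ s u t, a ≤ s → s ≤ u → u ≤ t → t ≤ b → J s t = J s u + J u t
  drift_le : ∀ s t, a ≤ s → s ≤ t → t ≤ b → ‖J s t‖ ≤ C * (t - s)

/-- For $h\le1$ powers decrease in the exponent. The condition $\alpha\le1/2$ places the drift at
order $2\alpha$ and the $2/3$-Hölder time dependence at order $\alpha$. -/
theorem rpow_bounds {h α : ℝ} (h0 : 0 ≤ h) (h1 : h ≤ 1) (hα : 1 / 3 < α) (hα' : α ≤ 1 / 2) :
    0 ≤ h ^ α ∧ h ^ α ≤ 1 ∧ h ^ (2 * α) = (h ^ α) ^ 2 ∧ h ≤ (h ^ α) ^ 2 ∧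
      h ^ α ≤ h ^ (1 / 3 : ℝ) ∧ h ^ (2 / 3 : ℝ) = (h ^ (1 / 3 : ℝ)) ^ 2 ∧
      h ^ (1 / 3 : ℝ) ≤ 1 ∧ h ^ (2 / 3 : ℝ) ≤ h ^ α := by
  have e : h ^ (2 * α) = (h ^ α) ^ 2 := by
    rw [← Real.rpow_mul_natCast h0]; congr 1; push_cast; ring
  refine ⟨by positivity, Real.rpow_le_one h0 h1 (by linarith), e, ?_,
    Real.rpow_le_rpow_of_exponent_ge' h0 h1 (by norm_num) hα.le, ?_,
    Real.rpow_le_one h0 h1 (by norm_num),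
    Real.rpow_le_rpow_of_exponent_ge' h0 h1 (by linarith) (by linarith)⟩
  · rw [← e]
    simpa using Real.rpow_le_rpow_of_exponent_ge' h0 h1 (by linarith) (show 2 * α ≤ 1 by linarith)
  · rw [← Real.rpow_mul_natCast h0]; norm_num

variable {T a b α C N : ℝ} {σ : ℝ → X → E d →L[ℝ] X} {ζ ζ' : ℝ → E d}
  {A A' : ℝ → ℝ → Fin d → Fin d → ℝ} {J J' : ℝ → ℝ → X} {x x' : ℝ → X}

theorem DavieSetup.mem (H : DavieSetup T a b α C N σ ζ A J) {s : ℝ} (h : a ≤ s) (h' : s ≤ b) :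
    s ∈ Icc 0 T := ⟨H.nonneg.trans h, h'.trans H.le_end⟩

/-- Increments of the path and of the drift are additive and drop out, and Chen's relation rewrites
the area part. What survives is the defect prescribed for the sewing term in `IsRoughIntegral`. The
identity uses no equation for $x$. -/
theorem delta_davieRemainder {s u t : ℝ}
    (hchen : ∀ i j, delta A s u t i j = inc ζ s u i * inc ζ u t j)
    (hJ : J s t = J s u + J u t) :
    delta (davieRemainder σ ζ A J x) s u t =
      (inc (fun r => σ r (x r)) s u - levyField σ s (x s) (inc ζ s u)) (inc ζ u t) +
        contract (inc (fun r => levyField σ r (x r)) s u) (A u t) := by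
  have hA : contract (levyField σ s (x s)) (delta A s u t)
      = levyField σ s (x s) (inc ζ s u) (inc ζ u t) := by
    rw [← contract_mul]
    congr 1
    ext i j
    exact hchen i j
  simp only [delta, contract_sub_right] at hA
  have hA' : contract (levyField σ s (x s)) (A s t) = levyField σ s (x s) (inc ζ s u) (inc ζ u t)
      + contract (levyField σ s (x s)) (A s u) + contract (levyField σ s (x s)) (A u t) := by
    rw [← hA]; abel
  have hζ : inc ζ s t = inc ζ s u + inc ζ u t := by simp [inc]
  have hx : inc x s t = inc x s u + inc x u t := by simp [inc]
  have h1 : inc (fun r => σ r (x r)) s u = σ u (x u) - σ s (x s) := rfl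
  have h2 : inc (fun r => levyField σ r (x r)) s u
    = levyField σ u (x u) - levyField σ s (x s) := rfl
  simp only [delta, davieRemainder, germ, hJ, hA', hζ, hx, h1, h2,
    contract_sub_left, _root_.sub_apply, map_add]
  abel

theorem DavieSetup.delta_davieRemainder (H : DavieSetup T a b α C N σ ζ A J) {s u t : ℝ}
    (hs : a ≤ s) (hsu : s ≤ u) (hut : u ≤ t) (ht : t ≤ b) :
    delta (davieRemainder σ ζ A J x) s u t =
      (inc (fun r => σ r (x r)) s u - levyField σ s (x s) (inc ζ s u)) (inc ζ u t) +
        contract (inc (fun r => levyField σ r (x r)) s u) (A u t) :=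
  RoughControl.delta_davieRemainder (H.driver.chen s u t hs hsu hut ht)
    (H.drift_add s u t hs hsu hut ht)

/-- With $w=\delta x$ and $w-v=R$, the bound is quadratic only in the known part $v$ and stays
linear in $R$. A term $|R|^2$ could not be absorbed by sewing. -/
theorem norm_taylor_le_split {W : Type*} [NormedAddCommGroup W] [NormedSpace ℝ W] {f : X → W}
    (hf : Differentiable ℝ f) (hC0 : 0 ≤ C) (hb : ∀ x, ‖fderiv ℝ f x‖ ≤ C)
    (hC : ∀ x y, ‖fderiv ℝ f x - fderiv ℝ f y‖ ≤ C * ‖x - y‖) (p v w : X) :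
    ‖f (p + w) - f p - fderiv ℝ f p w‖ ≤ C * ‖v‖ ^ 2 + 2 * C * ‖w - v‖ := by
  have h1 := norm_taylor_sub_le hf hC hC0 p v 0
  have h2 := norm_sub_le_of_fderiv_le hf hb (p + w) (p + v)
  have h3 := (fderiv ℝ f p).le_of_opNorm_le (hb p) (w - v)
  simp only [add_zero, sub_zero, norm_zero, add_sub_add_left_eq_sub] at h1 h2
  have e : f (p + w) - f p - fderiv ℝ f p w = (f (p + v) - f p - fderiv ℝ f p v)
      + (f (p + w) - f (p + v)) - fderiv ℝ f p (w - v) := by rw [map_sub]; abel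
  rw [e]
  refine (norm_sub_le _ _).trans ?_
  have := norm_add_le (f (p + v) - f p - fderiv ℝ f p v) (f (p + w) - f (p + v))
  nlinarith

section Single

variable (H : DavieSetup T a b α C N σ ζ A J) {s u : ℝ} (hs : a ≤ s) (hsu : s ≤ u) (hu : u ≤ b)
include H hs hsu hu

theorem DavieSetup.bounds_at : u - s ≤ 1 ∧ 0 ≤ u - s :=
  ⟨by linarith [H.short], by linarith⟩

theorem DavieSetup.norm_area_term_le (x : ℝ → X) :
    ‖contract (levyField σ s (x s)) (A s u)‖ ≤ C * N * ((u - s) ^ α) ^ 2 := by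
  obtain ⟨h1, h0⟩ := H.bounds_at hs hsu hu
  obtain ⟨p0, p1, e2, hh, -⟩ := rpow_bounds h0 h1 H.lt_exponent H.exponent_le
  have hC := H.one_le_field
  have hA := H.driver.area s u hs hsu hu
  rw [e2] at hA
  calc _ ≤ _ := norm_contract_le _ _
    _ ≤ C * (N * ((u - s) ^ α) ^ 2) := by
      gcongr
      · exact entrySum_nonneg _
      · exact H.levy.bound s (H.mem hs (hsu.trans hu)) _
    _ = _ := by ring

theorem DavieSetup.norm_inc_sub_field_le (x : ℝ → X) :
    ‖inc x s u - σ s (x s) (inc ζ s u)‖ ≤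
      2 * C * N * ((u - s) ^ α) ^ 2 + ‖davieRemainder σ ζ A J x s u‖ := by
  obtain ⟨h1, h0⟩ := H.bounds_at hs hsu hu
  obtain ⟨p0, p1, e2, hh, -⟩ := rpow_bounds h0 h1 H.lt_exponent H.exponent_le
  have hC := H.one_le_field
  have hN := H.one_le_driver
  have e : inc x s u - σ s (x s) (inc ζ s u) = J s u + contract (levyField σ s (x s)) (A s u)
      + davieRemainder σ ζ A J x s u := by simp only [davieRemainder, germ]; abel
  have hJ : ‖J s u‖ ≤ C * N * ((u - s) ^ α) ^ 2 := by
    calc _ ≤ _ := H.drift_le s u hs hsu hu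
      _ ≤ C * ((u - s) ^ α) ^ 2 := by gcongr
      _ ≤ _ := by gcongr; exact le_mul_of_one_le_right (by linarith) hN
  rw [e]
  refine norm_add₃_le.trans ?_
  linarith [H.norm_area_term_le hs hsu hu x]

theorem DavieSetup.norm_field_term_le (x : ℝ → X) :
    ‖σ s (x s) (inc ζ s u)‖ ≤ C * N * (u - s) ^ α := by
  have hC := H.one_le_field
  calc _ ≤ _ := (σ s (x s)).le_opNorm _
    _ ≤ C * (N * (u - s) ^ α) := by
      gcongr
      · exact H.field.base.bound s (H.mem hs (hsu.trans hu)) _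
      · exact H.driver.path s u hs hsu hu
    _ = _ := by ring

theorem DavieSetup.norm_inc_sub_remainder_le (x : ℝ → X) :
    ‖inc x s u - davieRemainder σ ζ A J x s u‖ ≤ 3 * C * N * (u - s) ^ α := by
  obtain ⟨h1, h0⟩ := H.bounds_at hs hsu hu
  obtain ⟨p0, p1, e2, hh, -⟩ := rpow_bounds h0 h1 H.lt_exponent H.exponent_le
  have hC := H.one_le_field
  have hN := H.one_le_driver
  have hp : ((u - s) ^ α) ^ 2 ≤ (u - s) ^ α := by nlinarith
  have e : inc x s u - davieRemainder σ ζ A J x s u = J s u + σ s (x s) (inc ζ s u)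
      + contract (levyField σ s (x s)) (A s u) := by simp only [davieRemainder, germ]; abel
  have hJ : ‖J s u‖ ≤ C * N * (u - s) ^ α := by
    calc _ ≤ _ := H.drift_le s u hs hsu hu
      _ ≤ C * (u - s) ^ α := by gcongr; linarith
      _ ≤ _ := by gcongr; exact le_mul_of_one_le_right (by linarith) hN
  have hA : ‖contract (levyField σ s (x s)) (A s u)‖ ≤ C * N * (u - s) ^ α :=
    (H.norm_area_term_le hs hsu hu x).trans (by gcongr)
  rw [e]
  refine norm_add₃_le.trans ?_
  linarith [H.norm_field_term_le hs hsu hu x]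

theorem DavieSetup.norm_field_remainder_le (x : ℝ → X) :
    ‖inc (fun r => σ r (x r)) s u - levyField σ s (x s) (inc ζ s u)‖ ≤
      12 * C ^ 3 * N ^ 2 * ((u - s) ^ α) ^ 2 + 3 * C * ‖davieRemainder σ ζ A J x s u‖ := by
  obtain ⟨h1, h0⟩ := H.bounds_at hs hsu hu
  obtain ⟨p0, p1, e2, hh, -⟩ := rpow_bounds h0 h1 H.lt_exponent H.exponent_le
  have hC := H.one_le_field
  have hN := H.one_le_driver
  have ms := H.mem hs (hsu.trans hu)
  have mu := H.mem (hs.trans hsu) hu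
  set R := davieRemainder σ ζ A J x s u with hR
  set p := (u - s) ^ α with hp
  -- A time increment, a Taylor remainder in space, and $\nabla\sigma$ applied to $\delta
  -- x-\sigma\,\delta\zeta$: each is of order $2\alpha$ up to a multiple of $|R|$.
  have e : inc (fun r => σ r (x r)) s u - levyField σ s (x s) (inc ζ s u) =
      (σ u (x u) - σ s (x u)) + (σ s (x s + inc x s u) - σ s (x s)
        - fderiv ℝ (σ s) (x s) (inc x s u))
      + fderiv ℝ (σ s) (x s) (inc x s u - σ s (x s) (inc ζ s u)) := by
    simp only [inc, levyField, ContinuousLinearMap.comp_apply, map_sub, add_sub_cancel]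
    abel
  have h1 : ‖σ u (x u) - σ s (x u)‖ ≤ C * p ^ 2 := by
    have := H.field.time s ms u mu (x u)
    rw [abs_of_nonneg h0] at this
    exact this.trans (by gcongr)
  have h2 := norm_taylor_le_split (H.field.differentiable s ms) (by linarith)
    (H.field.deriv.bound s ms) (H.field.deriv.lip s ms) (x s) (inc x s u - R) (inc x s u)
  have h3 := (fderiv ℝ (σ s) (x s)).le_of_opNorm_le (H.field.deriv.bound s ms (x s))
    (inc x s u - σ s (x s) (inc ζ s u))
  have h4 := H.norm_inc_sub_field_le hs hsu hu x
  have h5 := H.norm_inc_sub_remainder_le hs hsu hu x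
  rw [← hR, ← hp] at h4 h5
  rw [sub_sub_cancel] at h2
  rw [e]
  refine norm_add₃_le.trans ?_
  have h6 : C * ‖inc x s u - R‖ ^ 2 ≤ 9 * C ^ 3 * N ^ 2 * p ^ 2 := by
    calc _ ≤ C * (3 * C * N * p) ^ 2 := by gcongr
      _ = _ := by ring
  have h7 : C * ‖inc x s u - σ s (x s) (inc ζ s u)‖ ≤ 2 * C ^ 2 * N * p ^ 2 + C * ‖R‖ := by
    calc _ ≤ C * (2 * C * N * p ^ 2 + ‖R‖) := by gcongr
      _ = _ := by ring
  have h8 : C * p ^ 2 ≤ C ^ 3 * N ^ 2 * p ^ 2 := by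
    gcongr
    calc C = C ^ 1 * 1 ^ 2 := by ring
      _ ≤ C ^ 3 * N ^ 2 := by gcongr; first | exact hC | norm_num
  have h9 : C ^ 2 * N * p ^ 2 ≤ C ^ 3 * N ^ 2 * p ^ 2 := by
    have : C ^ 2 * N ^ 1 ≤ C ^ 3 * N ^ 2 := by gcongr <;> first | assumption | norm_num
    rw [pow_one] at this
    exact mul_le_mul_of_nonneg_right this (by positivity)
  linarith

theorem DavieSetup.norm_inc_levy_le (x : ℝ → X) :
    ‖inc (fun r => levyField σ r (x r)) s u‖ ≤
      4 * C ^ 2 * N * (u - s) ^ α + C * ‖davieRemainder σ ζ A J x s u‖ := by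
  obtain ⟨h1, h0⟩ := H.bounds_at hs hsu hu
  obtain ⟨p0, p1, e2, hh, -, -, -, hq⟩ := rpow_bounds h0 h1 H.lt_exponent H.exponent_le
  have hC := H.one_le_field
  have hN := H.one_le_driver
  have ms := H.mem hs (hsu.trans hu)
  have mu := H.mem (hs.trans hsu) hu
  set R := davieRemainder σ ζ A J x s u with hR
  set p := (u - s) ^ α with hp
  have e : inc (fun r => levyField σ r (x r)) s u = (levyField σ u (x u) - levyField σ s (x u))
      + (levyField σ s (x u) - levyField σ s (x s)) := by simp only [inc]; abel
  have h2 : ‖levyField σ u (x u) - levyField σ s (x u)‖ ≤ C ^ 2 * N * p := by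
    have := H.levy.time s ms u mu (x u)
    rw [abs_of_nonneg h0] at this
    calc _ ≤ C * p := this.trans (by gcongr)
      _ = C ^ 1 * 1 * p := by ring
      _ ≤ _ := by gcongr; first | assumption | norm_num
  have h3 := H.levy.lip s ms (x u) (x s)
  have h4 : ‖x u - x s‖ ≤ 3 * C * N * p + ‖R‖ := by
    have e' : x u - x s = (inc x s u - R) + R := by simp [inc]
    rw [e']
    refine (norm_add_le _ _).trans ?_
    linarith [H.norm_inc_sub_remainder_le hs hsu hu x]
  rw [e]
  refine (norm_add_le (E := E d →L[ℝ] E d →L[ℝ] X) _ _).trans ?_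
  have h5 : C * ‖x u - x s‖ ≤ 3 * C ^ 2 * N * p + C * ‖R‖ := by
    calc _ ≤ C * (3 * C * N * p + ‖R‖) := by gcongr
      _ = _ := by ring
  linarith

-- The two terms of the defect pair orders $2\alpha$ and $\alpha$, respectively $\alpha$ and
-- $2\alpha$. On intervals of length at most one, $3\alpha$ may be lowered to $2/3+\alpha$, the
-- order that is also available for differences of solutions.
omit hu in
theorem DavieSetup.norm_delta_davieRemainder_le (x : ℝ → X) {t : ℝ} (hut : u ≤ t) (ht : t ≤ b) :
    ‖delta (davieRemainder σ ζ A J x) s u t‖ ≤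
      16 * C ^ 3 * N ^ 3 * (t - s) ^ (2 / 3 + α) +
        4 * C * N * (t - s) ^ α * ‖davieRemainder σ ζ A J x s u‖ := by
  have hu := hut.trans ht
  obtain ⟨h1, h0⟩ := H.bounds_at hs (hsu.trans hut) ht
  obtain ⟨p0, p1, e2, hh, hpq, e3, q1, hq⟩ := rpow_bounds h0 h1 H.lt_exponent H.exponent_le
  have hα := H.lt_exponent
  have hC := H.one_le_field
  have hN := H.one_le_driver
  rw [H.delta_davieRemainder hs hsu hut ht]
  set R := davieRemainder σ ζ A J x s u with hR
  set p := (t - s) ^ α with hp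
  have hsu0 : 0 ≤ u - s := by linarith
  have hut0 : 0 ≤ t - u := by linarith
  have p1' : (u - s) ^ α ≤ p := Real.rpow_le_rpow hsu0 (by linarith) (by linarith)
  have p2' : (t - u) ^ α ≤ p := Real.rpow_le_rpow hut0 (by linarith) (by linarith)
  have p3' : (t - u) ^ (2 * α) ≤ p ^ 2 := by
    rw [← e2]; exact Real.rpow_le_rpow hut0 (by linarith) (by linarith)
  have b1 := H.norm_field_remainder_le hs hsu hu x
  have b2 := H.norm_inc_levy_le hs hsu hu x
  rw [← hR] at b1 b2
  have b3 := H.driver.path u t (hs.trans hsu) hut ht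
  have b4 := H.driver.area u t (hs.trans hsu) hut ht
  have hp3 : p ^ 3 ≤ (t - s) ^ (2 / 3 + α) := by
    rw [Real.rpow_add' h0 (by linarith), e3]
    calc p ^ 3 = p ^ 2 * p := by ring
      _ ≤ _ := by gcongr
  refine (norm_add_le _ _).trans ?_
  have c1 : ‖(inc (fun r => σ r (x r)) s u - levyField σ s (x s) (inc ζ s u)) (inc ζ u t)‖ ≤
      (12 * C ^ 3 * N ^ 2 * p ^ 2 + 3 * C * ‖R‖) * (N * p) := by
    refine (ContinuousLinearMap.le_opNorm _ _).trans ?_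
    gcongr
    · exact b1.trans (by gcongr)
    · exact b3.trans (by gcongr)
  have c2 : ‖contract (inc (fun r => levyField σ r (x r)) s u) (A u t)‖ ≤
      (4 * C ^ 2 * N * p + C * ‖R‖) * (N * p ^ 2) := by
    refine (norm_contract_le _ _).trans ?_
    gcongr
    · exact entrySum_nonneg _
    · exact b2.trans (by gcongr)
    · exact b4.trans (by gcongr)
  have c3 : 16 * C ^ 3 * N ^ 3 * p ^ 3 ≤ 16 * C ^ 3 * N ^ 3 * (t - s) ^ (2 / 3 + α) := by gcongr
  have c4 : C ^ 2 * N ^ 2 * p ^ 3 ≤ C ^ 3 * N ^ 3 * p ^ 3 := by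
    gcongr <;> first | assumption | norm_num
  have c5 : C * N * ‖R‖ * p ^ 2 ≤ C * N * ‖R‖ * p := by
    gcongr; nlinarith
  nlinarith

end Single

/-- The a priori estimate: on short intervals the remainder has a universal bound. -/
theorem DavieSetup.norm_davieRemainder_le (H : DavieSetup T a b α C N σ ζ A J)
    (hsmall : sewingConst (2 / 3 + α) * (4 * C * N) * (b - a) ^ α ≤ 1 / 2)
    {θ M : ℝ} (hθ : 1 < θ)
    (hR : ∀ s t, a ≤ s → s ≤ t → t ≤ b → ‖davieRemainder σ ζ A J x s t‖ ≤ M * (t - s) ^ θ)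
    {s t : ℝ} (hs : a ≤ s) (hst : s ≤ t) (ht : t ≤ b) :
    ‖davieRemainder σ ζ A J x s t‖ ≤
      2 * (sewingConst (2 / 3 + α) * (16 * C ^ 3 * N ^ 3)) * (t - s) ^ (2 / 3 + α) := by
  have hα := H.lt_exponent
  have hC := H.one_le_field
  have hN := H.one_le_driver
  exact norm_le_of_delta_le_self (by linarith) (by linarith) hθ (by linarith) H.short
    (by positivity) (by positivity) hsmall hR
    (fun s u t hs hsu hut ht => H.norm_delta_davieRemainder_le hs hsu x hut ht) hs hst ht

end Davie

/-! ### Stability on short intervals -/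

section Stability

variable {d : ℕ} {X : Type*} [NormedAddCommGroup X] [NormedSpace ℝ X]

/-- Two paths with drift increments and drivers that are close to each other, with bounds on the
remainders of both. -/
structure DavieClose (a b α C M S ϱ : ℝ) (σ : ℝ → X → E d →L[ℝ] X) (ζ : ℝ → E d)
    (A : ℝ → ℝ → Fin d → Fin d → ℝ) (J : ℝ → ℝ → X) (x : ℝ → X) (ζ' : ℝ → E d)
    (A' : ℝ → ℝ → Fin d → Fin d → ℝ) (J' : ℝ → ℝ → X) (x' : ℝ → X) : Prop where
  bound_nonneg : 0 ≤ M
  path_nonneg : 0 ≤ S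
  driver_nonneg : 0 ≤ ϱ
  rem : ∀ s t, a ≤ s → s ≤ t → t ≤ b →
    ‖davieRemainder σ ζ A J x s t‖ ≤ M * (t - s) ^ (2 / 3 + α)
  rem' : ∀ s t, a ≤ s → s ≤ t → t ≤ b →
    ‖davieRemainder σ ζ' A' J' x' s t‖ ≤ M * (t - s) ^ (2 / 3 + α)
  path : ∀ s, a ≤ s → s ≤ b → ‖x s - x' s‖ ≤ S
  driver : ∀ s t, a ≤ s → s ≤ t → t ≤ b → ‖inc ζ s t - inc ζ' s t‖ ≤ ϱ * (t - s) ^ α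
  area : ∀ s t, a ≤ s → s ≤ t → t ≤ b → entrySum (A s t - A' s t) ≤ ϱ * (t - s) ^ (2 * α)
  drift : ∀ s t, a ≤ s → s ≤ t → t ≤ b → ‖J s t - J' s t‖ ≤ C * S * (t - s)

variable {T a b α C N M S ϱ : ℝ} {σ : ℝ → X → E d →L[ℝ] X} {ζ ζ' : ℝ → E d}
  {A A' : ℝ → ℝ → Fin d → Fin d → ℝ} {J J' : ℝ → ℝ → X} {x x' : ℝ → X}

theorem norm_apply_sub_apply_le {Y Z : Type*} [NormedAddCommGroup Y] [NormedSpace ℝ Y]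
    [NormedAddCommGroup Z] [NormedSpace ℝ Z] (P Q : Y →L[ℝ] Z) (v w : Y) :
    ‖P v - Q w‖ ≤ ‖P - Q‖ * ‖v‖ + ‖Q‖ * ‖v - w‖ := by
  have e : P v - Q w = (P - Q) v + Q (v - w) := by simp
  rw [e]
  exact (norm_add_le _ _).trans (add_le_add (ContinuousLinearMap.le_opNorm _ _)
    (ContinuousLinearMap.le_opNorm _ _))

theorem norm_contract_sub_contract_le (P Q : E d →L[ℝ] E d →L[ℝ] X) (B B' : Fin d → Fin d → ℝ) :
    ‖contract P B - contract Q B'‖ ≤ ‖P - Q‖ * entrySum B + ‖Q‖ * entrySum (B - B') := by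
  have e : contract P B - contract Q B' = contract (P - Q) B + contract Q (B - B') := by
    rw [contract_sub_left, contract_sub_right]; abel
  rw [e]
  exact (norm_add_le _ _).trans (add_le_add (norm_contract_le _ _) (norm_contract_le _ _))

section Local

variable (H : DavieSetup T a b α C N σ ζ A J) (H' : DavieSetup T a b α C N σ ζ' A' J')
  (D : DavieClose a b α C M S ϱ σ ζ A J x ζ' A' J' x') {s u : ℝ} (hs : a ≤ s) (hsu : s ≤ u)
  (hu : u ≤ b)
include H hs hsu hu

/-- Holds since $2\alpha\le2/3+\alpha$ and the interval has length at most one. -/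
theorem DavieSetup.remainder_rpow_le : (u - s) ^ (2 / 3 + α) ≤ ((u - s) ^ α) ^ 2 := by
  obtain ⟨h1, h0⟩ := H.bounds_at hs hsu hu
  obtain ⟨p0, p1, e2, -⟩ := rpow_bounds h0 h1 H.lt_exponent H.exponent_le
  rw [← e2]
  exact Real.rpow_le_rpow_of_exponent_ge' h0 h1 (by linarith [H.lt_exponent])
    (by linarith [H.exponent_le])

theorem DavieSetup.norm_inc_le (hM : 0 ≤ M)
    (hR : ‖davieRemainder σ ζ A J x s u‖ ≤ M * (u - s) ^ (2 / 3 + α)) :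
    ‖inc x s u‖ ≤ (3 * C * N + M) * (u - s) ^ α := by
  obtain ⟨h1, h0⟩ := H.bounds_at hs hsu hu
  obtain ⟨p0, p1, e2, -⟩ := rpow_bounds h0 h1 H.lt_exponent H.exponent_le
  have h2 := H.norm_inc_sub_remainder_le hs hsu hu x
  have h3 := norm_le_norm_sub_add (inc x s u) (davieRemainder σ ζ A J x s u)
  have h4 : ‖davieRemainder σ ζ A J x s u‖ ≤ M * (u - s) ^ α := hR.trans
    (mul_le_mul_of_nonneg_left
      ((H.remainder_rpow_le hs hsu hu).trans (pow_le_of_le_one p0 p1 two_ne_zero)) hM)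
  linarith

include D

theorem DavieClose.norm_area_term_sub_le :
    ‖contract (levyField σ s (x s)) (A s u) - contract (levyField σ s (x' s)) (A' s u)‖ ≤
      C * N * (S + ϱ) * ((u - s) ^ α) ^ 2 := by
  obtain ⟨h1, h0⟩ := H.bounds_at hs hsu hu
  obtain ⟨p0, p1, e2, -⟩ := rpow_bounds h0 h1 H.lt_exponent H.exponent_le
  have hC := H.one_le_field
  have hN := H.one_le_driver
  have hS := D.path_nonneg
  have hϱ := D.driver_nonneg
  have ms := H.mem hs (hsu.trans hu)
  have hA := H.driver.area s u hs hsu hu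
  have hA' := D.area s u hs hsu hu
  rw [e2] at hA hA'
  calc _ ≤ _ := norm_contract_sub_contract_le _ _ _ _
    _ ≤ C * S * (N * ((u - s) ^ α) ^ 2) + C * (ϱ * ((u - s) ^ α) ^ 2) := by
      gcongr
      · exact entrySum_nonneg _
      · exact (H.levy.lip s ms _ _).trans (by gcongr; exact D.path s hs (hsu.trans hu))
      · exact entrySum_nonneg _
      · exact H.levy.bound s ms _
    _ ≤ C * S * (N * ((u - s) ^ α) ^ 2) + C * N * (ϱ * ((u - s) ^ α) ^ 2) := by
      gcongr; exact le_mul_of_one_le_right (by linarith) hN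
    _ = _ := by ring

theorem DavieClose.norm_inc_sub_field_sub_le :
    ‖inc x s u - σ s (x s) (inc ζ s u) - (inc x' s u - σ s (x' s) (inc ζ' s u))‖ ≤
      2 * C * N * (S + ϱ) * ((u - s) ^ α) ^ 2 +
        ‖davieRemainder σ ζ A J x s u - davieRemainder σ ζ' A' J' x' s u‖ := by
  obtain ⟨h1, h0⟩ := H.bounds_at hs hsu hu
  obtain ⟨p0, p1, e2, hh, -⟩ := rpow_bounds h0 h1 H.lt_exponent H.exponent_le
  have hC := H.one_le_field
  have hN := H.one_le_driver
  have hS := D.path_nonneg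
  have hϱ := D.driver_nonneg
  have hJ : ‖J s u - J' s u‖ ≤ C * N * (S + ϱ) * ((u - s) ^ α) ^ 2 := by
    calc _ ≤ _ := D.drift s u hs hsu hu
      _ = C * 1 * S * (u - s) := by ring
      _ ≤ _ := by gcongr; linarith
  have e : inc x s u - σ s (x s) (inc ζ s u) - (inc x' s u - σ s (x' s) (inc ζ' s u)) =
      (J s u - J' s u) + (contract (levyField σ s (x s)) (A s u)
        - contract (levyField σ s (x' s)) (A' s u))
      + (davieRemainder σ ζ A J x s u - davieRemainder σ ζ' A' J' x' s u) := by
    simp only [davieRemainder, germ]; abel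
  rw [e]
  refine norm_add₃_le.trans ?_
  linarith [D.norm_area_term_sub_le H hs hsu hu]

theorem DavieClose.norm_inc_sub_remainder_sub_le :
    ‖inc x s u - inc x' s u
      - (davieRemainder σ ζ A J x s u - davieRemainder σ ζ' A' J' x' s u)‖ ≤
      3 * C * N * (S + ϱ) * (u - s) ^ α := by
  obtain ⟨h1, h0⟩ := H.bounds_at hs hsu hu
  obtain ⟨p0, p1, e2, hh, -⟩ := rpow_bounds h0 h1 H.lt_exponent H.exponent_le
  have hC := H.one_le_field
  have hN := H.one_le_driver
  have hS := D.path_nonneg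
  have hϱ := D.driver_nonneg
  have ms := H.mem hs (hsu.trans hu)
  have hp : ((u - s) ^ α) ^ 2 ≤ (u - s) ^ α := by nlinarith
  have hJ : ‖J s u - J' s u‖ ≤ C * N * (S + ϱ) * (u - s) ^ α := by
    calc _ ≤ _ := D.drift s u hs hsu hu
      _ = C * 1 * S * (u - s) := by ring
      _ ≤ _ := by gcongr <;> linarith
  have hA : ‖contract (levyField σ s (x s)) (A s u) - contract (levyField σ s (x' s)) (A' s u)‖ ≤
      C * N * (S + ϱ) * (u - s) ^ α :=
    (D.norm_area_term_sub_le H hs hsu hu).trans (by gcongr)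
  have hF : ‖σ s (x s) (inc ζ s u) - σ s (x' s) (inc ζ' s u)‖ ≤ C * N * (S + ϱ) * (u - s) ^ α := by
    calc _ ≤ _ := norm_apply_sub_apply_le _ _ _ _
      _ ≤ C * S * (N * (u - s) ^ α) + C * (ϱ * (u - s) ^ α) := by
        gcongr
        · exact (H.field.base.lip s ms _ _).trans (by gcongr; exact D.path s hs (hsu.trans hu))
        · exact H.driver.path s u hs hsu hu
        · exact H.field.base.bound s ms _
        · exact D.driver s u hs hsu hu
      _ ≤ C * S * (N * (u - s) ^ α) + C * N * (ϱ * (u - s) ^ α) := by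
        gcongr; exact le_mul_of_one_le_right (by linarith) hN
      _ = _ := by ring
  have e : inc x s u - inc x' s u
      - (davieRemainder σ ζ A J x s u - davieRemainder σ ζ' A' J' x' s u) =
      (J s u - J' s u) + (σ s (x s) (inc ζ s u) - σ s (x' s) (inc ζ' s u))
      + (contract (levyField σ s (x s)) (A s u) - contract (levyField σ s (x' s)) (A' s u)) := by
    simp only [davieRemainder, germ]; abel
  rw [e]
  refine norm_add₃_le.trans ?_
  linarith

include H'

/-- Every term has to be linear in $S+\varrho$ and in the difference of the remainders. The change
of base point and the change of increment are therefore separated through the mixed Taylor remainder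
at $x'_s$ with increment $\delta x$. The time differences $\sigma_u-\sigma_s$ at $x_u$ and $x'_u$
limit the order to $2/3$. -/
theorem DavieClose.norm_field_remainder_sub_le :
    ‖inc (fun r => σ r (x r)) s u - levyField σ s (x s) (inc ζ s u)
      - (inc (fun r => σ r (x' r)) s u - levyField σ s (x' s) (inc ζ' s u))‖ ≤
      (C + C * (3 * C * N + M) ^ 2 + 6 * C ^ 2 * N * (3 * C * N + M) + C * (2 * C * N + M)
          + 2 * C ^ 2 * N) * (S + ϱ) * ((u - s) ^ (1 / 3 : ℝ)) ^ 2
        + (2 * C * (3 * C * N + M) + C)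
          * ‖davieRemainder σ ζ A J x s u - davieRemainder σ ζ' A' J' x' s u‖ := by
  obtain ⟨h1, h0⟩ := H.bounds_at hs hsu hu
  obtain ⟨p0, p1, e2, hh, hpq, e3, q1, -⟩ := rpow_bounds h0 h1 H.lt_exponent H.exponent_le
  have hC := H.one_le_field
  have hN := H.one_le_driver
  have hM := D.bound_nonneg
  have hS := D.path_nonneg
  have hϱ := D.driver_nonneg
  have ms := H.mem hs (hsu.trans hu)
  have mu := H.mem (hs.trans hsu) hu
  have v1 := H.norm_inc_le hs hsu hu hM (D.rem s u hs hsu hu)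
  have v2 := H'.norm_inc_le hs hsu hu hM (D.rem' s u hs hsu hu)
  have w1 := H.norm_inc_sub_field_le hs hsu hu x
  have w2 := D.norm_inc_sub_field_sub_le H hs hsu hu
  have z1 := D.norm_inc_sub_remainder_sub_le H hs hsu hu
  have hRp : ‖davieRemainder σ ζ A J x s u‖ ≤ M * ((u - s) ^ α) ^ 2 :=
    (D.rem s u hs hsu hu).trans (by gcongr; exact H.remainder_rpow_le hs hsu hu)
  set V := 3 * C * N + M with hV
  have hV0 : 0 ≤ V := by positivity
  set DR := davieRemainder σ ζ A J x s u - davieRemainder σ ζ' A' J' x' s u with hDR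
  set p := (u - s) ^ α with hp
  set q := (u - s) ^ (1 / 3 : ℝ) with hq
  have hq0 : 0 ≤ q := p0.trans hpq
  have hpq2 : p ^ 2 ≤ q ^ 2 := by gcongr
  have hz : ‖inc x s u - inc x' s u‖ ≤ 3 * C * N * (S + ϱ) * p + ‖DR‖ := by
    have := norm_le_norm_sub_add (inc x s u - inc x' s u) DR
    linarith
  have hx : ∀ r, a ≤ r → r ≤ b → ‖x r - x' r‖ ≤ S := D.path
  have t1 : ‖σ u (x u) - σ s (x u) - (σ u (x' u) - σ s (x' u))‖ ≤ C * (S + ϱ) * q ^ 2 := by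
    have := H.field.cross s ms u mu (x u) (x' u)
    rw [abs_of_nonneg h0, e3] at this
    calc _ ≤ C * q ^ 2 * S := this.trans (by gcongr; exact hx u (hs.trans hsu) hu)
      _ = C * S * q ^ 2 := by ring
      _ ≤ _ := by gcongr; linarith
  -- Same increment, two base points: the step that needs three space derivatives.
  have t2 : ‖σ s (x s + inc x s u) - σ s (x s) - fderiv ℝ (σ s) (x s) (inc x s u)
      - (σ s (x' s + inc x s u) - σ s (x' s) - fderiv ℝ (σ s) (x' s) (inc x s u))‖
      ≤ C * V ^ 2 * (S + ϱ) * q ^ 2 := by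
    calc _ ≤ _ := norm_taylor_sub_taylor_le (H.field.differentiable s ms)
          (H.field.deriv.second s ms) (by linarith) _ _ _
      _ ≤ C * S * (V * p) ^ 2 := by gcongr; exact hx s hs (hsu.trans hu)
      _ = C * V ^ 2 * S * p ^ 2 := by ring
      _ ≤ _ := by gcongr; linarith
  -- Same base point, two increments.
  have t3 : ‖σ s (x' s + inc x s u) - σ s (x' s + inc x' s u)
      - fderiv ℝ (σ s) (x' s) (inc x s u - inc x' s u)‖
      ≤ 6 * C ^ 2 * N * V * (S + ϱ) * q ^ 2 + 2 * C * V * ‖DR‖ := by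
    calc _ ≤ _ := norm_taylor_sub_le (H.field.differentiable s ms) (H.field.deriv.lip s ms)
          (by linarith) _ _ _
      _ ≤ C * (V * p + V * p) * (3 * C * N * (S + ϱ) * p + ‖DR‖) := by gcongr
      _ = 6 * C ^ 2 * N * V * (S + ϱ) * p ^ 2 + 2 * C * V * p * ‖DR‖ := by ring
      _ ≤ 6 * C ^ 2 * N * V * (S + ϱ) * q ^ 2 + 2 * C * V * 1 * ‖DR‖ := by gcongr
      _ = _ := by ring
  have t4 : ‖fderiv ℝ (σ s) (x s) (inc x s u - σ s (x s) (inc ζ s u))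
      - fderiv ℝ (σ s) (x' s) (inc x' s u - σ s (x' s) (inc ζ' s u))‖
      ≤ (C * (2 * C * N + M) + 2 * C ^ 2 * N) * (S + ϱ) * q ^ 2 + C * ‖DR‖ := by
    calc _ ≤ _ := norm_apply_sub_apply_le _ _ _ _
      _ ≤ C * S * ((2 * C * N + M) * p ^ 2) + C * (2 * C * N * (S + ϱ) * p ^ 2 + ‖DR‖) := by
        gcongr
        · exact (H.field.deriv.lip s ms _ _).trans (by gcongr; exact hx s hs (hsu.trans hu))
        · linarith
        · exact H.field.deriv.bound s ms _
      _ ≤ C * (S + ϱ) * ((2 * C * N + M) * q ^ 2) + C * (2 * C * N * (S + ϱ) * q ^ 2 + ‖DR‖) := by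
        gcongr; linarith
      _ = _ := by ring
  have e : inc (fun r => σ r (x r)) s u - levyField σ s (x s) (inc ζ s u)
      - (inc (fun r => σ r (x' r)) s u - levyField σ s (x' s) (inc ζ' s u)) =
      (σ u (x u) - σ s (x u) - (σ u (x' u) - σ s (x' u)))
      + (σ s (x s + inc x s u) - σ s (x s) - fderiv ℝ (σ s) (x s) (inc x s u)
      - (σ s (x' s + inc x s u) - σ s (x' s) - fderiv ℝ (σ s) (x' s) (inc x s u)))
      + (σ s (x' s + inc x s u) - σ s (x' s + inc x' s u)
      - fderiv ℝ (σ s) (x' s) (inc x s u - inc x' s u))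
      + (fderiv ℝ (σ s) (x s) (inc x s u - σ s (x s) (inc ζ s u))
      - fderiv ℝ (σ s) (x' s) (inc x' s u - σ s (x' s) (inc ζ' s u))) := by
    have e1 : x s + inc x s u = x u := by simp [inc]
    have e2 : x' s + inc x' s u = x' u := by simp [inc]
    have i1 : inc (fun r => σ r (x r)) s u = σ u (x u) - σ s (x s) := rfl
    have i2 : inc (fun r => σ r (x' r)) s u = σ u (x' u) - σ s (x' s) := rfl
    rw [e1, e2, i1, i2]
    simp only [levyField, ContinuousLinearMap.comp_apply, map_sub]
    abel
  rw [e]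
  refine norm_add₄_le.trans ?_
  linarith

-- The analogue one order lower, with plain increments of $\nabla\sigma\,\sigma$ in place of Taylor
-- remainders; its cross regularity in time yields the exponent $1/3$.
omit H' in
theorem DavieClose.norm_inc_levy_sub_le :
    ‖inc (fun r => levyField σ r (x r)) s u - inc (fun r => levyField σ r (x' r)) s u‖ ≤
      (C + C * (3 * C * N + M) + 3 * C ^ 2 * N) * (S + ϱ) * (u - s) ^ (1 / 3 : ℝ)
        + C * ‖davieRemainder σ ζ A J x s u - davieRemainder σ ζ' A' J' x' s u‖ := by
  obtain ⟨h1, h0⟩ := H.bounds_at hs hsu hu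
  obtain ⟨p0, p1, e2, hh, hpq, e3, q1, -⟩ := rpow_bounds h0 h1 H.lt_exponent H.exponent_le
  have hC := H.one_le_field
  have hN := H.one_le_driver
  have hM := D.bound_nonneg
  have hS := D.path_nonneg
  have hϱ := D.driver_nonneg
  have ms := H.mem hs (hsu.trans hu)
  have mu := H.mem (hs.trans hsu) hu
  have v1 := H.norm_inc_le hs hsu hu hM (D.rem s u hs hsu hu)
  have z1 := D.norm_inc_sub_remainder_sub_le H hs hsu hu
  set V := 3 * C * N + M with hV
  have hV0 : 0 ≤ V := by positivity
  set DR := davieRemainder σ ζ A J x s u - davieRemainder σ ζ' A' J' x' s u with hDR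
  set p := (u - s) ^ α with hp
  set q := (u - s) ^ (1 / 3 : ℝ) with hq
  have hq0 : 0 ≤ q := p0.trans hpq
  have hz : ‖inc x s u - inc x' s u‖ ≤ 3 * C * N * (S + ϱ) * p + ‖DR‖ := by
    have := norm_le_norm_sub_add (inc x s u - inc x' s u) DR
    linarith
  have t1 : ‖levyField σ u (x u) - levyField σ s (x u)
      - (levyField σ u (x' u) - levyField σ s (x' u))‖ ≤ C * (S + ϱ) * q := by
    have := H.levy.cross s ms u mu (x u) (x' u)
    rw [abs_of_nonneg h0] at this
    calc _ ≤ C * q * S := this.trans (by gcongr; exact D.path u (hs.trans hsu) hu)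
      _ = C * S * q := by ring
      _ ≤ _ := by gcongr; linarith
  have t2 : ‖levyField σ s (x s + inc x s u) - levyField σ s (x s)
      - (levyField σ s (x' s + inc x s u) - levyField σ s (x' s))‖ ≤ C * V * (S + ϱ) * q := by
    calc _ ≤ _ := H.levy.second s ms _ _ _
      _ ≤ C * S * (V * p) := by gcongr; exact D.path s hs (hsu.trans hu)
      _ = C * V * S * p := by ring
      _ ≤ _ := by gcongr; linarith
  have t3 : ‖levyField σ s (x' s + inc x s u) - levyField σ s (x' s + inc x' s u)‖ ≤
      3 * C ^ 2 * N * (S + ϱ) * q + C * ‖DR‖ := by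
    calc _ ≤ _ := H.levy.lip s ms _ _
      _ ≤ C * (3 * C * N * (S + ϱ) * p + ‖DR‖) := by
        rw [add_sub_add_left_eq_sub]; gcongr
      _ ≤ C * (3 * C * N * (S + ϱ) * q + ‖DR‖) := by gcongr
      _ = _ := by ring
  have e : inc (fun r => levyField σ r (x r)) s u - inc (fun r => levyField σ r (x' r)) s u =
      (levyField σ u (x u) - levyField σ s (x u)
      - (levyField σ u (x' u) - levyField σ s (x' u)))
      + (levyField σ s (x s + inc x s u) - levyField σ s (x s)
      - (levyField σ s (x' s + inc x s u) - levyField σ s (x' s)))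
      + (levyField σ s (x' s + inc x s u) - levyField σ s (x' s + inc x' s u)) := by
    have e1 : x s + inc x s u = x u := by simp [inc]
    have e2 : x' s + inc x' s u = x' u := by simp [inc]
    have i1 : inc (fun r => levyField σ r (x r)) s u
      = levyField σ u (x u) - levyField σ s (x s) := rfl
    have i2 : inc (fun r => levyField σ r (x' r)) s u
      = levyField σ u (x' u) - levyField σ s (x' s) := rfl
    rw [e1, e2, i1, i2]
    abel
  rw [e]
  refine (norm_add₃_le (E := E d →L[ℝ] E d →L[ℝ] X)).trans ?_
  linarith

end Local

/-- The constant in front of the distance in the defect of additivity of the difference of two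
remainders. -/
def stabilityConst (C N M : ℝ) : ℝ :=
  (C + C * (3 * C * N + M) ^ 2 + 6 * C ^ 2 * N * (3 * C * N + M) + C * (2 * C * N + M)
    + 2 * C ^ 2 * N) * N + (12 * C ^ 3 * N ^ 2 + 3 * C * M)
    + (C + C * (3 * C * N + M) + 3 * C ^ 2 * N) * N + (4 * C ^ 2 * N + C * M)

/-- The constant in front of the difference of the remainders. -/
def stabilityConst' (C N M : ℝ) : ℝ := (2 * C * (3 * C * N + M) + C) * N + C * N

-- Each of the two products in the defect is a difference of products and splits in two. All four
-- pieces are at least of order $2/3+\alpha$, apart from multiples of $|t-s|^\alpha$ times the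
-- difference of the remainders.
set_option maxHeartbeats 1000000 in
theorem DavieClose.norm_delta_sub_le (H : DavieSetup T a b α C N σ ζ A J)
    (H' : DavieSetup T a b α C N σ ζ' A' J')
    (D : DavieClose a b α C M S ϱ σ ζ A J x ζ' A' J' x') {s u t : ℝ} (hs : a ≤ s) (hsu : s ≤ u)
    (hut : u ≤ t) (ht : t ≤ b) :
    ‖delta (fun s t => davieRemainder σ ζ A J x s t - davieRemainder σ ζ' A' J' x' s t) s u t‖ ≤
      stabilityConst C N M * (S + ϱ) * (t - s) ^ (2 / 3 + α) + stabilityConst' C N M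
        * (t - s) ^ α * ‖davieRemainder σ ζ A J x s u - davieRemainder σ ζ' A' J' x' s u‖ := by
  have hu := hut.trans ht
  have hau := hs.trans hsu
  obtain ⟨h1, h0⟩ := H.bounds_at hs (hsu.trans hut) ht
  obtain ⟨p0, p1, e2, hh, hpq, e3, q1, -⟩ := rpow_bounds h0 h1 H.lt_exponent H.exponent_le
  have hα := H.lt_exponent
  have hC := H.one_le_field
  have hN := H.one_le_driver
  have hM := D.bound_nonneg
  have hS := D.path_nonneg
  have hϱ := D.driver_nonneg
  have b1 := D.norm_field_remainder_sub_le H H' hs hsu hu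
  have b2 := D.norm_inc_levy_sub_le H hs hsu hu
  have b3 := H'.norm_field_remainder_le hs hsu hu x'
  have b4 := H'.norm_inc_levy_le hs hsu hu x'
  have hRp : ‖davieRemainder σ ζ' A' J' x' s u‖ ≤ M * ((u - s) ^ α) ^ 2 :=
    (D.rem' s u hs hsu hu).trans (by gcongr; exact H.remainder_rpow_le hs hsu hu)
  have hsu0 : 0 ≤ u - s := by linarith
  have hut0 : 0 ≤ t - u := by linarith
  have e : delta (fun s t => davieRemainder σ ζ A J x s t - davieRemainder σ ζ' A' J' x' s t) s u t
      = delta (davieRemainder σ ζ A J x) s u t - delta (davieRemainder σ ζ' A' J' x') s u t := by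
    simp only [delta]; abel
  have hθ : (t - s) ^ (2 / 3 + α) = ((t - s) ^ (1 / 3 : ℝ)) ^ 2 * (t - s) ^ α := by
    rw [Real.rpow_add' h0 (by linarith), e3]
  have hp1 : (u - s) ^ α ≤ (t - s) ^ α := Real.rpow_le_rpow hsu0 (by linarith) (by linarith)
  have hp0 : 0 ≤ (u - s) ^ α := by positivity
  have hq1 : (u - s) ^ (1 / 3 : ℝ) ≤ (t - s) ^ (1 / 3 : ℝ) :=
    Real.rpow_le_rpow hsu0 (by linarith) (by norm_num)
  have hq0 : 0 ≤ (u - s) ^ (1 / 3 : ℝ) := by positivity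
  have d1 : ‖inc ζ u t‖ ≤ N * (t - s) ^ α := (H.driver.path u t hau hut ht).trans (by
    gcongr)
  have d2 : ‖inc ζ u t - inc ζ' u t‖ ≤ ϱ * (t - s) ^ α :=
    (D.driver u t hau hut ht).trans (by gcongr)
  have d3 : entrySum (A u t) ≤ N * ((t - s) ^ α) ^ 2 :=
    (H.driver.area u t hau hut ht).trans (by rw [← e2]; gcongr)
  have d4 : entrySum (A u t - A' u t) ≤ ϱ * ((t - s) ^ α) ^ 2 :=
    (D.area u t hau hut ht).trans (by rw [← e2]; gcongr)
  rw [e, H.delta_davieRemainder hs hsu hut ht, H'.delta_davieRemainder hs hsu hut ht,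
    add_sub_add_comm, hθ]
  set p := (t - s) ^ α with hp
  set q := (t - s) ^ (1 / 3 : ℝ) with hq
  set DR := davieRemainder σ ζ A J x s u - davieRemainder σ ζ' A' J' x' s u with hDR
  set K₁ := C + C * (3 * C * N + M) ^ 2 + 6 * C ^ 2 * N * (3 * C * N + M) + C * (2 * C * N + M)
    + 2 * C ^ 2 * N with hK₁
  set K₂ := C + C * (3 * C * N + M) + 3 * C ^ 2 * N with hK₂
  set K₃ := 2 * C * (3 * C * N + M) + C with hK₃
  have hK₁0 : 0 ≤ K₁ := by positivity
  have hK₂0 : 0 ≤ K₂ := by positivity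
  have hK₃0 : 0 ≤ K₃ := by positivity
  have hq0' : 0 ≤ q := p0.trans hpq
  have c1 := norm_apply_sub_apply_le
    (inc (fun r => σ r (x r)) s u - levyField σ s (x s) (inc ζ s u))
    (inc (fun r => σ r (x' r)) s u - levyField σ s (x' s) (inc ζ' s u)) (inc ζ u t) (inc ζ' u t)
  have c2 := norm_contract_sub_contract_le (inc (fun r => levyField σ r (x r)) s u)
    (inc (fun r => levyField σ r (x' r)) s u) (A u t) (A' u t)
  have hpq2 : p ^ 2 ≤ q ^ 2 := by gcongr
  have m1 : ‖inc (fun r => σ r (x r)) s u - levyField σ s (x s) (inc ζ s u)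
      - (inc (fun r => σ r (x' r)) s u - levyField σ s (x' s) (inc ζ' s u))‖ * ‖inc ζ u t‖ ≤
      (K₁ * (S + ϱ) * q ^ 2 + K₃ * ‖DR‖) * (N * p) := by
    gcongr
    exact b1.trans (by gcongr)
  have m2 : ‖inc (fun r => σ r (x' r)) s u - levyField σ s (x' s) (inc ζ' s u)‖
      * ‖inc ζ u t - inc ζ' u t‖ ≤ (12 * C ^ 3 * N ^ 2 + 3 * C * M) * q ^ 2 * ((S + ϱ) * p) := by
    gcongr
    · refine b3.trans ?_
      calc 12 * C ^ 3 * N ^ 2 * ((u - s) ^ α) ^ 2 + 3 * C * ‖davieRemainder σ ζ' A' J' x' s u‖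
          ≤ 12 * C ^ 3 * N ^ 2 * ((u - s) ^ α) ^ 2 + 3 * C * (M * ((u - s) ^ α) ^ 2) := by gcongr
        _ = (12 * C ^ 3 * N ^ 2 + 3 * C * M) * ((u - s) ^ α) ^ 2 := by ring
        _ ≤ (12 * C ^ 3 * N ^ 2 + 3 * C * M) * p ^ 2 := by gcongr
        _ ≤ _ := by gcongr
    · exact d2.trans (by gcongr; linarith)
  have m3 : ‖inc (fun r => levyField σ r (x r)) s u - inc (fun r => levyField σ r (x' r)) s u‖
      * entrySum (A u t) ≤ K₂ * (S + ϱ) * N * (q ^ 2 * p) + C * ‖DR‖ * N * p := by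
    calc _ ≤ (K₂ * (S + ϱ) * q + C * ‖DR‖) * (N * p ^ 2) := by
          gcongr
          · exact entrySum_nonneg _
          · exact b2.trans (by gcongr)
      _ = K₂ * (S + ϱ) * N * (q * p * p) + C * ‖DR‖ * N * (p * p) := by ring
      _ ≤ K₂ * (S + ϱ) * N * (q * q * p) + C * ‖DR‖ * N * (1 * p) := by gcongr
      _ = _ := by ring
  have m4 : ‖inc (fun r => levyField σ r (x' r)) s u‖ * entrySum (A u t - A' u t) ≤
      (4 * C ^ 2 * N + C * M) * (S + ϱ) * (q ^ 2 * p) := by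
    calc _ ≤ ((4 * C ^ 2 * N + C * M) * p) * (ϱ * p ^ 2) := by
          gcongr
          · exact entrySum_nonneg _
          · refine b4.trans ?_
            calc 4 * C ^ 2 * N * (u - s) ^ α + C * ‖davieRemainder σ ζ' A' J' x' s u‖
                ≤ 4 * C ^ 2 * N * (u - s) ^ α + C * (M * (u - s) ^ α) := by
                  gcongr
                  refine hRp.trans ?_
                  gcongr
                  exact pow_le_of_le_one hp0 (hp1.trans p1) two_ne_zero
              _ = (4 * C ^ 2 * N + C * M) * (u - s) ^ α := by ring
              _ ≤ _ := by gcongr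
      _ = (4 * C ^ 2 * N + C * M) * ϱ * (p ^ 2 * p) := by ring
      _ ≤ _ := by gcongr; linarith
  refine (norm_add_le _ _).trans ?_
  calc _ ≤ (K₁ * (S + ϱ) * q ^ 2 + K₃ * ‖DR‖) * (N * p)
      + (12 * C ^ 3 * N ^ 2 + 3 * C * M) * q ^ 2 * ((S + ϱ) * p)
      + (K₂ * (S + ϱ) * N * (q ^ 2 * p) + C * ‖DR‖ * N * p)
      + (4 * C ^ 2 * N + C * M) * (S + ϱ) * (q ^ 2 * p) := by linarith
    _ = _ := by simp only [stabilityConst, stabilityConst', ← hK₁, ← hK₂, ← hK₃]; ring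

/-- Stability on a short interval: the difference of two remainders. -/
theorem DavieClose.norm_remainder_sub_le (H : DavieSetup T a b α C N σ ζ A J)
    (H' : DavieSetup T a b α C N σ ζ' A' J')
    (D : DavieClose a b α C M S ϱ σ ζ A J x ζ' A' J' x')
    (hsmall : sewingConst (2 / 3 + α) * stabilityConst' C N M * (b - a) ^ α ≤ 1 / 2)
    {s t : ℝ} (hs : a ≤ s) (hst : s ≤ t) (ht : t ≤ b) :
    ‖davieRemainder σ ζ A J x s t - davieRemainder σ ζ' A' J' x' s t‖ ≤
      2 * (sewingConst (2 / 3 + α) * (stabilityConst C N M * (S + ϱ))) * (t - s) ^ (2 / 3 + α) := by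
  have hα := H.lt_exponent
  have hC := H.one_le_field
  have hN := H.one_le_driver
  have hM := D.bound_nonneg
  have hS := D.path_nonneg
  have hϱ := D.driver_nonneg
  -- The sum of the two separate bounds serves as a priori estimate; sewing replaces it by a
  -- multiple of $S+\varrho$.
  refine norm_le_of_delta_le_self (by linarith) (by linarith) (θ' := 2 / 3 + α) (M := M + M)
    (g := fun s t => davieRemainder σ ζ A J x s t - davieRemainder σ ζ' A' J' x' s t)
    (by linarith) (by linarith) H.short (by unfold stabilityConst; positivity)
    (by unfold stabilityConst'; positivity) hsmall
    (fun s t hs hst ht => ?_)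
    (fun s u t hs hsu hut ht => D.norm_delta_sub_le H H' hs hsu hut ht) hs hst ht
  refine (norm_sub_le _ _).trans ?_
  linarith [D.rem s t hs hst ht, D.rem' s t hs hst ht]

/-- Stability on a short interval: an improved bound on the distance of the paths. -/
theorem DavieClose.norm_path_sub_le (H : DavieSetup T a b α C N σ ζ A J)
    (H' : DavieSetup T a b α C N σ ζ' A' J')
    (D : DavieClose a b α C M S ϱ σ ζ A J x ζ' A' J' x')
    (hsmall : sewingConst (2 / 3 + α) * stabilityConst' C N M * (b - a) ^ α ≤ 1 / 2)
    (hsmall' : (3 * C * N + 2 * (sewingConst (2 / 3 + α) * stabilityConst C N M)) * (b - a) ^ α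
      ≤ 1 / 2) {t : ℝ} (hat : a ≤ t) (ht : t ≤ b) :
    ‖x t - x' t‖ ≤ ‖x a - x' a‖ + ϱ / 2 + S / 2 := by
  have h1 := D.norm_inc_sub_remainder_sub_le H le_rfl hat ht
  have h2 := D.norm_remainder_sub_le H H' hsmall le_rfl hat ht
  have hα := H.lt_exponent
  have hC := H.one_le_field
  have hN := H.one_le_driver
  have hM := D.bound_nonneg
  have hS := D.path_nonneg
  have hϱ := D.driver_nonneg
  have hc := one_le_sewingConst (θ := 2 / 3 + α) (by linarith)
  obtain ⟨g1, g0⟩ := H.bounds_at le_rfl hat ht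
  obtain ⟨p0, p1, -⟩ := rpow_bounds g0 g1 H.lt_exponent H.exponent_le
  have hK : 0 ≤ stabilityConst C N M := by unfold stabilityConst; positivity
  have h3 : (t - a) ^ (2 / 3 + α) ≤ (b - a) ^ α :=
    (Real.rpow_le_rpow_of_exponent_ge' g0 g1 (by linarith) (by linarith)).trans
      (Real.rpow_le_rpow g0 (by linarith) (by linarith))
  have h4 : (t - a) ^ α ≤ (b - a) ^ α := Real.rpow_le_rpow g0 (by linarith) (by linarith)
  set DR := davieRemainder σ ζ A J x a t - davieRemainder σ ζ' A' J' x' a t with hDR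
  have e : x t - x' t = (x a - x' a) + (inc x a t - inc x' a t - DR) + DR := by
    simp only [inc]; abel
  rw [e]
  refine norm_add₃_le.trans ?_
  have h5 : 3 * C * N * (S + ϱ) * (t - a) ^ α ≤ 3 * C * N * (S + ϱ) * (b - a) ^ α := by gcongr
  have h6 : 2 * (sewingConst (2 / 3 + α) * (stabilityConst C N M * (S + ϱ)))
      * (t - a) ^ (2 / 3 + α) ≤ 2 * (sewingConst (2 / 3 + α) * (stabilityConst C N M * (S + ϱ)))
      * (b - a) ^ α := by gcongr
  have h7 := mul_le_mul_of_nonneg_right hsmall' (add_nonneg hS hϱ)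
  nlinarith

end Stability

/-! ### Global estimates, uniform over drifts and drivers -/

section Global

variable {d : ℕ} {X : Type*} [NormedAddCommGroup X] [NormedSpace ℝ X]

/-- A bounded drift that is Lipschitz in space and continuous in time on `[a, b]`. -/
structure DriftField (a b C : ℝ) (β : ℝ → X → X) : Prop where
  bound : ∀ r ∈ Icc a b, ∀ x, ‖β r x‖ ≤ C
  lip : ∀ r ∈ Icc a b, ∀ x y, ‖β r x - β r y‖ ≤ C * ‖x - y‖
  cont : ∀ x, ContinuousOn (fun r => β r x) (Icc a b)

/-- The increments of the integral of the drift along a path. -/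
noncomputable def driftIncrement (β : ℝ → X → X) (x : ℝ → X) (s t : ℝ) : X :=
  ∫ u in s..t, β u (x u)

/-- A continuous path whose second order expansion along the driver has a remainder of order
larger than one. -/
structure DavieSolution (a b : ℝ) (β : ℝ → X → X) (σ : ℝ → X → E d →L[ℝ] X) (ζ : ℝ → E d)
    (A : ℝ → ℝ → Fin d → Fin d → ℝ) (x : ℝ → X) : Prop where
  cont : ContinuousOn x (Icc a b)
  rem : ∃ θ > (1 : ℝ), ∃ M : ℝ, ∀ s t, a ≤ s → s ≤ t → t ≤ b →
    ‖davieRemainder σ ζ A (driftIncrement β x) x s t‖ ≤ M * (t - s) ^ θ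

variable {T a b α C N : ℝ} {β : ℝ → X → X} {σ : ℝ → X → E d →L[ℝ] X} {ζ ζ' : ℝ → E d}
  {A A' : ℝ → ℝ → Fin d → Fin d → ℝ} {x x' : ℝ → X}

omit [NormedSpace ℝ X] in
theorem DriftField.continuousOn_comp (hβ : DriftField a b C β) (hx : ContinuousOn x (Icc a b)) :
    ContinuousOn (fun r => β r (x r)) (Icc a b) := by
  have h : ContinuousOn (Function.uncurry fun (y : X) (r : ℝ) => β r y) (univ ×ˢ Icc a b) :=
    continuousOn_prod_of_continuousOn_lipschitzOnWith _ C.toNNReal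
      (fun y _ => hβ.cont y)
      (fun r hr => LipschitzOnWith.of_dist_le_mul fun y _ z _ => by
        rw [dist_eq_norm, dist_eq_norm]
        exact (hβ.lip r hr y z).trans (by gcongr; exact Real.le_coe_toNNReal C))
  exact h.comp (hx.prodMk continuousOn_id) fun r hr => ⟨mem_univ _, hr⟩

omit [NormedSpace ℝ X] in
theorem DriftField.intervalIntegrable (hβ : DriftField a b C β) (hx : ContinuousOn x (Icc a b))
    {s t : ℝ} (hs : a ≤ s) (hst : s ≤ t) (ht : t ≤ b) :
    IntervalIntegrable (fun r => β r (x r)) volume s t :=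
  ((hβ.continuousOn_comp hx).mono (Icc_subset_Icc hs ht)).intervalIntegrable_of_Icc hst

theorem DriftField.driftIncrement_add (hβ : DriftField a b C β) (hx : ContinuousOn x (Icc a b))
    {s u t : ℝ} (hs : a ≤ s) (hsu : s ≤ u) (hut : u ≤ t) (ht : t ≤ b) :
    driftIncrement β x s t = driftIncrement β x s u + driftIncrement β x u t :=
  (intervalIntegral.integral_add_adjacent_intervals
    (hβ.intervalIntegrable hx hs hsu (hut.trans ht))
    (hβ.intervalIntegrable hx (hs.trans hsu) hut ht)).symm

theorem DriftField.norm_driftIncrement_le (hβ : DriftField a b C β) (x : ℝ → X)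
    {s t : ℝ} (hs : a ≤ s) (hst : s ≤ t) (ht : t ≤ b) :
    ‖driftIncrement β x s t‖ ≤ C * (t - s) := by
  have := intervalIntegral.norm_integral_le_of_norm_le_const (a := s) (b := t) (C := C)
    (f := fun r => β r (x r)) (fun r hr => by
      rw [uIoc_of_le hst] at hr
      exact hβ.bound r ⟨hs.trans hr.1.le, hr.2.trans ht⟩ _)
  rwa [abs_of_nonneg (sub_nonneg.2 hst)] at this

theorem DriftField.norm_driftIncrement_sub_le (hβ : DriftField a b C β)
    (hx : ContinuousOn x (Icc a b)) (hx' : ContinuousOn x' (Icc a b)) (hC : 0 ≤ C) {S : ℝ}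
    {s t : ℝ} (hs : a ≤ s) (hst : s ≤ t) (ht : t ≤ b)
    (hS : ∀ r, s ≤ r → r ≤ t → ‖x r - x' r‖ ≤ S) :
    ‖driftIncrement β x s t - driftIncrement β x' s t‖ ≤ C * S * (t - s) := by
  rw [driftIncrement, driftIncrement, ← intervalIntegral.integral_sub
    (hβ.intervalIntegrable hx hs hst ht) (hβ.intervalIntegrable hx' hs hst ht)]
  have := intervalIntegral.norm_integral_le_of_norm_le_const (a := s) (b := t) (C := C * S)
    (f := fun r => β r (x r) - β r (x' r)) (fun r hr => by
      rw [uIoc_of_le hst] at hr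
      exact (hβ.lip r ⟨hs.trans hr.1.le, hr.2.trans ht⟩ _ _).trans (by
        gcongr; exact hS r hr.1.le hr.2))
  rwa [abs_of_nonneg (sub_nonneg.2 hst)] at this

theorem DriverBound.mono (h : DriverBound a b α N ζ A) {a' b' : ℝ} (ha : a ≤ a') (hb : b' ≤ b) :
    DriverBound a' b' α N ζ A where
  path s t hs hst ht := h.path s t (ha.trans hs) hst (ht.trans hb)
  area s t hs hst ht := h.area s t (ha.trans hs) hst (ht.trans hb)
  chen s u t hs hsu hut ht := h.chen s u t (ha.trans hs) hsu hut (ht.trans hb)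

/-- The standing assumptions on the exponent, the constants and the vector field. -/
structure RoughData (T α C N : ℝ) (σ : ℝ → X → E d →L[ℝ] X) : Prop where
  lt_exponent : 1 / 3 < α
  exponent_le : α ≤ 1 / 2
  one_le_field : 1 ≤ C
  one_le_driver : 1 ≤ N
  field : FieldRegular T C σ
  levy : SpaceTimeRegular T C (levyField σ)

theorem RoughData.davieSetup (H : RoughData T α C N σ) (ha : 0 ≤ a) (hβ : DriftField a T C β)
    (hA : DriverBound a T α N ζ A) (hx : ContinuousOn x (Icc a T)) {c e : ℝ} (hc : a ≤ c)
    (he : e ≤ T) (hce : e - c ≤ 1) :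
    DavieSetup T c e α C N σ ζ A (driftIncrement β x) where
  nonneg := ha.trans hc
  le_end := he
  short := hce
  lt_exponent := H.lt_exponent
  exponent_le := H.exponent_le
  one_le_field := H.one_le_field
  one_le_driver := H.one_le_driver
  field := H.field
  levy := H.levy
  driver := hA.mono hc he
  drift_add _ _ _ hs hsu hut ht := hβ.driftIncrement_add hx (hc.trans hs) hsu hut (ht.trans he)
  drift_le _ _ hs hst ht := hβ.norm_driftIncrement_le x (hc.trans hs) hst (ht.trans he)

theorem exists_short {K α : ℝ} (hK : 0 ≤ K) (hα : 0 < α) :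
    ∃ h > (0 : ℝ), h ≤ 1 ∧ K * h ^ α ≤ 1 / 2 := by
  have h1 : 0 < 1 / (2 * (K + 1)) := by positivity
  refine ⟨(1 / (2 * (K + 1))) ^ (1 / α), by positivity, Real.rpow_le_one h1.le ?_ (by positivity),
    ?_⟩
  · rw [div_le_one (by positivity)]; linarith
  · rw [← Real.rpow_mul h1.le, one_div_mul_cancel hα.ne', Real.rpow_one, mul_one_div,
      div_le_div_iff₀ (by positivity) (by norm_num)]
    linarith

/-- A discrete Gronwall argument: $f+\varrho$ at most doubles over each interval of length $h$. -/
theorem le_of_local_affine {f : ℝ → ℝ} {h ϱ : ℝ} (hh : 0 < h)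
    (hf : ∀ c e, a ≤ c → c ≤ e → e ≤ b → e - c ≤ h → f e ≤ 2 * f c + ϱ) (n : ℕ) :
    ∀ t, a ≤ t → t ≤ b → t ≤ a + n * h → f t + ϱ ≤ 2 ^ n * (f a + ϱ) := by
  induction n with
  | zero =>
    intro t h1 h2 h3
    obtain rfl : t = a := by simp at h3; linarith
    simp
  | succ n ih =>
    intro t h1 h2 h3
    push_cast at h3
    -- One step back from $t$, stopped at the left end.
    have hc : max a (t - h) ≤ a + n * h := max_le (by nlinarith [n.cast_nonneg (α := ℝ)])
      (by linarith)
    have hct : max a (t - h) ≤ t := max_le h1 (by linarith)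
    have i1 := ih (max a (t - h)) (le_max_left _ _) (hct.trans h2) hc
    have i2 := hf (max a (t - h)) t (le_max_left _ _) hct h2
      (by linarith [le_max_right a (t - h)])
    rw [pow_succ]
    linarith

/-- A universal length of short intervals and a universal constant in the a priori estimate. -/
theorem RoughData.exists_norm_davieRemainder_le (H : RoughData T α C N σ) :
    ∃ h > (0 : ℝ), h ≤ 1 ∧ ∃ M ≥ (0 : ℝ), ∀ a β ζ A x, 0 ≤ a → DriftField a T C β →
      DriverBound a T α N ζ A → DavieSolution a T β σ ζ A x →
      ∀ s t, a ≤ s → s ≤ t → t ≤ T → t - s ≤ h →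
        ‖davieRemainder σ ζ A (driftIncrement β x) x s t‖ ≤ M * (t - s) ^ (2 / 3 + α) := by
  have hα := H.lt_exponent
  have hC := H.one_le_field
  have hN := H.one_le_driver
  have hc := one_le_sewingConst (θ := 2 / 3 + α) (by linarith)
  obtain ⟨h, h0, h1, hs⟩ := exists_short (K := sewingConst (2 / 3 + α) * (4 * C * N)) (α := α)
    (by positivity) (by linarith)
  refine ⟨h, h0, h1, 2 * (sewingConst (2 / 3 + α) * (16 * C ^ 3 * N ^ 3)), by positivity, ?_⟩
  intro a β ζ A x ha hβ hA hx s t has hst ht hts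
  obtain ⟨θ, hθ, M, hM⟩ := hx.rem
  -- The a priori estimate is applied on $[s,t]$ itself, so its smallness condition only involves
  -- $t-s\le h$. The order and constant of the given solution disappear.
  have S := H.davieSetup ha hβ hA hx.cont has ht (hts.trans h1)
  refine S.norm_davieRemainder_le (x := x) (M := M) (θ := θ) (le_trans ?_ hs) hθ
    (fun s' t' h1 h2 h3 => hM s' t' (has.trans h1) h2 (h3.trans ht)) le_rfl hst le_rfl
  gcongr

/-- Global stability of solutions with respect to the initial condition and the driver. -/
theorem RoughData.exists_norm_sub_le (H : RoughData T α C N σ) :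
    ∃ K ≥ (0 : ℝ), ∀ a β ζ A x ζ' A' x' ϱ, 0 ≤ a → DriftField a T C β →
      DriverBound a T α N ζ A → DavieSolution a T β σ ζ A x →
      DriverBound a T α N ζ' A' → DavieSolution a T β σ ζ' A' x' → 0 ≤ ϱ →
      (∀ s t, a ≤ s → s ≤ t → t ≤ T → ‖inc ζ s t - inc ζ' s t‖ ≤ ϱ * (t - s) ^ α) →
      (∀ s t, a ≤ s → s ≤ t → t ≤ T → entrySum (A s t - A' s t) ≤ ϱ * (t - s) ^ (2 * α)) →
      ∀ t, a ≤ t → t ≤ T → ‖x t - x' t‖ ≤ K * (‖x a - x' a‖ + ϱ) := by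
  have hα := H.lt_exponent
  have hC := H.one_le_field
  have hN := H.one_le_driver
  have hc := one_le_sewingConst (θ := 2 / 3 + α) (by linarith)
  obtain ⟨h₁, h₁0, h₁1, M, hM, hrem⟩ := H.exists_norm_davieRemainder_le
  have k1 : 0 ≤ sewingConst (2 / 3 + α) * stabilityConst' C N M := by
    unfold stabilityConst'; positivity
  have k2 : 0 ≤ 3 * C * N + 2 * (sewingConst (2 / 3 + α) * stabilityConst C N M) := by
    unfold stabilityConst; positivity
  -- One length meets both smallness conditions of the local stability estimate.
  obtain ⟨h₂, h₂0, h₂1, hs⟩ := exists_short (add_nonneg k1 k2) (α := α) (by linarith)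
  set h := min h₁ h₂ with hh
  have hpos : 0 < h := lt_min h₁0 h₂0
  -- One doubling per interval of length $h$. The constant is fixed before the drift and the
  -- starting time, hence is common to all controls.
  refine ⟨2 ^ ⌈T / h⌉₊, by positivity, ?_⟩
  intro a β ζ A x ζ' A' x' ϱ ha hβ hA hx hA' hx' hϱ hζ hAA t hat ht
  have key := le_of_local_affine (f := fun t => ‖x t - x' t‖) (ϱ := ϱ) hpos
    (a := a) (b := T) ?_ ⌈T / h⌉₊ t hat ht ?_
  · exact (le_add_of_nonneg_right hϱ).trans key
  · intro c e hac hce he hec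
    have hec1 : e - c ≤ h₁ := hec.trans (min_le_left _ _)
    have hec2 : e - c ≤ h₂ := hec.trans (min_le_right _ _)
    have hcont : ContinuousOn (fun t => x t - x' t) (Icc c e) :=
      (hx.cont.sub hx'.cont).mono (Icc_subset_Icc hac he)
    obtain ⟨B, hB⟩ := isCompact_Icc.exists_bound_of_continuousOn hcont
    have hB0 : 0 ≤ B := (norm_nonneg _).trans (hB c ⟨le_rfl, hce⟩)
    have S := H.davieSetup ha hβ hA hx.cont hac he (hec1.trans h₁1)
    have S' := H.davieSetup ha hβ hA' hx'.cont hac he (hec1.trans h₁1)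
    have hpow : (e - c) ^ α ≤ h₂ ^ α := Real.rpow_le_rpow (by linarith) hec2 (by linarith)
    have s1 : sewingConst (2 / 3 + α) * stabilityConst' C N M * (e - c) ^ α ≤ 1 / 2 := by
      refine le_trans ?_ hs
      gcongr
      exact le_add_of_nonneg_right k2
    have s2 : (3 * C * N + 2 * (sewingConst (2 / 3 + α) * stabilityConst C N M)) * (e - c) ^ α
        ≤ 1 / 2 := by
      refine le_trans (mul_le_mul_of_nonneg_right (le_add_of_nonneg_left k1)
        (Real.rpow_nonneg (by linarith) _)) (le_trans ?_ hs)
      exact mul_le_mul_of_nonneg_left hpow (add_nonneg k1 k2)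
    -- Local stability sends a uniform bound $y$ of $|x-x'|$ on $[c,e]$ to
    -- $\|x_c-x'_c\|+\varrho/2+y/2$; continuity supplies a first bound, and the fixed point is
    -- $2\|x_c-x'_c\|+\varrho$.
    have := le_two_mul_of_forall_le (x := ‖x e - x' e‖) (P := ‖x c - x' c‖ + ϱ / 2) (M := B)
      (S := {y | 0 ≤ y ∧ ∀ r, c ≤ r → r ≤ e → ‖x r - x' r‖ ≤ y})
      ⟨hB0, fun r h1 h2 => hB r ⟨h1, h2⟩⟩ ?_ fun y hy => hy.2 e hce le_rfl
    · linarith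
    rintro y ⟨hy0, hy⟩
    refine ⟨by positivity, fun r hr hr' => ?_⟩
    refine DavieClose.norm_path_sub_le S S' (M := M) (ϱ := ϱ) (S := y)
      ⟨hM, hy0, hϱ, ?_, ?_, hy, ?_, ?_, ?_⟩ s1 s2 hr hr'
    · exact fun s t h1 h2 h3 => hrem a β ζ A x ha hβ hA hx s t (hac.trans h1) h2 (h3.trans he)
        (by linarith)
    · exact fun s t h1 h2 h3 => hrem a β ζ' A' x' ha hβ hA' hx' s t (hac.trans h1) h2
        (h3.trans he) (by linarith)
    · exact fun s t h1 h2 h3 => hζ s t (hac.trans h1) h2 (h3.trans he)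
    · exact fun s t h1 h2 h3 => hAA s t (hac.trans h1) h2 (h3.trans he)
    · exact fun s t h1 h2 h3 => hβ.norm_driftIncrement_sub_le hx.cont hx'.cont (by linarith)
        (hac.trans h1) h2 (h3.trans he) fun r g1 g2 => hy r (h1.trans g1) (g2.trans h3)
  · have := Nat.le_ceil (T / h)
    rw [div_le_iff₀ hpos] at this
    linarith

/-- Solutions stay at bounded distance of their initial condition. -/
theorem RoughData.exists_norm_sub_init_le (H : RoughData T α C N σ) :
    ∃ K ≥ (0 : ℝ), ∀ a β ζ A x, 0 ≤ a → DriftField a T C β →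
      DriverBound a T α N ζ A → DavieSolution a T β σ ζ A x →
      ∀ t, a ≤ t → t ≤ T → ‖x t - x a‖ ≤ K := by
  have hα := H.lt_exponent
  have hC := H.one_le_field
  have hN := H.one_le_driver
  obtain ⟨h, h0, h1, M, hM, hrem⟩ := H.exists_norm_davieRemainder_le
  refine ⟨2 ^ ⌈T / h⌉₊ * (3 * C * N + M), by positivity, ?_⟩
  intro a β ζ A x ha hβ hA hx t hat ht
  have key := le_of_local_affine (f := fun t => ‖x t - x a‖) (ϱ := 3 * C * N + M) h0
    (a := a) (b := T) ?_ ⌈T / h⌉₊ t hat ht ?_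
  · rw [sub_self, norm_zero, zero_add] at key
    linarith [show 0 ≤ 3 * C * N + M by positivity]
  · intro c e hac hce he hec
    have S := H.davieSetup ha hβ hA hx.cont hac he (hec.trans h1)
    have h2 := S.norm_inc_le (x := x) le_rfl hce le_rfl hM
      (hrem a β ζ A x ha hβ hA hx c e hac hce he hec)
    have h3 : (e - c) ^ α ≤ 1 := Real.rpow_le_one (by linarith) (by linarith) (by linarith)
    have h4 : (3 * C * N + M) * (e - c) ^ α ≤ (3 * C * N + M) * 1 := by gcongr
    have h5 : x e - x a = inc x c e + (x c - x a) := by simp [inc]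
    have h6 : ‖x e - x a‖ ≤ ‖inc x c e‖ + ‖x c - x a‖ := by rw [h5]; exact norm_add_le _ _
    linarith [norm_nonneg (x c - x a)]
  · have := Nat.le_ceil (T / h)
    rw [div_le_iff₀ h0] at this
    linarith

end Global

/-! ### Ordinary integral equations -/

section IntegralEquation

variable {X : Type*} [NormedAddCommGroup X] [NormedSpace ℝ X] {a b C : ℝ} {β : ℝ → X → X}

theorem DriftField.exists_integral_solution [CompleteSpace X] (hβ : DriftField a b C β)
    (hab : a ≤ b) (hC : 0 ≤ C) (y : X) :
    ∃ x, ContinuousOn x (Icc a b) ∧ ∀ t ∈ Icc a b, x t = y + driftIncrement β x a t := by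
  -- Since the field is bounded by $C$, the solution cannot leave the ball of radius $C(b-a)$, and
  -- the theorem applies on the whole interval at once.
  have hpl : IsPicardLindelof β (tmin := a) (tmax := b) ⟨a, le_rfl, hab⟩ y
      (C.toNNReal * (b - a).toNNReal) 0 C.toNNReal C.toNNReal := by
    refine ⟨fun t ht => LipschitzOnWith.of_dist_le_mul fun p _ q _ => ?_,
      fun x _ => hβ.cont x, fun t ht x _ => ?_, ?_⟩
    · rw [dist_eq_norm, dist_eq_norm, Real.coe_toNNReal _ hC]
      exact hβ.lip t ht p q
    · rw [Real.coe_toNNReal _ hC]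
      exact hβ.bound t ht x
    · have : 0 ≤ b - a := by linarith
      simp [Real.coe_toNNReal _ hC, Real.coe_toNNReal _ this, this]
  obtain ⟨x, hx0, hx⟩ := hpl.exists_eq_forall_mem_Icc_hasDerivWithinAt₀
  have hc : ContinuousOn x (Icc a b) := fun t ht => (hx t ht).continuousWithinAt
  refine ⟨x, hc, fun t ht => ?_⟩
  have h := intervalIntegral.integral_eq_sub_of_hasDerivAt_of_le (f := x)
    (f' := fun r => β r (x r)) ht.1
    (hc.mono (Icc_subset_Icc_right ht.2))
    (fun r hr => (hx r ⟨hr.1.le, hr.2.le.trans ht.2⟩).hasDerivAt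
      (Icc_mem_nhds hr.1 (hr.2.trans_le ht.2)))
    (hβ.intervalIntegrable hc le_rfl ht.1 ht.2)
  dsimp only at hx0
  rw [driftIncrement, h, hx0]
  abel

theorem DriftField.integral_solution_unique (hβ : DriftField a b C β) (hC : 0 ≤ C) {y : X}
    {x x' : ℝ → X} (hx : ContinuousOn x (Icc a b)) (hx' : ContinuousOn x' (Icc a b))
    (h : ∀ t ∈ Icc a b, x t = y + driftIncrement β x a t)
    (h' : ∀ t ∈ Icc a b, x' t = y + driftIncrement β x' a t) : EqOn x x' (Icc a b) := by
  intro t ht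
  -- On intervals of this length the integral map is a contraction with ratio $1/2$ in the uniform
  -- norm.
  set h₀ : ℝ := 1 / (2 * (C + 1)) with hh₀
  have h₀0 : 0 < h₀ := by positivity
  have hCh : C * h₀ ≤ 1 / 2 := by
    rw [hh₀, mul_one_div, div_le_div_iff₀ (by positivity) (by norm_num)]
    linarith
  have key := le_of_local_affine (f := fun t => ‖x t - x' t‖) (ϱ := 0) h₀0 (a := a) (b := b) ?_
    ⌈(b - a) / h₀⌉₊ t ht.1 ht.2 ?_
  · have e : ∀ z : ℝ → X, driftIncrement β z a a = 0 := fun z => intervalIntegral.integral_same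
    have ha : a ∈ Icc a b := ⟨le_rfl, ht.1.trans ht.2⟩
    rw [h a ha, h' a ha, e, e, sub_self, norm_zero, add_zero, add_zero, mul_zero] at key
    exact sub_eq_zero.1 (norm_le_zero_iff.1 key)
  · intro c e hac hce he hec
    have hcont : ContinuousOn (fun t => x t - x' t) (Icc c e) :=
      (hx.sub hx').mono (Icc_subset_Icc hac he)
    obtain ⟨B, hB⟩ := isCompact_Icc.exists_bound_of_continuousOn hcont
    have hB0 : 0 ≤ B := (norm_nonneg _).trans (hB c ⟨le_rfl, hce⟩)
    rw [add_zero]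
    refine le_two_mul_of_forall_le (M := B)
      (S := {z | 0 ≤ z ∧ ∀ r, c ≤ r → r ≤ e → ‖x r - x' r‖ ≤ z})
      ⟨hB0, fun r h1 h2 => hB r ⟨h1, h2⟩⟩ ?_ fun z hz => hz.2 e hce le_rfl
    rintro z ⟨hz0, hz⟩
    refine ⟨by positivity, fun r hr hr' => ?_⟩
    have hcm : c ∈ Icc a b := ⟨hac, hce.trans he⟩
    have hrm : r ∈ Icc a b := ⟨hac.trans hr, hr'.trans he⟩
    have e1 : x r - x' r = (x c - x' c) + (driftIncrement β x c r - driftIncrement β x' c r) := by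
      rw [h r hrm, h' r hrm, h c hcm, h' c hcm, hβ.driftIncrement_add hx le_rfl hac hr hrm.2,
        hβ.driftIncrement_add hx' le_rfl hac hr hrm.2]
      abel
    have e2 := hβ.norm_driftIncrement_sub_le hx hx' hC hac hr hrm.2
      fun q h1 h2 => hz q h1 (h2.trans hr')
    have e3 : C * z * (r - c) ≤ z / 2 := by
      calc C * z * (r - c) ≤ C * z * h₀ := by gcongr; linarith
        _ = C * h₀ * z := by ring
        _ ≤ 1 / 2 * z := by gcongr
        _ = z / 2 := by ring
    rw [e1]
    exact (norm_add_le _ _).trans (by linarith)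
  · have := Nat.le_ceil ((b - a) / h₀)
    rw [div_le_iff₀ h₀0] at this
    linarith [ht.2]

end IntegralEquation

/-! ### Continuously differentiable drivers and their canonical lifts -/

section Smooth

variable {d : ℕ} {X : Type*} [NormedAddCommGroup X] [NormedSpace ℝ X]
  {T a C B : ℝ} {β : ℝ → X → X} {σ : ℝ → X → E d →L[ℝ] X} {ζ : ℝ → E d}

theorem FieldRegular.continuousOn_time (hσ : FieldRegular T C σ) (x : X) :
    ContinuousOn (fun t => σ t x) (Icc 0 T) := by
  have h : LipschitzOnWith C.toNNReal (fun t => σ t x) (Icc 0 T) :=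
    LipschitzOnWith.of_dist_le_mul fun t ht s hs => by
      rw [dist_eq_norm, Real.dist_eq]
      exact (hσ.time s hs t ht x).trans (by gcongr; exact Real.le_coe_toNNReal C)
  exact h.continuousOn

theorem DriftField.velocity (hβ : DriftField a T C β) (hσ : FieldRegular T C σ) (ha : 0 ≤ a)
    {ξ : ℝ → E d} (hξ : ContinuousOn ξ (Icc a T)) (hB : ∀ t ∈ Icc a T, ‖ξ t‖ ≤ B) :
    DriftField a T (C + C * B) (fun t x => β t x + σ t x (ξ t)) where
  bound r hr x := by
    refine (norm_add_le _ _).trans (add_le_add (hβ.bound r hr x) ?_)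
    have hr' : r ∈ Icc 0 T := ⟨ha.trans hr.1, hr.2⟩
    refine (ContinuousLinearMap.le_opNorm _ _).trans ?_
    have := hσ.base.nonneg
    gcongr
    exacts [hσ.base.bound r hr' x, hB r hr]
  lip r hr x y := by
    have hr' : r ∈ Icc 0 T := ⟨ha.trans hr.1, hr.2⟩
    have hC := hσ.base.nonneg
    have e : β r x + σ r x (ξ r) - (β r y + σ r y (ξ r))
        = (β r x - β r y) + (σ r x - σ r y) (ξ r) := by
      rw [_root_.sub_apply]; abel
    rw [e]
    calc _ ≤ C * ‖x - y‖ + (C * ‖x - y‖) * B := by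
          refine (norm_add_le _ _).trans (add_le_add (hβ.lip r hr x y) ?_)
          refine (ContinuousLinearMap.le_opNorm _ _).trans ?_
          gcongr
          exacts [hσ.base.lip r hr' x y, hB r hr]
      _ = _ := by ring
  cont x := (hβ.cont x).add
    (((hσ.continuousOn_time x).mono (Icc_subset_Icc_left ha)).clm_apply hξ)

theorem pathDeriv_continuousOn (hT : 0 < T) (hζ : ContDiffOn ℝ 1 ζ (Icc 0 T)) :
    ContinuousOn (pathDeriv T ζ) (Icc 0 T) :=
  hζ.continuousOn_derivWithin (uniqueDiffOn_Icc hT) le_rfl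

theorem integral_pathDeriv (hT : 0 < T) (hζ : ContDiffOn ℝ 1 ζ (Icc 0 T)) {s t : ℝ} (hs : 0 ≤ s)
    (hst : s ≤ t) (ht : t ≤ T) : ∫ u in s..t, pathDeriv T ζ u = inc ζ s t := by
  refine intervalIntegral.integral_eq_sub_of_hasDerivAt_of_le hst
    (hζ.continuousOn.mono (Icc_subset_Icc hs ht)) (fun r hr => ?_)
    (((pathDeriv_continuousOn hT hζ).mono (Icc_subset_Icc hs ht)).intervalIntegrable_of_Icc hst)
  have hr' : r ∈ Icc 0 T := ⟨hs.trans hr.1.le, hr.2.le.trans ht⟩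
  exact ((hζ.differentiableOn (by norm_num)) r hr').hasDerivWithinAt.hasDerivAt
    (Icc_mem_nhds (hs.trans_lt hr.1) (hr.2.trans_le ht))

theorem inc_apply (s t : ℝ) (i : Fin d) : inc ζ s t i = ζ t i - ζ s i := rfl

theorem pathDeriv_coord_continuousOn (hT : 0 < T) (hζ : ContDiffOn ℝ 1 ζ (Icc 0 T)) (j : Fin d) :
    ContinuousOn (fun u => pathDeriv T ζ u j) (Icc 0 T) :=
  (EuclideanSpace.proj (𝕜 := ℝ) j).continuous.comp_continuousOn (pathDeriv_continuousOn hT hζ)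

theorem canonicalArea_intervalIntegrable (hT : 0 < T) (hζ : ContDiffOn ℝ 1 ζ (Icc 0 T))
    {s t : ℝ} (hs : 0 ≤ s) (hst : s ≤ t) (ht : t ≤ T) (r : ℝ) (i j : Fin d) :
    IntervalIntegrable (fun u => inc ζ r u i * pathDeriv T ζ u j) volume s t := by
  refine ContinuousOn.intervalIntegrable_of_Icc hst (ContinuousOn.mono ?_ (Icc_subset_Icc hs ht))
  refine ContinuousOn.mul ?_ (pathDeriv_coord_continuousOn hT hζ j)
  exact (((EuclideanSpace.proj (𝕜 := ℝ) i).continuous.comp_continuousOn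
    hζ.continuousOn).sub continuousOn_const)

/-- Chen's relation for the canonical lift. -/
theorem canonicalArea_chen (hT : 0 < T) (hζ : ContDiffOn ℝ 1 ζ (Icc 0 T)) {s u t : ℝ}
    (hs : 0 ≤ s) (hsu : s ≤ u) (hut : u ≤ t) (ht : t ≤ T) (i j : Fin d) :
    delta (canonicalArea T ζ) s u t i j = inc ζ s u i * inc ζ u t j := by
  have h1 := intervalIntegral.integral_add_adjacent_intervals
    (canonicalArea_intervalIntegrable hT hζ hs hsu (hut.trans ht) s i j)
    (canonicalArea_intervalIntegrable hT hζ (hs.trans hsu) hut ht s i j)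
  -- Moving the base point of the integrand from $s$ to $u$ changes it by the constant factor
  -- $\delta\zeta^i_{su}$.
  have h2 : (∫ r in u..t, inc ζ s r i * pathDeriv T ζ r j) - canonicalArea T ζ u t i j
      = inc ζ s u i * inc ζ u t j := by
    rw [canonicalArea, ← intervalIntegral.integral_sub
      (canonicalArea_intervalIntegrable hT hζ (hs.trans hsu) hut ht s i j)
      (canonicalArea_intervalIntegrable hT hζ (hs.trans hsu) hut ht u i j)]
    have h3 : inc ζ u t j = ∫ r in u..t, pathDeriv T ζ r j := by
      rw [← integral_pathDeriv hT hζ (hs.trans hsu) hut ht]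
      exact ((EuclideanSpace.proj (𝕜 := ℝ) j).intervalIntegral_comp_comm
        (((pathDeriv_continuousOn hT hζ).mono
          (Icc_subset_Icc (hs.trans hsu) ht)).intervalIntegrable_of_Icc hut)).symm
    rw [h3, ← intervalIntegral.integral_const_mul]
    congr 1
    ext r
    simp only [inc_apply]
    ring
  have h4 : delta (canonicalArea T ζ) s u t i j = canonicalArea T ζ s t i j
      - canonicalArea T ζ s u i j - canonicalArea T ζ u t i j := rfl
  rw [h4, ← h2]
  have h5 : canonicalArea T ζ s t i j = ∫ r in s..t, inc ζ s r i * pathDeriv T ζ r j := rfl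
  have h6 : canonicalArea T ζ s u i j = ∫ r in s..u, inc ζ s r i * pathDeriv T ζ r j := rfl
  rw [h5, h6, ← h1]
  ring

theorem intervalIntegrable_smul_const {f : ℝ → ℝ} {s t : ℝ}
    (hf : IntervalIntegrable f volume s t) (c : X) :
    IntervalIntegrable (fun u => f u • c) volume s t :=
  ⟨hf.1.smul_const c, hf.2.smul_const c⟩

theorem contract_canonicalArea [CompleteSpace X] (hT : 0 < T) (hζ : ContDiffOn ℝ 1 ζ (Icc 0 T))
    (P : E d →L[ℝ] E d →L[ℝ] X) {s t : ℝ} (hs : 0 ≤ s) (hst : s ≤ t) (ht : t ≤ T) :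
    contract P (canonicalArea T ζ s t) = ∫ u in s..t, P (inc ζ s u) (pathDeriv T ζ u) := by
  simp_rw [← contract_mul]
  unfold contract
  rw [intervalIntegral.integral_finsetSum]
  · refine Finset.sum_congr rfl fun i _ => ?_
    rw [intervalIntegral.integral_finsetSum]
    · refine Finset.sum_congr rfl fun j _ => ?_
      rw [intervalIntegral.integral_smul_const]
      rfl
    · exact fun j _ => intervalIntegrable_smul_const
        (canonicalArea_intervalIntegrable hT hζ hs hst ht s i j) _
  · intro i _
    have := IntervalIntegrable.sum Finset.univ
      (f := fun (j : Fin d) u => (inc ζ s u i * pathDeriv T ζ u j) •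
        P (EuclideanSpace.single i 1) (EuclideanSpace.single j 1))
      (fun j _ => intervalIntegrable_smul_const
        (canonicalArea_intervalIntegrable hT hζ hs hst ht s i j) _)
    rw [Finset.sum_fn] at this
    exact this

/-- Solutions of the ordinary integral equation are solutions in the sense of the second order
expansion along the canonical lift. -/
theorem davieSolution_of_integral_solution [CompleteSpace X] (hT : 0 < T)
    (hζ : ContDiffOn ℝ 1 ζ (Icc 0 T)) (hβ : DriftField a T C β) (hσ : FieldRegular T C σ)
    (hΦ : SpaceTimeRegular T C (levyField σ)) (ha : 0 ≤ a) {y : X} {x : ℝ → X}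
    (hx : ContinuousOn x (Icc a T))
    (h : ∀ t ∈ Icc a T,
      x t = y + driftIncrement (fun t x => β t x + σ t x (pathDeriv T ζ t)) x a t) :
    DavieSolution a T β σ ζ (canonicalArea T ζ) x := by
  have hξ := pathDeriv_continuousOn hT hζ
  obtain ⟨B, hB⟩ := isCompact_Icc.exists_bound_of_continuousOn hξ
  have hB0 : 0 ≤ B := (norm_nonneg _).trans (hB 0 ⟨le_rfl, hT.le⟩)
  have hC := hσ.base.nonneg
  have hsub : Icc a T ⊆ Icc 0 T := Icc_subset_Icc_left ha
  have hv := hβ.velocity hσ ha (hξ.mono hsub) (fun t ht => hB t (hsub ht))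
  set v : ℝ → X → X := fun t x => β t x + σ t x (pathDeriv T ζ t) with hv_def
  set V := C + C * B with hV
  have hV0 : 0 ≤ V := by positivity
  have hinc : ∀ s t, a ≤ s → s ≤ t → t ≤ T → inc x s t = driftIncrement v x s t := by
    intro s t hs hst ht
    rw [inc, h t ⟨hs.trans hst, ht⟩, h s ⟨hs, hst.trans ht⟩,
      hv.driftIncrement_add hx le_rfl hs hst ht]
    abel
  -- The remainder is the integral over $[s,t]$ of a map of size $O(t-s)$, hence of order $2$. The
  -- three summands are the time, space and area contributions. The constant involves
  -- $B=\sup|\dot\zeta|$, which is harmless because the a priori estimate later replaces it.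
  refine ⟨hx, 2, by norm_num, (C + C * V + C * B) * B, fun s t hs hst ht => ?_⟩
  have hs0 : 0 ≤ s := ha.trans hs
  have hξst : ContinuousOn (pathDeriv T ζ) (Icc s t) := hξ.mono (Icc_subset_Icc hs0 ht)
  have i1 := hv.intervalIntegrable hx hs hst ht
  have i2 := hβ.intervalIntegrable hx hs hst ht
  have i3 : IntervalIntegrable (fun r => σ s (x s) (pathDeriv T ζ r)) volume s t :=
    ((σ s (x s)).continuous.comp_continuousOn hξst).intervalIntegrable_of_Icc hst
  have i4 : IntervalIntegrable
      (fun r => levyField σ s (x s) (inc ζ s r) (pathDeriv T ζ r)) volume s t := by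
    refine ContinuousOn.intervalIntegrable_of_Icc hst (ContinuousOn.clm_apply ?_ hξst)
    exact (levyField σ s (x s)).continuous.comp_continuousOn
      ((hζ.continuousOn.mono (Icc_subset_Icc hs0 ht)).sub continuousOn_const)
  have e1 : σ s (x s) (inc ζ s t) = ∫ r in s..t, σ s (x s) (pathDeriv T ζ r) := by
    rw [← integral_pathDeriv hT hζ hs0 hst ht]
    exact ((σ s (x s)).intervalIntegral_comp_comm (hξst.intervalIntegrable_of_Icc hst)).symm
  have e2 : davieRemainder σ ζ (canonicalArea T ζ) (driftIncrement β x) x s t =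
      ∫ r in s..t, (v r (x r) - β r (x r) - (σ s (x s) (pathDeriv T ζ r)
        + levyField σ s (x s) (inc ζ s r) (pathDeriv T ζ r))) := by
    rw [davieRemainder, hinc s t hs hst ht, germ, e1, contract_canonicalArea hT hζ _ hs0 hst ht,
      driftIncrement, driftIncrement, intervalIntegral.integral_sub (i1.sub i2) (i3.add i4),
      intervalIntegral.integral_sub i1 i2, intervalIntegral.integral_add i3 i4]
  rw [e2]
  have key : ∀ r ∈ uIoc s t, ‖v r (x r) - β r (x r) - (σ s (x s) (pathDeriv T ζ r)
        + levyField σ s (x s) (inc ζ s r) (pathDeriv T ζ r))‖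
        ≤ (C + C * V + C * B) * (t - s) * B := by
    intro r hr
    rw [uIoc_of_le hst] at hr
    have hsr : s ≤ r := hr.1.le
    have hr0 : r ∈ Icc 0 T := ⟨hs0.trans hsr, hr.2.trans ht⟩
    have hsm : s ∈ Icc 0 T := ⟨hs0, hst.trans ht⟩
    have hrs : r - s ≤ t - s := by linarith [hr.2]
    have hrs0 : 0 ≤ r - s := by linarith
    have d1 : ‖x r - x s‖ ≤ V * (r - s) := by
      have := hv.norm_driftIncrement_le x hs hsr (hr.2.trans ht)
      rwa [← hinc s r hs hsr (hr.2.trans ht)] at this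
    have d2 : ‖inc ζ s r‖ ≤ B * (r - s) := by
      rw [← integral_pathDeriv hT hζ hs0 hsr (hr.2.trans ht)]
      have := intervalIntegral.norm_integral_le_of_norm_le_const (a := s) (b := r) (C := B)
        (f := pathDeriv T ζ) (fun q hq => by
          rw [uIoc_of_le hsr] at hq
          exact hB q ⟨hs0.trans hq.1.le, hq.2.trans hr0.2⟩)
      rwa [abs_of_nonneg hrs0] at this
    have e3 : v r (x r) - β r (x r) - (σ s (x s) (pathDeriv T ζ r)
        + levyField σ s (x s) (inc ζ s r) (pathDeriv T ζ r)) =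
        ((σ r (x r) - σ s (x r)) + (σ s (x r) - σ s (x s)) - levyField σ s (x s) (inc ζ s r))
          (pathDeriv T ζ r) := by
      simp only [hv_def, _root_.sub_apply, _root_.add_apply]
      abel
    rw [e3]
    refine (ContinuousLinearMap.le_opNorm _ _).trans ?_
    have d3 := hσ.time s hsm r hr0 (x r)
    rw [abs_of_nonneg hrs0] at d3
    have d4 : ‖σ s (x r) - σ s (x s)‖ ≤ C * (V * (r - s)) :=
      (hσ.base.lip s hsm _ _).trans (by gcongr)
    have d5 : ‖levyField σ s (x s) (inc ζ s r)‖ ≤ C * (B * (r - s)) :=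
      (ContinuousLinearMap.le_opNorm _ _).trans (by gcongr; exact hΦ.bound s hsm _)
    have d6 : ‖(σ r (x r) - σ s (x r)) + (σ s (x r) - σ s (x s))
        - levyField σ s (x s) (inc ζ s r)‖ ≤ (C + C * V + C * B) * (t - s) := by
      refine (norm_sub_le _ _).trans ((add_le_add_left (norm_add_le _ _) _).trans ?_)
      have : (C + C * V + C * B) * (r - s) ≤ (C + C * V + C * B) * (t - s) := by gcongr
      linarith
    gcongr
    exact hB r hr0
  have := intervalIntegral.norm_integral_le_of_norm_le_const key
  rw [abs_of_nonneg (sub_nonneg.2 hst)] at this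
  refine this.trans_eq ?_
  rw [Real.rpow_two]
  ring

end Smooth

/-! ### Calculus of Hölder orders -/

section HolderBound

variable {V W : Type*} [NormedAddCommGroup V] [NormedAddCommGroup W] {a b p q : ℝ}

/-- A two-parameter map is of order `p` on `[a, b]`. -/
def HolderBound (a b p : ℝ) (g : ℝ → ℝ → W) : Prop :=
  ∃ M : ℝ, 0 ≤ M ∧ ∀ s t, a ≤ s → s ≤ t → t ≤ b → ‖g s t‖ ≤ M * (t - s) ^ p

theorem HolderBound.holderNorm_lt_top {g : ℝ → ℝ → W} (h : HolderBound a b p g) :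
    holderNorm a b p g < ∞ := by
  obtain ⟨M, -, hM⟩ := h
  exact RoughControl.holderNorm_lt_top fun s t hs hst ht => hM s t hs hst.le ht

theorem HolderBound.of_exponent {g : ℝ → ℝ → W} (h : HolderBound a b p g) (hq : 0 < q)
    (hqp : q ≤ p) : HolderBound a b q g := by
  obtain ⟨M, hM0, hM⟩ := h
  rcases lt_or_ge b a with hab | hab
  · exact ⟨0, le_rfl, fun s t hs hst ht => by linarith⟩
  have hba : 0 ≤ b - a := by linarith
  refine ⟨M * (b - a) ^ (p - q), by positivity, fun s t hs hst ht => ?_⟩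
  have hts : 0 ≤ t - s := by linarith
  have e : (t - s) ^ p = (t - s) ^ (p - q) * (t - s) ^ q := by
    rw [← Real.rpow_add' hts (by linarith), sub_add_cancel]
  calc _ ≤ M * ((t - s) ^ (p - q) * (t - s) ^ q) := by rw [← e]; exact hM s t hs hst ht
    _ ≤ M * ((b - a) ^ (p - q) * (t - s) ^ q) := by gcongr
    _ = _ := by ring

theorem HolderBound.of_le {g : ℝ → ℝ → W} {g' : ℝ → ℝ → V} (h : HolderBound a b p g) {c : ℝ}
    (hc : 0 ≤ c) (hg : ∀ s t, a ≤ s → s ≤ t → t ≤ b → ‖g' s t‖ ≤ c * ‖g s t‖) :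
    HolderBound a b p g' := by
  obtain ⟨M, hM0, hM⟩ := h
  refine ⟨c * M, by positivity, fun s t hs hst ht => (hg s t hs hst ht).trans ?_⟩
  rw [mul_assoc]
  exact mul_le_mul_of_nonneg_left (hM s t hs hst ht) hc

theorem HolderBound.add {g g' : ℝ → ℝ → W} (h : HolderBound a b p g)
    (h' : HolderBound a b p g') : HolderBound a b p (fun s t => g s t + g' s t) := by
  obtain ⟨M, hM0, hM⟩ := h
  obtain ⟨M', hM0', hM'⟩ := h'
  refine ⟨M + M', by positivity, fun s t hs hst ht => (norm_add_le _ _).trans ?_⟩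
  rw [add_mul]
  exact add_le_add (hM s t hs hst ht) (hM' s t hs hst ht)

theorem HolderBound.congr {g g' : ℝ → ℝ → W} (h : HolderBound a b p g)
    (hg : ∀ s t, a ≤ s → s ≤ t → t ≤ b → g' s t = g s t) : HolderBound a b p g' := by
  obtain ⟨M, hM0, hM⟩ := h
  exact ⟨M, hM0, fun s t hs hst ht => by rw [hg s t hs hst ht]; exact hM s t hs hst ht⟩

theorem HolderBound.sq_norm {g : ℝ → ℝ → W} (h : HolderBound a b p g) :
    HolderBound a b (2 * p) (fun s t => ‖g s t‖ ^ 2) := by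
  obtain ⟨M, hM0, hM⟩ := h
  refine ⟨M ^ 2, by positivity, fun s t hs hst ht => ?_⟩
  have e : (t - s) ^ (2 * p) = ((t - s) ^ p) ^ 2 := by
    rw [← Real.rpow_mul_natCast (by linarith)]; congr 1; push_cast; ring
  rw [norm_pow, norm_norm, e, ← mul_pow]
  exact pow_le_pow_left₀ (norm_nonneg _) (hM s t hs hst ht) 2

theorem holderBound_rpow {c : ℝ} (hc : 0 ≤ c) :
    HolderBound a b p (fun s t => c * |t - s| ^ p) :=
  ⟨c, hc, fun s t _ hst _ => by
    dsimp only
    rw [abs_of_nonneg (sub_nonneg.2 hst), Real.norm_of_nonneg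
      (mul_nonneg hc (Real.rpow_nonneg (sub_nonneg.2 hst) _))]⟩

theorem HolderBound.continuousOn {x : ℝ → W} (h : HolderBound a b p (inc x)) (hp : 0 < p) :
    ContinuousOn x (Icc a b) := by
  obtain ⟨M, hM0, hM⟩ := h
  have key : ∀ s ∈ Icc a b, ∀ t ∈ Icc a b, ‖x t - x s‖ ≤ M * |t - s| ^ p := by
    intro s hs t ht
    rcases le_total s t with hst | hst
    · rw [abs_of_nonneg (sub_nonneg.2 hst)]
      exact hM s t hs.1 hst ht.2
    · rw [abs_sub_comm, abs_of_nonneg (sub_nonneg.2 hst), norm_sub_rev]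
      exact hM t s ht.1 hst hs.2
  intro s hs
  rw [ContinuousWithinAt, tendsto_iff_norm_sub_tendsto_zero]
  have hlim : Tendsto (fun t => M * |t - s| ^ p) (𝓝[Icc a b] s) (𝓝 0) := by
    have : Continuous fun t : ℝ => M * |t - s| ^ p :=
      continuous_const.mul (((continuous_id.sub continuous_const).abs).rpow_const
        fun _ => Or.inr hp.le)
    have h0 := this.continuousWithinAt (s := Icc a b) (x := s)
    rw [ContinuousWithinAt, sub_self, abs_zero, Real.zero_rpow hp.ne', mul_zero] at h0
    exact h0
  exact tendsto_of_tendsto_of_tendsto_of_le_of_le' tendsto_const_nhds hlim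
    (Eventually.of_forall fun _ => norm_nonneg _)
    (eventually_nhdsWithin_of_forall fun t ht => key s hs t ht)

/-- The Hölder norm only sees $s<t$, so vanishing on the diagonal is a separate assumption. -/
theorem holderBound_of_holderNorm {g : ℝ → ℝ → W} (h : holderNorm a b p g < ∞)
    (h0 : ∀ s, a ≤ s → s ≤ b → g s s = 0) : HolderBound a b p g := by
  refine ⟨(holderNorm a b p g).toReal, ENNReal.toReal_nonneg, fun s t hs hst ht => ?_⟩
  rcases hst.eq_or_lt with rfl | hst
  · rw [h0 s hs ht, norm_zero]
    exact mul_nonneg ENNReal.toReal_nonneg (Real.rpow_nonneg (by linarith) _)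
  · exact norm_le_holderNorm_toReal h.ne hs hst ht

end HolderBound

/-! ### Expansions and controlled rough paths; existence -/

section Equivalence

variable {d : ℕ} {X : Type*} [NormedAddCommGroup X] [NormedSpace ℝ X]
  {T α C N a : ℝ} {β : ℝ → X → X} {σ : ℝ → X → E d →L[ℝ] X} {ζ : ℝ → E d}
  {A : ℝ → ℝ → Fin d → Fin d → ℝ} {x : ℝ → X}

/-- All orders are read off the expansion: $\delta x-\sigma\,\delta\zeta$ is drift plus area term
plus $R$, of order $2\alpha$, and a Taylor expansion transfers this to $\sigma(\cdot,x)$. The sewing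
term is $R$ itself, whence the condition $3\kappa\le\theta$. -/
theorem DavieSolution.isControlled (H : RoughData T α C N σ) (ha : 0 ≤ a)
    (hβ : DriftField a T C β) (hA : DriverBound a T α N ζ A)
    (hx : DavieSolution a T β σ ζ A x) {θ : ℝ} (hθ : 1 < θ)
    (hR : HolderBound a T θ (davieRemainder σ ζ A (driftIncrement β x) x))
    {κ : ℝ} (hκ : 1 / 3 < κ) (hκα : κ < α) (hκθ : 3 * κ ≤ θ) :
    IsControlled a T κ ζ x (fun r => σ r (x r)) ∧
    IsRoughIntegral a T κ ζ A (fun r => σ r (x r)) (fun r => levyField σ r (x r))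
      (fun r t => inc x r t - driftIncrement β x r t) := by
  have hα := H.lt_exponent
  have hα' := H.exponent_le
  have hC : 0 ≤ C := zero_le_one.trans H.one_le_field
  have hN : 0 ≤ N := zero_le_one.trans H.one_le_driver
  have mem : ∀ {s}, a ≤ s → s ≤ T → s ∈ Icc 0 T := fun h h' => ⟨ha.trans h, h'⟩
  have bζ : HolderBound a T α (inc ζ) := ⟨N, hN, hA.path⟩
  have bA : HolderBound a T (2 * α) (fun s t => entrySum (A s t)) :=
    ⟨N, hN, fun s t hs hst ht => by
      rw [Real.norm_of_nonneg (entrySum_nonneg _)]; exact hA.area s t hs hst ht⟩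
  have bt : ∀ c, 0 ≤ c → HolderBound a T 1 (fun s t => c * |t - s| ^ (1 : ℝ)) :=
    fun c hc => holderBound_rpow hc
  have bJ : HolderBound a T (2 * α) (driftIncrement β x) :=
    HolderBound.of_exponent (p := 1) ⟨C, hC, fun s t hs hst ht => by
      rw [Real.rpow_one]; exact hβ.norm_driftIncrement_le x hs hst ht⟩ (by linarith) (by linarith)
  have bΦ : HolderBound a T (2 * α) (fun s t => contract (levyField σ s (x s)) (A s t)) :=
    bA.of_le hC fun s t hs hst ht => (norm_contract_le _ _).trans (by
      rw [Real.norm_of_nonneg (entrySum_nonneg _)]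
      gcongr
      · exact entrySum_nonneg _
      · exact H.levy.bound s (mem hs (hst.trans ht)) _)
  have bσ : HolderBound a T α (fun s t => σ s (x s) (inc ζ s t)) :=
    bζ.of_le hC fun s t hs hst ht => (ContinuousLinearMap.le_opNorm _ _).trans (by
      gcongr; exact H.field.base.bound s (mem hs (hst.trans ht)) _)
  have bR := hR.of_exponent (q := 2 * α) (by linarith) (by linarith)
  have brem : HolderBound a T (2 * α) (remainder ζ x (fun r => σ r (x r))) :=
    ((bJ.add bΦ).add bR).congr fun s t _ _ _ => by
      simp only [remainder, davieRemainder, germ]; abel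
  have bx : HolderBound a T α (inc x) :=
    ((brem.of_exponent (q := α) (by linarith) (by linarith)).add bσ).congr fun s t _ _ _ => by
      simp [remainder]
  have bμ : HolderBound a T α (inc fun r => σ r (x r)) := by
    refine (((bt C hC).of_exponent (q := α) (by linarith) (by linarith)).add
      (bx.of_le (g' := fun s t => C * ‖inc x s t‖) hC fun s t _ _ _ => by
        rw [norm_mul, norm_norm, Real.norm_of_nonneg hC])).of_le zero_le_one
      fun s t hs hst ht => ?_
    have e : inc (fun r => σ r (x r)) s t = (σ t (x t) - σ s (x t)) + (σ s (x t) - σ s (x s)) := by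
      simp only [inc]; abel
    rw [e, one_mul, Real.norm_of_nonneg (by positivity), Real.rpow_one]
    exact (norm_add_le _ _).trans (add_le_add (H.field.time s (mem hs (hst.trans ht)) t
      (mem (hs.trans hst) ht) _) (H.field.base.lip s (mem hs (hst.trans ht)) _ _))
  have bμ' : HolderBound a T α (inc fun r => levyField σ r (x r)) := by
    refine (((holderBound_rpow (p := 2 / 3) hC).of_exponent (q := α) (by linarith)
      (by linarith)).add
      (bx.of_le (g' := fun s t => C * ‖inc x s t‖) hC fun s t _ _ _ => by
        rw [norm_mul, norm_norm, Real.norm_of_nonneg hC])).of_le zero_le_one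
      fun s t hs hst ht => ?_
    have e : inc (fun r => levyField σ r (x r)) s t = (levyField σ t (x t) - levyField σ s (x t))
        + (levyField σ s (x t) - levyField σ s (x s)) := by
      simp only [inc]; abel
    rw [e, one_mul, Real.norm_of_nonneg (by positivity)]
    exact (norm_add_le (E := E d →L[ℝ] E d →L[ℝ] X) _ _).trans
      (add_le_add (H.levy.time s (mem hs (hst.trans ht)) t
      (mem (hs.trans hst) ht) _) (H.levy.lip s (mem hs (hst.trans ht)) _ _))
  have bρ : HolderBound a T (2 * α)
      (remainder ζ (fun r => σ r (x r)) (fun r => levyField σ r (x r))) := by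
    refine (((bt C hC).of_exponent (q := 2 * α) (by linarith) (by linarith)).add
      ((bx.sq_norm.of_le (g' := fun s t => C * ‖inc x s t‖ ^ 2) hC fun s t _ _ _ => by
        rw [norm_mul, Real.norm_of_nonneg hC]).add
        (brem.of_le (g' := fun s t => C * ‖remainder ζ x (fun r => σ r (x r)) s t‖) hC
          fun s t _ _ _ => by rw [norm_mul, norm_norm, Real.norm_of_nonneg hC]))).of_le
      zero_le_one fun s t hs hst ht => ?_
    have ms := mem hs (hst.trans ht)
    have e : remainder ζ (fun r => σ r (x r)) (fun r => levyField σ r (x r)) s t =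
        (σ t (x t) - σ s (x t)) + ((σ s (x s + inc x s t) - σ s (x s)
        - fderiv ℝ (σ s) (x s) (inc x s t))
        + fderiv ℝ (σ s) (x s) (remainder ζ x (fun r => σ r (x r)) s t)) := by
      simp only [remainder, inc, levyField, ContinuousLinearMap.comp_apply, map_sub,
        add_sub_cancel]
      abel
    rw [e, one_mul, Real.norm_of_nonneg (by positivity), Real.rpow_one]
    refine (norm_add_le _ _).trans (add_le_add (H.field.time s ms t (mem (hs.trans hst) ht) _)
      ((norm_add_le _ _).trans (add_le_add ?_ ?_)))
    · have := norm_taylor_sub_le (H.field.differentiable s ms) (H.field.deriv.lip s ms) hC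
        (x s) (inc x s t) 0
      simp only [add_zero, sub_zero, norm_zero] at this
      exact this.trans_eq (by ring)
    · exact ContinuousLinearMap.le_of_opNorm_le _ (H.field.deriv.bound s ms _) _
  refine ⟨⟨(bx.of_exponent (by linarith) hκα.le).holderNorm_lt_top,
    (bμ.of_exponent (by linarith) hκα.le).holderNorm_lt_top,
    (brem.of_exponent (by linarith) (by linarith)).holderNorm_lt_top⟩,
    ⟨(bμ.of_exponent (by linarith) hκα.le).holderNorm_lt_top,
    (bμ'.of_exponent (by linarith) hκα.le).holderNorm_lt_top,
    (bρ.of_exponent (by linarith) (by linarith)).holderNorm_lt_top⟩,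
    davieRemainder σ ζ A (driftIncrement β x) x, ⟨fun s u t hs hsu hut ht => ?_,
    (hR.of_exponent (by linarith) hκθ).holderNorm_lt_top⟩, fun s t _ _ _ => ?_⟩
  · exact delta_davieRemainder (hA.chen s u t hs hsu hut ht)
      (hβ.driftIncrement_add hx.cont hs hsu hut ht)
  · simp only [davieRemainder, germ]
    abel

/-- The sewing term of the rough integral is the remainder $R$, and $3\kappa>1$. -/
theorem davieSolution_of_isRoughIntegral {κ : ℝ} (hκ : 1 / 3 < κ)
    (h : IsControlled a T κ ζ x (fun r => σ r (x r)))
    (h' : IsRoughIntegral a T κ ζ A (fun r => σ r (x r)) (fun r => levyField σ r (x r))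
      (fun r t => inc x r t - driftIncrement β x r t)) :
    DavieSolution a T β σ ζ A x := by
  obtain ⟨-, g, ⟨hg, hgn⟩, hI⟩ := h'
  -- At $s=u=t$ the defect identity reads $-g_{ss}=0$.
  have hg0 : ∀ s, a ≤ s → s ≤ T → g s s = 0 := by
    intro s hs hs'
    have h1 := hg s s s hs le_rfl le_rfl hs'
    simp only [delta, inc, remainder, sub_self, map_zero, zero_sub] at h1
    have h2 : contract (0 : E d →L[ℝ] E d →L[ℝ] X) (A s s) = 0 := by simp [contract]
    rw [h2, add_zero] at h1
    exact neg_eq_zero.1 h1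
  obtain ⟨M, -, hM⟩ := holderBound_of_holderNorm hgn hg0
  refine ⟨(holderBound_of_holderNorm h.holder_path fun s _ _ => sub_self _).continuousOn
    (by linarith), 3 * κ, by linarith, M, fun s t hs hst ht => ?_⟩
  have e : davieRemainder σ ζ A (driftIncrement β x) x s t = g s t := by
    have := hI s t hs hst ht
    dsimp only at this
    rw [davieRemainder, this, germ]
    abel
  rw [e]
  exact hM s t hs hst ht

/-- The existence of solutions by approximation of the driver. -/
theorem RoughData.exists_davieSolution [CompleteSpace X] (H : RoughData T α C N σ) (ha : 0 ≤ a)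
    (haT : a ≤ T) (hβ : DriftField a T C β) (hA : DriverBound a T α N ζ A)
    {ζn : ℕ → ℝ → E d} {An : ℕ → ℝ → ℝ → Fin d → Fin d → ℝ} {xn : ℕ → ℝ → X} {ϱ : ℕ → ℝ}
    (hAn : ∀ n, DriverBound a T α N (ζn n) (An n))
    (hxn : ∀ n, DavieSolution a T β σ (ζn n) (An n) (xn n)) {y : X} (hy : ∀ n, xn n a = y)
    (hϱ0 : ∀ n, 0 ≤ ϱ n) (hϱ : Tendsto ϱ atTop (𝓝 0))
    (hζ : ∀ n s t, a ≤ s → s ≤ t → t ≤ T → ‖inc (ζn n) s t - inc ζ s t‖ ≤ ϱ n * (t - s) ^ α)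
    (hAA : ∀ n s t, a ≤ s → s ≤ t → t ≤ T →
      entrySum (An n s t - A s t) ≤ ϱ n * (t - s) ^ (2 * α)) :
    ∃ x, DavieSolution a T β σ ζ A x ∧ x a = y := by
  have hα := H.lt_exponent
  have hC : 0 ≤ C := zero_le_one.trans H.one_le_field
  have hN : 0 ≤ N := zero_le_one.trans H.one_le_driver
  obtain ⟨K, hK, hstab⟩ := H.exists_norm_sub_le
  obtain ⟨h, h0, h1, M, hM, hrem⟩ := H.exists_norm_davieRemainder_le
  -- Stability with a common initial value; the two drivers are compared through their limit.
  have hcauchy : ∀ n k t, a ≤ t → t ≤ T → ‖xn n t - xn k t‖ ≤ K * (ϱ n + ϱ k) := by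
    intro n k t hat ht
    have := hstab a β (ζn n) (An n) (xn n) (ζn k) (An k) (xn k) (ϱ n + ϱ k) ha hβ (hAn n) (hxn n)
      (hAn k) (hxn k) (add_nonneg (hϱ0 n) (hϱ0 k)) (fun s t hs hst ht => ?_)
      (fun s t hs hst ht => ?_) t hat ht
    · rwa [hy, hy, sub_self, norm_zero, zero_add] at this
    · have e : inc (ζn n) s t - inc (ζn k) s t
        = (inc (ζn n) s t - inc ζ s t) - (inc (ζn k) s t - inc ζ s t) := by abel
      rw [e, add_mul]
      exact (norm_sub_le _ _).trans (add_le_add (hζ n s t hs hst ht) (hζ k s t hs hst ht))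
    · rw [add_mul]
      refine le_trans ?_ (add_le_add (hAA n s t hs hst ht) (hAA k s t hs hst ht))
      unfold entrySum
      rw [← Finset.sum_add_distrib]
      refine Finset.sum_le_sum fun i _ => ?_
      rw [← Finset.sum_add_distrib]
      refine Finset.sum_le_sum fun j _ => ?_
      have e : (An n s t - An k s t) i j = (An n s t - A s t) i j - (An k s t - A s t) i j := by
        simp only [Pi.sub_apply]; ring
      rw [e]
      exact abs_sub _ _
  have hlim : ∀ t, a ≤ t → t ≤ T → ∃ z, Tendsto (fun n => xn n t) atTop (𝓝 z) := by
    intro t hat ht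
    refine cauchySeq_tendsto_of_complete (Metric.cauchySeq_iff'.2 fun ε hε => ?_)
    have hlim' : Tendsto (fun n => K * ϱ n) atTop (𝓝 (K * 0)) := hϱ.const_mul K
    rw [mul_zero] at hlim'
    obtain ⟨n₀, hn₀⟩ := eventually_atTop.1 (hlim'.eventually (gt_mem_nhds (half_pos hε)))
    refine ⟨n₀, fun n hn => ?_⟩
    rw [dist_eq_norm]
    refine (hcauchy n n₀ t hat ht).trans_lt ?_
    have := hn₀ n hn
    have := hn₀ n₀ le_rfl
    linarith
  choose! x hx using hlim
  have hunif : ∀ n t, a ≤ t → t ≤ T → ‖xn n t - x t‖ ≤ K * ϱ n := by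
    intro n t hat ht
    have l1 : Tendsto (fun k => ‖xn n t - xn k t‖) atTop (𝓝 ‖xn n t - x t‖) :=
      (tendsto_const_nhds.sub (hx t hat ht)).norm
    have l2 : Tendsto (fun k => K * (ϱ n + ϱ k)) atTop (𝓝 (K * (ϱ n + 0))) :=
      (tendsto_const_nhds.add hϱ).const_mul K
    rw [add_zero] at l2
    exact le_of_tendsto_of_tendsto' l1 l2 fun k => hcauchy n k t hat ht
  have hKϱ : Tendsto (fun n => K * ϱ n) atTop (𝓝 0) := by simpa using hϱ.const_mul K
  have hcont : ContinuousOn x (Icc a T) := by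
    refine TendstoUniformlyOn.continuousOn (F := xn) (p := atTop) ?_
      (Frequently.of_forall fun n => (hxn n).cont)
    rw [Metric.tendstoUniformlyOn_iff]
    intro ε hε
    filter_upwards [hKϱ.eventually (gt_mem_nhds hε)] with n hn t ht
    rw [dist_comm, dist_eq_norm]
    exact (hunif n t ht.1 ht.2).trans_lt hn
  have hRlim : ∀ s t, a ≤ s → s ≤ t → t ≤ T → Tendsto
      (fun n => davieRemainder σ (ζn n) (An n) (driftIncrement β (xn n)) (xn n) s t) atTop
      (𝓝 (davieRemainder σ ζ A (driftIncrement β x) x s t)) := by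
    intro s t hs hst ht
    have ms : s ∈ Icc 0 T := ⟨ha.trans hs, hst.trans ht⟩
    refine ((hx t (hs.trans hst) ht).sub (hx s hs (hst.trans ht))).sub ?_ |>.sub
      (Tendsto.add ?_ ?_)
    · rw [tendsto_iff_norm_sub_tendsto_zero]
      refine squeeze_zero (fun n => norm_nonneg _) (fun n =>
        hβ.norm_driftIncrement_sub_le (hxn n).cont hcont hC hs hst ht fun r h1 h2 =>
          hunif n r (hs.trans h1) (h2.trans ht)) ?_
      simpa using (hKϱ.const_mul C).mul_const (t - s)
    · rw [tendsto_iff_norm_sub_tendsto_zero]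
      refine squeeze_zero (g := fun n => C * (K * ϱ n) * (N * (t - s) ^ α)
          + C * (ϱ n * (t - s) ^ α)) (fun n => norm_nonneg _) (fun n => ?_) ?_
      · have hϱn := hϱ0 n
        refine (norm_apply_sub_apply_le _ _ _ _).trans ?_
        gcongr
        · exact (H.field.base.lip s ms _ _).trans (by
            gcongr; exact hunif n s hs (hst.trans ht))
        · exact (hAn n).path s t hs hst ht
        · exact H.field.base.bound s ms _
        · exact hζ n s t hs hst ht
      · simpa using ((hKϱ.const_mul C).mul_const (N * (t - s) ^ α)).add
          ((hϱ.mul_const ((t - s) ^ α)).const_mul C)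
    · rw [tendsto_iff_norm_sub_tendsto_zero]
      refine squeeze_zero (g := fun n => C * (K * ϱ n) * (N * (t - s) ^ (2 * α))
          + C * (ϱ n * (t - s) ^ (2 * α))) (fun n => norm_nonneg _) (fun n => ?_) ?_
      · have hϱn := hϱ0 n
        refine (norm_contract_sub_contract_le _ _ _ _).trans ?_
        gcongr
        · exact entrySum_nonneg _
        · exact (H.levy.lip s ms _ _).trans (by
            gcongr; exact hunif n s hs (hst.trans ht))
        · exact (hAn n).area s t hs hst ht
        · exact entrySum_nonneg _
        · exact H.levy.bound s ms _
        · exact hAA n s t hs hst ht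
      · simpa using ((hKϱ.const_mul C).mul_const (N * (t - s) ^ (2 * α))).add
          ((hϱ.mul_const ((t - s) ^ (2 * α))).const_mul C)
  -- The constant $M$ does not depend on $n$, so the bound survives pointwise convergence of the
  -- remainders.
  have hshort : ∀ s t, a ≤ s → s ≤ t → t ≤ T → t - s ≤ h →
      ‖davieRemainder σ ζ A (driftIncrement β x) x s t‖ ≤ M * (t - s) ^ (2 / 3 + α) :=
    fun s t hs hst ht hts => le_of_tendsto' (hRlim s t hs hst ht).norm fun n =>
      hrem a β (ζn n) (An n) (xn n) ha hβ (hAn n) (hxn n) s t hs hst ht hts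
  obtain ⟨B, hB⟩ := isCompact_Icc.exists_bound_of_continuousOn hcont
  have hB0 : 0 ≤ B := (norm_nonneg _).trans (hB a ⟨le_rfl, haT⟩)
  have hT0 : 0 ≤ T := ha.trans haT
  -- For $t-s\ge h$ a uniform bound $D$ is enough: it is at most $D\,h^{-\theta}(t-s)^\theta$ with
  -- $\theta=2/3+\alpha$.
  set D : ℝ := B + B + C * T + (C * (N * T ^ α) + C * (N * T ^ (2 * α))) with hD
  have hD0 : 0 ≤ D := by positivity
  have hlong : ∀ s t, a ≤ s → s ≤ t → t ≤ T →
      ‖davieRemainder σ ζ A (driftIncrement β x) x s t‖ ≤ D := by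
    intro s t hs hst ht
    have ms : s ∈ Icc 0 T := ⟨ha.trans hs, hst.trans ht⟩
    have hts : t - s ≤ T := by linarith [ms.1]
    have hts0 : 0 ≤ t - s := by linarith
    have r1 : ‖inc x s t‖ ≤ B + B := (norm_sub_le _ _).trans
      (add_le_add (hB t ⟨hs.trans hst, ht⟩) (hB s ⟨hs, hst.trans ht⟩))
    have r2 : ‖driftIncrement β x s t‖ ≤ C * T :=
      (hβ.norm_driftIncrement_le x hs hst ht).trans (by gcongr)
    have r3 : ‖σ s (x s) (inc ζ s t)‖ ≤ C * (N * T ^ α) := by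
      refine (ContinuousLinearMap.le_opNorm _ _).trans ?_
      gcongr
      · exact H.field.base.bound s ms _
      · exact (hA.path s t hs hst ht).trans (by gcongr)
    have r4 : ‖contract (levyField σ s (x s)) (A s t)‖ ≤ C * (N * T ^ (2 * α)) := by
      refine (norm_contract_le _ _).trans ?_
      gcongr
      · exact entrySum_nonneg _
      · exact H.levy.bound s ms _
      · exact (hA.area s t hs hst ht).trans (by gcongr)
    refine (norm_sub_le _ _).trans (add_le_add ((norm_sub_le _ _).trans (add_le_add r1 r2))
      ((norm_add_le _ _).trans (add_le_add r3 r4)))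
  refine ⟨x, ⟨hcont, 2 / 3 + α, by linarith, M + D / h ^ (2 / 3 + α), fun s t hs hst ht => ?_⟩,
    tendsto_nhds_unique (hx a le_rfl haT) (by simp only [hy]; exact tendsto_const_nhds)⟩
  have hts0 : 0 ≤ t - s := by linarith
  rcases le_total (t - s) h with hts | hts
  · refine (hshort s t hs hst ht hts).trans ?_
    gcongr
    exact le_add_of_nonneg_right (by positivity)
  · calc _ ≤ D := hlong s t hs hst ht
      _ = D / h ^ (2 / 3 + α) * h ^ (2 / 3 + α) := by field_simp
      _ ≤ (M + D / h ^ (2 / 3 + α)) * (t - s) ^ (2 / 3 + α) := by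
        gcongr
        exact le_add_of_nonneg_left hM

end Equivalence

/-! ### Relaxed controls: averaged drift and measurability of the reward -/

section Wasserstein

variable {U : Type*} [MetricSpace U] [SecondCountableTopology U] [MeasurableSpace U] [BorelSpace U]

instance (m : P2 U) : IsProbabilityMeasure m.1 := m.2.1

omit [SecondCountableTopology U] in
theorem integrable_of_bounded_continuous {W : Type*} [NormedAddCommGroup W]
    [SecondCountableTopologyEither U W] (m : P2 U) {f : U → W} {C : ℝ} (hf : Continuous f)
    (hC : ∀ a, ‖f a‖ ≤ C) : Integrable f m.1 :=
  Integrable.of_bound hf.aestronglyMeasurable C (Eventually.of_forall hC)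

/-- Integrals of bounded Lipschitz functions are Lipschitz for the Wasserstein distance. -/
theorem abs_integral_sub_le_of_W2_lt {m₁ m₂ : P2 U} {f : U → ℝ} {C r : ℝ} {L : NNReal}
    (hC : ∀ a, ‖f a‖ ≤ C) (hf : LipschitzWith L f) (hr : 0 ≤ r)
    (h : W2 m₁ m₂ < ENNReal.ofReal r) :
    |(∫ a, f a ∂m₁.1) - ∫ a, f a ∂m₂.1| ≤ L * r := by
  simp only [W2, iInf_lt_iff] at h
  obtain ⟨π, ⟨h1, h2⟩, hπ⟩ := h
  have : IsProbabilityMeasure π := by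
    constructor
    have := congrArg (fun μ : Measure U => μ univ) h1
    simp only [Measure.map_apply measurable_fst MeasurableSet.univ, preimage_univ] at this
    rw [this]
    exact measure_univ
  have hm := hf.continuous.measurable
  have i1 : Integrable (fun p : U × U => f p.1) π :=
    Integrable.of_bound (hm.comp measurable_fst).aestronglyMeasurable C
      (Eventually.of_forall fun p => hC p.1)
  have i2 : Integrable (fun p : U × U => f p.2) π :=
    Integrable.of_bound (hm.comp measurable_snd).aestronglyMeasurable C
      (Eventually.of_forall fun p => hC p.2)
  rw [← h1, ← h2, integral_map measurable_fst.aemeasurable hm.aestronglyMeasurable,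
    integral_map measurable_snd.aemeasurable hm.aestronglyMeasurable, ← integral_sub i1 i2]
  have hed : Measurable fun p : U × U => edist p.1 p.2 := measurable_edist
  -- Cauchy–Schwarz against the constant $1$: the mean distance under the coupling is at most its
  -- $L^2$ norm.
  have hol := ENNReal.lintegral_mul_le_Lp_mul_Lq π (p := 2) (q := 2)
    (Real.HolderConjugate.two_two) hed.aemeasurable (aemeasurable_const (b := (1 : ℝ≥0∞)))
  simp only [Pi.mul_apply, mul_one, ENNReal.one_rpow, lintegral_const, measure_univ] at hol
  have key : ‖∫ p, (f p.1 - f p.2) ∂π‖ₑ ≤ L * ENNReal.ofReal r := by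
    calc _ ≤ ∫⁻ p, ‖f p.1 - f p.2‖ₑ ∂π := enorm_integral_le_lintegral_enorm _
      _ ≤ ∫⁻ p, L * edist p.1 p.2 ∂π := lintegral_mono fun p => by
          rw [← edist_eq_enorm_sub]; exact hf p.1 p.2
      _ = L * ∫⁻ p, edist p.1 p.2 ∂π := lintegral_const_mul _ hed
      _ ≤ L * ENNReal.ofReal r := by
          gcongr
          refine hol.trans (le_trans (le_of_eq ?_) hπ.le)
          simp
  rw [← Real.norm_eq_abs, ← toReal_enorm]
  refine (ENNReal.toReal_mono (by finiteness) key).trans ?_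
  simp [hr]

variable {K : Set (P2 U)} {ε L s T : ℝ} {γ : ℝ → P2 U}

/-- Controls are weakly continuous. -/
theorem tendsto_integral_of_mem_controls (hε : 0 < ε) (hL : 0 < L) (hγ : γ ∈ controls K ε L s T)
    {r : ℝ} (hr : r ∈ Icc s T) {f : U → ℝ} {C : ℝ} (hf : Continuous f) (hC : ∀ a, ‖f a‖ ≤ C) :
    Tendsto (fun t => ∫ a, f a ∂(γ t).1) (𝓝[Icc s T] r) (𝓝 (∫ a, f a ∂(γ r).1)) := by
  -- The drift is only locally Lipschitz in $a$, so general bounded continuous test functions are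
  -- needed. Weak convergence reduces them to bounded Lipschitz ones, which the Wasserstein distance
  -- controls.
  let μ : ℝ → ProbabilityMeasure U := fun t => ⟨(γ t).1, (γ t).2.1⟩
  have hμ : Tendsto μ (𝓝[Icc s T] r) (𝓝 (μ r)) := by
    rw [tendsto_iff_forall_lipschitz_integral_tendsto]
    rintro g ⟨B, hB⟩ ⟨M, hM⟩
    obtain ⟨D, hD⟩ : ∃ D, ∀ a, ‖g a‖ ≤ D := by
      rcases isEmpty_or_nonempty U with hU | ⟨⟨a₀⟩⟩
      · exact ⟨0, fun a => hU.elim a⟩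
      · refine ⟨‖g a₀‖ + B, fun a => ?_⟩
        have := norm_le_norm_add_norm_sub' (g a) (g a₀)
        have := hB a a₀
        rw [dist_eq_norm] at this
        linarith
    have hbound : ∀ t ∈ Icc s T, |(∫ a, g a ∂(γ t).1) - ∫ a, g a ∂(γ r).1|
        ≤ M * (L * |r - t| ^ ε) := by
      intro t ht
      -- The infimum over couplings need not be attained, so a margin $\eta>0$ is added and sent to
      -- $0$.
      have hlim : Tendsto (fun η : ℝ => M * (L * |r - t| ^ ε + η)) (𝓝[>] 0)
          (𝓝 (M * (L * |r - t| ^ ε + 0))) :=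
        ((tendsto_const_nhds.add (tendsto_nhdsWithin_of_tendsto_nhds tendsto_id)).const_mul _)
      rw [add_zero] at hlim
      refine ge_of_tendsto hlim (eventually_nhdsWithin_of_forall fun η hη => ?_)
      have h0 : 0 ≤ L * |r - t| ^ ε := by positivity
      have hη' : (0 : ℝ) < η := hη
      refine abs_integral_sub_le_of_W2_lt hD hM (by linarith)
        ((hγ.2 t ht r hr).trans_lt ?_)
      exact (ENNReal.ofReal_lt_ofReal_iff (by linarith)).2 (by linarith)
    have hcont : Tendsto (fun t => M * (L * |r - t| ^ ε)) (𝓝[Icc s T] r) (𝓝 0) := by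
      have hc : Continuous fun t : ℝ => M * (L * |r - t| ^ ε) :=
        continuous_const.mul (continuous_const.mul
          (((continuous_const.sub continuous_id).abs).rpow_const fun _ => Or.inr hε.le))
      have h0 := hc.continuousWithinAt (s := Icc s T) (x := r)
      rw [ContinuousWithinAt, sub_self, abs_zero, Real.zero_rpow hε.ne', mul_zero, mul_zero] at h0
      exact h0
    rw [tendsto_iff_norm_sub_tendsto_zero]
    exact tendsto_of_tendsto_of_tendsto_of_le_of_le' tendsto_const_nhds hcont
      (Eventually.of_forall fun _ => norm_nonneg _)
      (eventually_nhdsWithin_of_forall fun t ht => hbound t ht)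
  rw [ProbabilityMeasure.tendsto_iff_forall_integral_tendsto] at hμ
  exact hμ (BoundedContinuousFunction.ofNormedAddCommGroup f hf C hC)

theorem tendsto_integral_euclidean_of_mem_controls {m : ℕ} (hε : 0 < ε) (hL : 0 < L)
    (hγ : γ ∈ controls K ε L s T)
    {r : ℝ} (hr : r ∈ Icc s T) {f : U → E m} {C : ℝ} (hf : Continuous f) (hC : ∀ a, ‖f a‖ ≤ C) :
    Tendsto (fun t => ∫ a, f a ∂(γ t).1) (𝓝[Icc s T] r) (𝓝 (∫ a, f a ∂(γ r).1)) := by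
  rw [(EuclideanSpace.equiv (Fin m) ℝ).toHomeomorph.isInducing.tendsto_nhds_iff, tendsto_pi_nhds]
  intro i
  have e : ∀ t, (∫ a, f a ∂(γ t).1) i = ∫ a, f a i ∂(γ t).1 := fun t =>
    ((EuclideanSpace.proj (𝕜 := ℝ) i).integral_comp_comm
      (integrable_of_bounded_continuous (γ t) hf hC)).symm
  have h := tendsto_integral_of_mem_controls hε hL hγ hr (f := fun a => f a i) (C := C)
    ((EuclideanSpace.proj (𝕜 := ℝ) i).continuous.comp hf)
    (fun a => (PiLp.norm_apply_le (f a) i).trans (hC a))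
  simp only [← e] at h
  exact h

/-- The drift averaged over a control. -/
noncomputable def averagedDrift {m : ℕ} (b : ℝ → E m → U → E m) (γ : ℝ → P2 U) (r : ℝ)
    (x : E m) : E m :=
  ∫ a, b r x a ∂(γ r).1

theorem DriftRegular.exists_driftField {m : ℕ} {b : ℝ → E m → U → E m} (hb : DriftRegular T b) :
    ∃ C : ℝ, ∀ K : Set (P2 U), ∀ ε L s : ℝ, 0 < ε → 0 < L → 0 ≤ s → ∀ γ ∈ controls K ε L s T,
      DriftField s T C (averagedDrift b γ) := by
  obtain ⟨⟨C, hC⟩, hunif⟩ := hb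
  refine ⟨C, fun K ε L s hε hL hs γ hγ => ?_⟩
  have mem : ∀ {r}, r ∈ Icc s T → r ∈ Icc 0 T := fun hr => ⟨hs.trans hr.1, hr.2⟩
  have hcont : ∀ r ∈ Icc s T, ∀ x, Continuous (b r x) := by
    intro r hr x
    refine continuous_iff_continuousAt.2 fun a => ?_
    rw [ContinuousAt, tendsto_iff_norm_sub_tendsto_zero]
    have h0 : Tendsto (fun a' => C * dist a' a) (𝓝 a) (𝓝 0) := by
      have : Continuous fun a' => C * dist a' a := by fun_prop
      simpa using this.tendsto a
    exact tendsto_of_tendsto_of_tendsto_of_le_of_le' tendsto_const_nhds h0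
      (Eventually.of_forall fun _ => norm_nonneg _) ((hC r (mem hr) a).2 x).2.2
  have hbd : ∀ r ∈ Icc s T, ∀ x a, ‖b r x a‖ ≤ C := fun r hr x a => ((hC r (mem hr) a).2 x).1
  have hint : ∀ r ∈ Icc s T, ∀ x t, Integrable (b r x) (γ t).1 := fun r hr x t =>
    integrable_of_bounded_continuous (γ t) (hcont r hr x) (hbd r hr x)
  refine ⟨fun r hr x => ?_, fun r hr x y => ?_, fun x r hr => ?_⟩
  · have := norm_integral_le_of_norm_le_const (μ := (γ r).1)
      (Eventually.of_forall (hbd r hr x))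
    simpa [averagedDrift] using this
  · rw [averagedDrift, averagedDrift, ← integral_sub (hint r hr x r) (hint r hr y r)]
    have := norm_integral_le_of_norm_le_const (μ := (γ r).1) (f := fun a => b r x a - b r y a)
      (C := C * ‖x - y‖) (Eventually.of_forall fun a =>
        norm_sub_le_of_fderiv_le ((hC r (mem hr) a).1.differentiable (by norm_num))
          (fun x => ((hC r (mem hr) a).2 x).2.1) x y)
    simpa using this
  -- Continuity in time: weak continuity of the control with the integrand frozen at $r$, plus the
  -- modulus of $b$ in time, which is uniform in $a$ and so survives averaging against $\gamma_t$.
  · have h1 := tendsto_integral_euclidean_of_mem_controls hε hL hγ hr (hcont r hr x) (hbd r hr x)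
    have h2 : Tendsto (fun t => averagedDrift b γ t x - ∫ a, b r x a ∂(γ t).1) (𝓝[Icc s T] r)
        (𝓝 0) := by
      rw [Metric.tendsto_nhds]
      intro η hη
      obtain ⟨δ, hδ, hδ'⟩ := hunif x (η / 2) (half_pos hη)
      have : ∀ᶠ t in 𝓝[Icc s T] r, dist t r < δ :=
        mem_nhdsWithin_of_mem_nhds (Metric.ball_mem_nhds r hδ)
      filter_upwards [this, self_mem_nhdsWithin] with t ht ht'
      rw [dist_zero_right, averagedDrift, ← integral_sub (hint t ht' x t) (hint r hr x t)]
      have h3 := norm_integral_le_of_norm_le_const (μ := (γ t).1)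
        (f := fun a => b t x a - b r x a) (C := η / 2)
        (Eventually.of_forall fun a => hδ' t (mem ht') r (mem hr) ht a)
      simp only [measureReal_def, measure_univ, ENNReal.toReal_one, mul_one] at h3
      linarith
    have h3 := h2.add h1
    simp only [sub_add_cancel, zero_add] at h3
    exact h3

-- A Carathéodory argument. With path and control frozen at the left points of a grid of mesh
-- $1/(n+1)$, the integrand is a countable gluing of measurable functions. It converges pointwise
-- because $F$ is Lipschitz in the state and in the measure.
omit [SecondCountableTopology U] [BorelSpace U] in
theorem RewardRegular.aestronglyMeasurable {m : ℕ} {F : ℝ → E m → P2 U → ℝ}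
    (hF : RewardRegular T K F) (hε : 0 < ε) (hL : 0 < L) (hs : 0 ≤ s)
    (hγ : γ ∈ controls K ε L s T) {x : ℝ → E m} (hx : ContinuousOn x (Icc s T)) :
    AEStronglyMeasurable (fun r => F r (x r) (γ r)) (volume.restrict (Icc s T)) := by
  obtain ⟨hmeas, C, hC⟩ := hF
  let k : ℕ → ℝ → ℕ := fun n r => ⌊(r - s) * (n + 1)⌋₊
  let φ : ℕ → ℕ → ℝ := fun n j => s + j / (n + 1)
  have hφ : ∀ n, ∀ r ∈ Icc s T, s ≤ φ n (k n r) ∧ φ n (k n r) ≤ r ∧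
      r - φ n (k n r) ≤ 1 / ((n : ℝ) + 1) := by
    intro n r hr
    have hn : (0 : ℝ) < n + 1 := by positivity
    have h0 : 0 ≤ (r - s) * (n + 1) := mul_nonneg (by linarith [hr.1]) hn.le
    have h1 := Nat.floor_le h0
    have h2 := Nat.lt_floor_add_one ((r - s) * (n + 1))
    have h3 : (⌊(r - s) * (n + 1)⌋₊ : ℝ) / (n + 1) ≤ r - s := by rwa [div_le_iff₀ hn]
    have h4 : r - s ≤ (⌊(r - s) * (n + 1)⌋₊ : ℝ) / (n + 1) + 1 / (n + 1) := by
      rw [← add_div, le_div_iff₀ hn]; exact h2.le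
    refine ⟨le_add_of_nonneg_right (by positivity), ?_, ?_⟩ <;> simp only [φ, k] <;> linarith
  have hmem : ∀ n, ∀ r ∈ Icc s T, φ n (k n r) ∈ Icc s T := fun n r hr =>
    ⟨(hφ n r hr).1, (hφ n r hr).2.1.trans hr.2⟩
  have hstep : ∀ n, AEStronglyMeasurable
      (fun r => F r (x (φ n (k n r))) (γ (φ n (k n r)))) (volume.restrict (Icc s T)) := by
    intro n
    have hk : Measurable (k n) := by
      refine Nat.measurable_floor.comp ?_
      fun_prop
    have hcover : Icc s T = ⋃ j, Icc s T ∩ k n ⁻¹' {j} := by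
      rw [← inter_iUnion]
      exact (inter_eq_left.2 fun r _ => mem_iUnion.2 ⟨k n r, rfl⟩).symm
    rw [hcover, aestronglyMeasurable_iUnion_iff]
    intro j
    have hms : MeasurableSet (Icc s T ∩ k n ⁻¹' {j}) :=
      measurableSet_Icc.inter (hk (measurableSet_singleton j))
    -- Only a nonempty piece guarantees that its grid point lies in $[s,T]$, hence that the frozen
    -- measure is in $\mathcal K$.
    rcases (Icc s T ∩ k n ⁻¹' {j}).eq_empty_or_nonempty with he | ⟨r₀, hr₀, hj⟩
    · rw [he]; simp
    · have hj' : k n r₀ = j := hj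
      have h1 : AEStronglyMeasurable (fun r => F r (x (φ n j)) (γ (φ n j)))
          (volume.restrict (Icc s T ∩ k n ⁻¹' {j})) :=
        (hmeas (x (φ n j)) (γ (φ n j)) (hγ.1 _ (hj' ▸ hmem n r₀ hr₀))).mono_measure
          (Measure.restrict_mono (show Icc s T ∩ k n ⁻¹' {j} ⊆ Icc 0 T from
            fun r hr => ⟨hs.trans hr.1.1, hr.1.2⟩) le_rfl)
      refine h1.congr ?_
      filter_upwards [ae_restrict_mem hms] with r hr
      have : k n r = j := hr.2
      rw [this]
  refine aestronglyMeasurable_of_tendsto_ae atTop hstep ?_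
  filter_upwards [ae_restrict_mem measurableSet_Icc] with r hr
  have hr0 : r ∈ Icc 0 T := ⟨hs.trans hr.1, hr.2⟩
  have hφr : Tendsto (fun n => φ n (k n r)) atTop (𝓝 r) := by
    have h0 : Tendsto (fun n : ℕ => r - 1 / ((n : ℝ) + 1)) atTop (𝓝 (r - 0)) :=
      tendsto_const_nhds.sub tendsto_one_div_add_atTop_nhds_zero_nat
    rw [sub_zero] at h0
    exact tendsto_of_tendsto_of_tendsto_of_le_of_le h0 tendsto_const_nhds
      (fun n => by linarith [(hφ n r hr).2.2]) (fun n => (hφ n r hr).2.1)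
  have hxr : Tendsto (fun n => x (φ n (k n r))) atTop (𝓝 (x r)) :=
    (hx r hr).tendsto.comp (tendsto_nhdsWithin_iff.2
      ⟨hφr, Eventually.of_forall fun n => hmem n r hr⟩)
  have hC0 : 0 ≤ C := (abs_nonneg _).trans ((hC r hr0).1 (x r) _ (hγ.1 r hr))
  have hbound : ∀ n, |F r (x (φ n (k n r))) (γ (φ n (k n r))) - F r (x r) (γ r)| ≤
      C * ‖x (φ n (k n r)) - x r‖ + C * (L * |r - φ n (k n r)| ^ ε) := by
    intro n
    have h1 := (hC r hr0).2.1 (x (φ n (k n r))) (x r) _ (hγ.1 _ (hmem n r hr))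
    have h2 := (hC r hr0).2.2 (x r) _ (hγ.1 _ (hmem n r hr)) _ (hγ.1 r hr)
    have h3 := h2.trans (mul_le_mul_right (hγ.2 _ (hmem n r hr) r hr) _)
    rw [← ENNReal.ofReal_mul hC0, ENNReal.ofReal_le_ofReal_iff (by positivity)] at h3
    exact (abs_sub_le _ (F r (x r) (γ (φ n (k n r)))) _).trans (add_le_add h1 h3)
  rw [tendsto_iff_norm_sub_tendsto_zero]
  refine squeeze_zero (fun n => norm_nonneg _) hbound ?_
  have l1 : Tendsto (fun n => C * ‖x (φ n (k n r)) - x r‖) atTop (𝓝 (C * 0)) :=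
    ((tendsto_iff_norm_sub_tendsto_zero.1 hxr).const_mul C)
  have l2 : Tendsto (fun n => C * (L * |r - φ n (k n r)| ^ ε)) atTop (𝓝 (C * (L * 0))) := by
    refine Tendsto.const_mul C (Tendsto.const_mul L ?_)
    have hc : Continuous fun t : ℝ => |r - t| ^ ε :=
      ((continuous_const.sub continuous_id).abs).rpow_const fun _ => Or.inr hε.le
    have := (hc.tendsto r).comp hφr
    simpa [Function.comp_def, Real.zero_rpow hε.ne'] using this
  simpa using l1.add l2

end Wasserstein

/-! ### Uniform bounds and rates for the drivers -/

section Drivers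

variable {d : ℕ} {T α α' N ϱ : ℝ} {ζ ζ' : ℝ → E d} {A A' : ℝ → ℝ → Fin d → Fin d → ℝ}

/-- Two drivers with areas are within `ϱ` of each other on `[0, T]`. -/
structure DriverClose (T α ϱ : ℝ) (ζ : ℝ → E d) (A : ℝ → ℝ → Fin d → Fin d → ℝ)
    (ζ' : ℝ → E d) (A' : ℝ → ℝ → Fin d → Fin d → ℝ) : Prop where
  path : ∀ s t, 0 ≤ s → s ≤ t → t ≤ T → ‖inc ζ s t - inc ζ' s t‖ ≤ ϱ * (t - s) ^ α
  area : ∀ s t, 0 ≤ s → s ≤ t → t ≤ T → entrySum (A s t - A' s t) ≤ ϱ * (t - s) ^ (2 * α)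

theorem area_self_eq_zero {s : ℝ} (h : ∀ i j, delta A s s s i j = inc ζ s s i * inc ζ s s j) :
    A s s = 0 := by
  ext i j
  simpa [delta, inc] using h i j

theorem rpow_le_rpow_sub_mul {h : ℝ} (h0 : 0 ≤ h) (hT : h ≤ T) (hα : 0 < α) (hαα : α' ≤ α) :
    h ^ α ≤ T ^ (α - α') * h ^ α' := by
  rcases h0.eq_or_lt with rfl | h0'
  · rw [Real.zero_rpow hα.ne']
    positivity
  · calc h ^ α = h ^ (α - α') * h ^ α' := by rw [← Real.rpow_add h0', sub_add_cancel]
      _ ≤ _ := by gcongr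

theorem IsGeometricRoughPath.exists_driverBound (h : IsGeometricRoughPath T α ζ A) (hα : 0 < α')
    (hαα : α' ≤ α) : ∃ N ≥ 0, DriverBound 0 T α' N ζ A := by
  have h1 := (holderBound_of_holderNorm h.holder_path fun s _ _ => sub_self _).of_exponent hα hαα
  have h2 := (holderBound_of_holderNorm h.holder_area fun s hs hs' =>
    area_self_eq_zero (h.chen s s s hs le_rfl le_rfl hs')).of_exponent
      (q := 2 * α') (by linarith) (by linarith)
  obtain ⟨M₁, hM₁, h1⟩ := h1
  obtain ⟨M₂, hM₂, h2⟩ := h2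
  refine ⟨M₁ + d ^ 2 * M₂, by positivity, fun s t hs hst ht => ?_, fun s t hs hst ht => ?_, h.chen⟩
  · refine (h1 s t hs hst ht).trans ?_
    have : 0 ≤ t - s := by linarith
    gcongr
    exact le_add_of_nonneg_right (by positivity)
  · have h0 : 0 ≤ t - s := by linarith
    calc _ ≤ d ^ 2 * ‖A s t‖ := entrySum_le _
      _ ≤ d ^ 2 * (M₂ * (t - s) ^ (2 * α')) := by gcongr; exact h2 s t hs hst ht
      _ = d ^ 2 * M₂ * (t - s) ^ (2 * α') := by ring
      _ ≤ _ := by gcongr; exact le_add_of_nonneg_left hM₁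

/-- The powers of $T$ pay for lowering the exponents, and $d^2$ for passing from the largest entry
to the sum of entries. -/
theorem driverClose_of_roughDist (hα : 0 < α) (hαα : α' ≤ α)
    (h : roughDist T α ζ A ζ' A' ≠ ∞)
    (hA : ∀ s, 0 ≤ s → s ≤ T → A s s = 0) (hA' : ∀ s, 0 ≤ s → s ≤ T → A' s s = 0) :
    DriverClose T α' ((roughDist T α ζ A ζ' A').toReal *
      (T ^ (α - α') + d ^ 2 * T ^ (2 * α - 2 * α'))) ζ A ζ' A' := by
  obtain ⟨n1, n2⟩ := ENNReal.add_ne_top.1 h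
  have e := ENNReal.toReal_add n1 n2
  rw [show holderNorm 0 T α (fun s t => inc ζ s t - inc ζ' s t) +
    holderNorm 0 T (2 * α) (fun s t => A s t - A' s t) = roughDist T α ζ A ζ' A' from rfl] at e
  set D := (roughDist T α ζ A ζ' A').toReal with hD
  have p1 := ENNReal.toReal_nonneg (a := holderNorm 0 T α fun s t => inc ζ s t - inc ζ' s t)
  have p2 := ENNReal.toReal_nonneg (a := holderNorm 0 T (2 * α) fun s t => A s t - A' s t)
  have hD0 : 0 ≤ D := ENNReal.toReal_nonneg
  refine ⟨fun s t hs hst ht => ?_, fun s t hs hst ht => ?_⟩ <;>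
    have hT : 0 ≤ T := hs.trans (hst.trans ht) <;>
    have h0 : 0 ≤ t - s := sub_nonneg.2 hst
  · rcases hst.eq_or_lt with rfl | hst'
    · simp only [inc, sub_self, norm_zero] at h0 ⊢
      positivity
    calc _ ≤ _ := norm_le_holderNorm_toReal n1 hs hst' ht
      _ ≤ D * (T ^ (α - α') * (t - s) ^ α') := by
        gcongr
        · linarith
        · exact rpow_le_rpow_sub_mul h0 (by linarith) hα hαα
      _ = D * T ^ (α - α') * (t - s) ^ α' := by ring
      _ ≤ _ := by gcongr; exact le_add_of_nonneg_right (by positivity)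
  · rcases hst.eq_or_lt with rfl | hst'
    · rw [hA s hs ht, hA' s hs ht]
      simp only [sub_self, entrySum, Pi.zero_apply, abs_zero, Finset.sum_const_zero]
      positivity
    calc _ ≤ d ^ 2 * ‖A s t - A' s t‖ := entrySum_le _
      _ ≤ d ^ 2 * (D * (T ^ (2 * α - 2 * α') * (t - s) ^ (2 * α'))) := by
        gcongr
        refine (norm_le_holderNorm_toReal n2 hs hst' ht).trans ?_
        gcongr
        · linarith
        · exact rpow_le_rpow_sub_mul h0 (by linarith) (by linarith) (by linarith)
      _ = D * (d ^ 2 * T ^ (2 * α - 2 * α')) * (t - s) ^ (2 * α') := by ring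
      _ ≤ _ := by gcongr; exact le_add_of_nonneg_left (by positivity)

theorem DriverBound.of_close (h : DriverBound 0 T α N ζ A) (h' : DriverClose T α ϱ ζ' A' ζ A)
    (hN : N + ϱ ≤ N')
    (hc : ∀ s u t, 0 ≤ s → s ≤ u → u ≤ t → t ≤ T → ∀ i j,
      delta A' s u t i j = inc ζ' s u i * inc ζ' u t j) :
    DriverBound 0 T α N' ζ' A' where
  path s t hs hst ht := by
    have h0 : 0 ≤ t - s := sub_nonneg.2 hst
    have h1 := norm_le_norm_add_norm_sub' (inc ζ' s t) (inc ζ s t)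
    have h2 := h.path s t hs hst ht
    have h3 := h'.path s t hs hst ht
    calc _ ≤ (N + ϱ) * (t - s) ^ α := by rw [add_mul]; linarith
      _ ≤ _ := by gcongr
  area s t hs hst ht := by
    have h0 : 0 ≤ t - s := sub_nonneg.2 hst
    have h1 : entrySum (A' s t) ≤ entrySum (A s t) + entrySum (A' s t - A s t) := by
      simp only [entrySum, ← Finset.sum_add_distrib]
      gcongr with i _ j _
      have := abs_add_le (A s t i j) (A' s t i j - A s t i j)
      simpa using this
    have h2 := h.area s t hs hst ht
    have h3 := h'.area s t hs hst ht
    calc _ ≤ (N + ϱ) * (t - s) ^ (2 * α) := by rw [add_mul]; linarith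
      _ ≤ _ := by gcongr
  chen := hc

theorem DriverBound.mono_const (h : DriverBound 0 T α N ζ A) (hN : N ≤ N') :
    DriverBound 0 T α N' ζ A where
  path s t hs hst ht := (h.path s t hs hst ht).trans (by
    have : 0 ≤ t - s := sub_nonneg.2 hst
    gcongr)
  area s t hs hst ht := (h.area s t hs hst ht).trans (by
    have : 0 ≤ t - s := sub_nonneg.2 hst
    gcongr)
  chen := h.chen

/-- Convergent lifts are eventually uniformly bounded, and close to their limit at a rate. -/
theorem exists_driverClose (hT : 0 ≤ T) (hα : 0 < α') (hαα : α' ≤ α)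
    (h : IsGeometricRoughPath T α ζ A) {ζn : ℕ → ℝ → E d} {An : ℕ → ℝ → ℝ → Fin d → Fin d → ℝ}
    (hc : ∀ n s u t, 0 ≤ s → s ≤ u → u ≤ t → t ≤ T → ∀ i j,
      delta (An n) s u t i j = inc (ζn n) s u i * inc (ζn n) u t j)
    (hconv : Tendsto (fun n => roughDist T α (ζn n) (An n) ζ A) atTop (𝓝 0)) :
    ∃ N ≥ (1 : ℝ), ∃ ϱ : ℕ → ℝ, ∃ k : ℕ, Tendsto ϱ atTop (𝓝 0) ∧
      (∀ n, 0 ≤ ϱ n) ∧ DriverBound 0 T α' N ζ A ∧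
      ∀ n ≥ k, DriverBound 0 T α' N (ζn n) (An n) ∧ DriverClose T α' (ϱ n) (ζn n) (An n) ζ A := by
  obtain ⟨N, hN, hb⟩ := h.exists_driverBound hα hαα
  -- An infinite distance has real value $0$, so $\varrho_n$ is meaningful only from the index $k$
  -- on, where the distance is finite and $\varrho_n\le1$.
  set ϱ : ℕ → ℝ := fun n => (roughDist T α (ζn n) (An n) ζ A).toReal *
      (T ^ (α - α') + d ^ 2 * T ^ (2 * α - 2 * α')) with hϱ
  have hlim : Tendsto ϱ atTop (𝓝 0) := by
    have := ((ENNReal.tendsto_toReal ENNReal.zero_ne_top).comp hconv).mul_const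
      (T ^ (α - α') + d ^ 2 * T ^ (2 * α - 2 * α'))
    simpa [hϱ, Function.comp_def] using this
  have hev : ∀ᶠ n in atTop, roughDist T α (ζn n) (An n) ζ A < ∞ ∧ ϱ n ≤ 1 :=
    (hconv.eventually_lt_const ENNReal.zero_lt_top).and
      (hlim.eventually_le_const zero_lt_one)
  obtain ⟨k, hk⟩ := eventually_atTop.1 hev
  refine ⟨N + 1, by linarith, ϱ, k, hlim,
    fun n => mul_nonneg ENNReal.toReal_nonneg (by positivity), hb.mono_const (by linarith),
    fun n hn => ?_⟩
  have hcl : DriverClose T α' (ϱ n) (ζn n) (An n) ζ A :=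
    driverClose_of_roughDist (hα.trans_le hαα) hαα (hk n hn).1.ne
      (fun s hs hs' => area_self_eq_zero (hc n s s s hs le_rfl le_rfl hs'))
      (fun s hs hs' => area_self_eq_zero (h.chen s s s hs le_rfl le_rfl hs'))
  exact ⟨hb.of_close hcl (by linarith [(hk n hn).2]) (hc n), hcl⟩

end Drivers

/-! ### A common constant for the coefficients -/

section Coefficients

variable {m d : ℕ} {T C C' a b : ℝ}

theorem DriftField.mono {β : ℝ → E m → E m} (h : DriftField a b C β) (hC : C ≤ C') :
    DriftField a b C' β where
  bound r hr x := (h.bound r hr x).trans hC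
  lip r hr x y := (h.lip r hr x y).trans (by gcongr)
  cont := h.cont

/-- The lower bound $C_0$ is there for the constant of the drift, so that all coefficients share one
$C$. -/
theorem DiffusionRegular.exists_roughData {σ : ℝ → E m → E d →L[ℝ] E m}
    (hσ : DiffusionRegular T σ) {α N : ℝ} (hα : 1 / 3 < α) (hα' : α ≤ 1 / 2) (hN : 1 ≤ N)
    (C₀ : ℝ) : ∃ C ≥ C₀, RoughData T α C N σ := by
  obtain ⟨C, hx, ht⟩ := hσ
  obtain ⟨C₁, h₁⟩ := exists_fieldRegular hx ht
  have h₂ : SpaceTimeRegular T (6 * C₁ ^ 2) (levyField σ) := h₁.deriv.comp h₁.base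
  refine ⟨max (max C₀ 1) (max C₁ (6 * C₁ ^ 2)), (le_max_left _ _).trans (le_max_left _ _), hα, hα',
    (le_max_right _ _).trans (le_max_left _ _), hN,
    h₁.mono ((le_max_left _ _).trans (le_max_right _ _)),
    h₂.mono ((le_max_right _ _).trans (le_max_right _ _))⟩

end Coefficients

/-! ### Well-posedness of the state equations -/

section StateEquation

variable {m d : ℕ} {U : Type*} [MetricSpace U] [MeasurableSpace U] {T C N s : ℝ}
  {b : ℝ → E m → U → E m} {σ : ℝ → E m → E d →L[ℝ] E m} {γ : ℝ → P2 U} {x : ℝ → E m} {y : E m}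

theorem isClassicalSolution_iff {ζ : ℝ → E d} (hT : 0 < T) (hζ : ContDiffOn ℝ 1 ζ (Icc 0 T))
    (hβ : DriftField s T C (averagedDrift b γ)) (hσ : FieldRegular T C σ) (hs : 0 ≤ s) :
    IsClassicalSolution T b σ ζ s y γ x ↔ ContinuousOn x (Icc s T) ∧ ∀ t ∈ Icc s T,
      x t = y + driftIncrement
        (fun t x => averagedDrift b γ t x + σ t x (pathDeriv T ζ t)) x s t := by
  refine and_congr_right fun hx => forall₂_congr fun t ht => ?_
  have hξ := pathDeriv_continuousOn hT hζ
  obtain ⟨B, hB⟩ := isCompact_Icc.exists_bound_of_continuousOn hξ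
  have hsub : Icc s T ⊆ Icc 0 T := Icc_subset_Icc_left hs
  have hv := hβ.velocity hσ hs (hξ.mono hsub) fun t ht => hB t (hsub ht)
  have i1 := hβ.intervalIntegrable hx le_rfl ht.1 ht.2
  have i2 : IntervalIntegrable (fun r => σ r (x r) (pathDeriv T ζ r)) volume s t := by
    simpa using (hv.intervalIntegrable hx le_rfl ht.1 ht.2).sub i1
  rw [driftIncrement, intervalIntegral.integral_add i1 i2, ← add_assoc]
  rfl

theorem exists_isClassicalSolution {ζ : ℝ → E d} (hT : 0 < T) (hζ : ContDiffOn ℝ 1 ζ (Icc 0 T))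
    (hβ : DriftField s T C (averagedDrift b γ)) (hσ : FieldRegular T C σ) (hs : s ∈ Icc 0 T)
    (y : E m) : ∃ x, IsClassicalSolution T b σ ζ s y γ x ∧
      ∀ x', IsClassicalSolution T b σ ζ s y γ x' → EqOn x' x (Icc s T) := by
  have hξ := pathDeriv_continuousOn hT hζ
  obtain ⟨B, hB⟩ := isCompact_Icc.exists_bound_of_continuousOn hξ
  have hB0 : 0 ≤ B := (norm_nonneg _).trans (hB 0 ⟨le_rfl, hT.le⟩)
  have hC := hσ.base.nonneg
  have hsub : Icc s T ⊆ Icc 0 T := Icc_subset_Icc_left hs.1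
  have hv := hβ.velocity hσ hs.1 (hξ.mono hsub) fun t ht => hB t (hsub ht)
  have hC' : 0 ≤ C + C * B := by positivity
  obtain ⟨x, hx, h⟩ := hv.exists_integral_solution hs.2 hC' y
  refine ⟨x, (isClassicalSolution_iff hT hζ hβ hσ hs.1).2 ⟨hx, h⟩, fun x' hx' => ?_⟩
  obtain ⟨hx', h'⟩ := (isClassicalSolution_iff hT hζ hβ hσ hs.1).1 hx'
  exact hv.integral_solution_unique hC' hx' hx h' h

theorem IsClassicalSolution.davieSolution {ζ : ℝ → E d} (hT : 0 < T)
    (hζ : ContDiffOn ℝ 1 ζ (Icc 0 T)) (hβ : DriftField s T C (averagedDrift b γ))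
    (hσ : FieldRegular T C σ) (hΦ : SpaceTimeRegular T C (levyField σ)) (hs : 0 ≤ s)
    (h : IsClassicalSolution T b σ ζ s y γ x) :
    DavieSolution s T (averagedDrift b γ) σ ζ (canonicalArea T ζ) x := by
  obtain ⟨hx, h⟩ := (isClassicalSolution_iff hT hζ hβ hσ hs).1 h
  exact davieSolution_of_integral_solution hT hζ hβ hσ hΦ hs hx h

theorem IsClassicalSolution.init {ζ : ℝ → E d} (hsT : s ≤ T)
    (h : IsClassicalSolution T b σ ζ s y γ x) : x s = y := by
  simpa using h.2 s ⟨le_rfl, hsT⟩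

variable {α α' : ℝ} {ζ : ℝ → E d} {A : ℝ → ℝ → Fin d → Fin d → ℝ}

theorem IsRoughSolution.davieSolution (h : IsRoughSolution T α b σ ζ A s y γ x) :
    DavieSolution s T (averagedDrift b γ) σ ζ A x := by
  obtain ⟨-, κ, hκ, -, h1, h2⟩ := h
  exact davieSolution_of_isRoughIntegral hκ h1 h2

theorem DavieSolution.isRoughSolution (H : RoughData T α' C N σ) (hα : α' ≤ α) (hs : 0 ≤ s)
    (hβ : DriftField s T C (averagedDrift b γ)) (hA : DriverBound s T α' N ζ A)
    (hx : DavieSolution s T (averagedDrift b γ) σ ζ A x) (hy : x s = y) :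
    IsRoughSolution T α b σ ζ A s y γ x := by
  obtain ⟨θ, hθ, M, hM⟩ := hx.rem
  have hα' := H.lt_exponent
  have h1 : 1 / 3 < min α' (θ / 3) := lt_min hα' (by linarith)
  have h2 := min_le_left α' (θ / 3)
  have h3 := min_le_right α' (θ / 3)
  have hR : HolderBound s T θ (davieRemainder σ ζ A (driftIncrement (averagedDrift b γ) x) x) :=
    ⟨max M 0, le_max_right _ _, fun r t hr hrt ht => (hM r t hr hrt ht).trans (by
      have : 0 ≤ t - r := sub_nonneg.2 hrt
      gcongr
      exact le_max_left _ _)⟩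
  -- The midpoint $\kappa$ satisfies $1/3<\kappa<\alpha'\le\alpha$ and $3\kappa\le\theta$.
  exact ⟨hy, (1 / 3 + min α' (θ / 3)) / 2, by linarith, by linarith,
    hx.isControlled H hs hβ hA hθ hR (by linarith) (by linarith) (by linarith)⟩

theorem IsRoughSolution.eqOn (H : RoughData T α' C N σ) (hs : 0 ≤ s)
    (hβ : DriftField s T C (averagedDrift b γ)) (hA : DriverBound s T α' N ζ A) {x' : ℝ → E m}
    (h : IsRoughSolution T α b σ ζ A s y γ x) (h' : IsRoughSolution T α b σ ζ A s y γ x') :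
    EqOn x x' (Icc s T) := by
  obtain ⟨K, -, hK⟩ := H.exists_norm_sub_le
  intro t ht
  have := hK s _ ζ A x ζ A x' 0 hs hβ hA h.davieSolution hA h'.davieSolution le_rfl
    (fun _ _ _ _ _ => by simp) (fun _ _ _ _ _ => by simp [entrySum]) t ht.1 ht.2
  rw [h.1, h'.1, sub_self, norm_zero, add_zero, mul_zero] at this
  exact sub_eq_zero.1 (norm_le_zero_iff.1 this)

end StateEquation

/-! ### Comparison of suprema and of objectives -/

section Values

theorem sSup_le_sSup_add {S S' : Set ℝ} {η : ℝ} (hS : S.Nonempty) (hS' : BddAbove S')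
    (h : ∀ x ∈ S, ∃ y ∈ S', x ≤ y + η) : sSup S ≤ sSup S' + η :=
  csSup_le hS fun x hx => by
    obtain ⟨y, hy, hxy⟩ := h x hx
    linarith [le_csSup hS' hy]

theorem abs_sSup_sub_sSup_le {S S' : Set ℝ} {η : ℝ} (hη : 0 ≤ η) (hS : BddAbove S)
    (hS' : BddAbove S') (h : ∀ x ∈ S, ∃ y ∈ S', |x - y| ≤ η)
    (h' : ∀ y ∈ S', ∃ x ∈ S, |x - y| ≤ η) : |sSup S - sSup S'| ≤ η := by
  -- If one set is empty so is the other, and both suprema take the same default value.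
  rcases S.eq_empty_or_nonempty with rfl | hne
  · have : S' = ∅ := eq_empty_iff_forall_notMem.2 fun y hy => by
      obtain ⟨x, hx, -⟩ := h' y hy
      exact hx
    simpa [this] using hη
  · have hne' : S'.Nonempty := by
      obtain ⟨x, hx⟩ := hne
      obtain ⟨y, hy, -⟩ := h x hx
      exact ⟨y, hy⟩
    have h1 := sSup_le_sSup_add (η := η) hne hS' fun x hx => by
      obtain ⟨y, hy, hxy⟩ := h x hx
      exact ⟨y, hy, by linarith [(abs_le.1 hxy).2]⟩
    have h2 := sSup_le_sSup_add (η := η) hne' hS fun y hy => by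
      obtain ⟨x, hx, hxy⟩ := h' y hy
      exact ⟨x, hx, by linarith [(abs_le.1 hxy).1]⟩
    exact abs_le.2 ⟨by linarith, by linarith⟩

variable {m : ℕ} {U : Type*} [MetricSpace U] [MeasurableSpace U] {T ε L : ℝ} {K : Set (P2 U)}
  {F : ℝ → E m → P2 U → ℝ}

/-- The objective is bounded, and continuous with respect to the state path. -/
theorem RewardRegular.exists_objective_bounds (hF : RewardRegular T K F) (hε : 0 < ε)
    (hL : 0 < L) : ∃ C ≥ 0, ∀ s ∈ Icc 0 T, ∀ γ ∈ controls K ε L s T, ∀ (G : E m → ℝ) (x : ℝ → E m),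
      (∀ B, |G (x T)| ≤ B → objective T F G s γ x ≤ C * T + B) ∧
      ∀ x' : ℝ → E m, ContinuousOn x (Icc s T) → ContinuousOn x' (Icc s T) → ∀ δ η,
        (∀ r ∈ Icc s T, ‖x r - x' r‖ ≤ δ) → |G (x T) - G (x' T)| ≤ η →
        |objective T F G s γ x - objective T F G s γ x'| ≤ C * δ * T + η := by
  obtain ⟨C, hC⟩ := hF.2
  refine ⟨max C 0, le_max_right _ _, fun s hs γ hγ G x => ?_⟩
  have hIoc : ∀ r ∈ uIoc s T, r ∈ Icc 0 T ∧ r ∈ Icc s T := fun r hr => by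
    rw [uIoc_of_le hs.2] at hr
    exact ⟨⟨hs.1.trans hr.1.le, hr.2⟩, hr.1.le, hr.2⟩
  have hlen : |T - s| ≤ T := by
    rw [abs_of_nonneg (sub_nonneg.2 hs.2)]
    linarith [hs.1]
  have hbd : ∀ z : ℝ → E m, ∀ r ∈ uIoc s T, ‖F r (z r) (γ r)‖ ≤ max C 0 := fun z r hr =>
    ((hC r (hIoc r hr).1).1 _ _ (hγ.1 r (hIoc r hr).2)).trans (le_max_left _ _)
  refine ⟨fun B hB => ?_, fun x' hx hx' δ η hδ hη => ?_⟩
  · have h1 := intervalIntegral.norm_integral_le_of_norm_le_const (hbd x)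
    have h2 : max C 0 * |T - s| ≤ max C 0 * T := by gcongr
    exact add_le_add ((le_abs_self _).trans (h1.trans h2)) ((le_abs_self _).trans hB)
  -- Integrability along each path is needed to write the difference of the integrals as one
  -- integral.
  · have hint : ∀ z : ℝ → E m, ContinuousOn z (Icc s T) →
        IntervalIntegrable (fun r => F r (z r) (γ r)) volume s T := fun z hz => by
      rw [intervalIntegrable_iff]
      refine IntegrableOn.of_bound (by simp) ?_ (max C 0)
        ((ae_restrict_iff' measurableSet_uIoc).2 (Eventually.of_forall (hbd z)))
      exact (hF.aestronglyMeasurable hε hL hs.1 hγ hz).mono_measure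
        (Measure.restrict_mono (fun r hr => (hIoc r hr).2) le_rfl)
    have h1 := intervalIntegral.norm_integral_le_of_norm_le_const (a := s) (b := T)
      (f := fun r => F r (x r) (γ r) - F r (x' r) (γ r)) (C := max C 0 * δ) fun r hr =>
        ((hC r (hIoc r hr).1).2.1 _ _ _ (hγ.1 r (hIoc r hr).2)).trans (by
          gcongr
          · exact le_max_left _ _
          · exact hδ r (hIoc r hr).2)
    rw [intervalIntegral.integral_sub (hint x hx) (hint x' hx')] at h1
    have hδ0 : 0 ≤ δ := (norm_nonneg _).trans (hδ s ⟨le_rfl, hs.2⟩)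
    have h2 : max C 0 * δ * |T - s| ≤ max C 0 * δ * T := by gcongr
    rw [objective, objective, add_sub_add_comm]
    exact (abs_add_le _ _).trans (add_le_add (h1.trans h2) hη)

end Values

end RoughControl

/-! ### The main theorem -/

theorem mainTheorem7 {m d : ℕ} {U : Type*} [MetricSpace U] [SecondCountableTopology U]
    [MeasurableSpace U] [BorelSpace U]
    (T α ε L : ℝ) (hT : 0 < T) (hα : 1 / 3 < α) (hε : 0 < ε) (hL : 0 < L)
    (K : Set (RoughControl.P2 U)) (hK : IsCompact K) (hK₀ : K.Nonempty)
    (b : ℝ → RoughControl.E m → U → RoughControl.E m)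
    (hb : RoughControl.DriftRegular T b)
    (σ : ℝ → RoughControl.E m → RoughControl.E d →L[ℝ] RoughControl.E m)
    (hσ : RoughControl.DiffusionRegular T σ)
    (F : ℝ → RoughControl.E m → RoughControl.P2 U → ℝ)
    (hF : RoughControl.RewardRegular T K F)
    (G : RoughControl.E m → ℝ) (hG : Continuous G) (hGb : ∃ C : ℝ, ∀ x, |G x| ≤ C)
    (ζ : ℝ → RoughControl.E d) (A : ℝ → ℝ → Fin d → Fin d → ℝ)
    (hζ : RoughControl.IsGeometricRoughPath T α ζ A)
    (ζn : ℕ → ℝ → RoughControl.E d) (hζn : ∀ n, ContDiffOn ℝ 1 (ζn n) (Icc 0 T))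
    (hconv : Tendsto (fun n => RoughControl.roughDist T α (ζn n)
      (RoughControl.canonicalArea T (ζn n)) ζ A) atTop (𝓝 0)) :
    (∀ s ∈ Icc (0 : ℝ) T, ∀ y, ∀ γ ∈ RoughControl.controls K ε L s T,
      (∃ x, RoughControl.IsRoughSolution T α b σ ζ A s y γ x ∧
        ∀ x', RoughControl.IsRoughSolution T α b σ ζ A s y γ x' → EqOn x' x (Icc s T)) ∧
      ∀ n, ∃ x, RoughControl.IsClassicalSolution T b σ (ζn n) s y γ x ∧
        ∀ x', RoughControl.IsClassicalSolution T b σ (ζn n) s y γ x' → EqOn x' x (Icc s T)) ∧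
    TendstoLocallyUniformlyOn
      (fun n (p : ℝ × RoughControl.E m) =>
        RoughControl.classicalValue T b σ F G K ε L (ζn n) p.1 p.2)
      (fun p => RoughControl.roughValue T α b σ F G K ε L ζ A p.1 p.2)
      atTop (Icc 0 T ×ˢ univ) := by
  -- The estimates are run at an exponent in $(1/3,1/2]$; rough path bounds and convergence pass to
  -- lower exponents on $[0,T]$.
  set α' := min α (1 / 2) with hα'
  have hα'1 : 1 / 3 < α' := lt_min hα (by norm_num)
  have hαα : α' ≤ α := min_le_left _ _
  obtain ⟨N, hN, ϱ, k, hϱ, hϱ0, hA, hAn⟩ := RoughControl.exists_driverClose hT.le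
    (by linarith : 0 < α') hαα hζ (fun n s u t hs hsu hut ht =>
      RoughControl.canonicalArea_chen hT (hζn n) hs hsu hut ht) hconv
  obtain ⟨C₀, hC₀⟩ := hb.exists_driftField
  obtain ⟨C, hC, H⟩ := hσ.exists_roughData hα'1 (min_le_right _ _) hN C₀
  have hβ : ∀ s ∈ Icc 0 T, ∀ γ ∈ RoughControl.controls K ε L s T,
      RoughControl.DriftField s T C (RoughControl.averagedDrift b γ) := fun s hs γ hγ =>
    (hC₀ K ε L s hε hL hs.1 γ hγ).mono hC
  have hclass : ∀ s ∈ Icc 0 T, ∀ y, ∀ γ ∈ RoughControl.controls K ε L s T, ∀ n,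
      ∃ x, RoughControl.IsClassicalSolution T b σ (ζn n) s y γ x ∧
        ∀ x', RoughControl.IsClassicalSolution T b σ (ζn n) s y γ x' → EqOn x' x (Icc s T) :=
    fun s hs y γ hγ n =>
      RoughControl.exists_isClassicalSolution hT (hζn n) (hβ s hs γ hγ) H.field hs y
  have hdavie : ∀ {s y γ n x}, s ∈ Icc 0 T → γ ∈ RoughControl.controls K ε L s T →
      RoughControl.IsClassicalSolution T b σ (ζn n) s y γ x →
      RoughControl.DavieSolution s T (RoughControl.averagedDrift b γ) σ (ζn n)
        (RoughControl.canonicalArea T (ζn n)) x := fun {s y γ n x} hs hγ hx =>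
    hx.davieSolution hT (hζn n) (hβ s hs γ hγ) H.field H.levy hs.1
  have hrough : ∀ s ∈ Icc 0 T, ∀ y, ∀ γ ∈ RoughControl.controls K ε L s T,
      ∃ x, RoughControl.IsRoughSolution T α b σ ζ A s y γ x := by
    intro s hs y γ hγ
    choose x hx _ using hclass s hs y γ hγ
    have hk : ∀ n, k ≤ n + k := fun n => Nat.le_add_left k n
    -- The sequence is shifted by $k$, since only from there on do the drivers share the bound $N$.
    obtain ⟨z, hz, hz0⟩ := H.exists_davieSolution hs.1 hs.2 (hβ s hs γ hγ) (hA.mono hs.1 le_rfl)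
      (ζn := fun n => ζn (n + k)) (An := fun n => RoughControl.canonicalArea T (ζn (n + k)))
      (xn := fun n => x (n + k)) (ϱ := fun n => ϱ (n + k)) (y := y)
      (fun n => (hAn (n + k) (hk n)).1.mono hs.1 le_rfl) (fun n => hdavie hs hγ (hx (n + k)))
      (fun n => (hx (n + k)).init hs.2) (fun n => hϱ0 (n + k))
      ((tendsto_add_atTop_iff_nat k).2 hϱ)
      (fun n r t hr hrt ht => (hAn (n + k) (hk n)).2.path r t (hs.1.trans hr) hrt ht)
      (fun n r t hr hrt ht => (hAn (n + k) (hk n)).2.area r t (hs.1.trans hr) hrt ht)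
    exact ⟨z, hz.isRoughSolution H hαα hs.1 (hβ s hs γ hγ) (hA.mono hs.1 le_rfl) hz0⟩
  refine ⟨fun s hs y γ hγ => ⟨?_, hclass s hs y γ hγ⟩, ?_⟩
  · obtain ⟨x, hx⟩ := hrough s hs y γ hγ
    exact ⟨x, hx, fun x' hx' => hx'.eqOn H hs.1 (hβ s hs γ hγ) (hA.mono hs.1 le_rfl) hx⟩
  obtain ⟨K₀, hK₀0, hinit⟩ := H.exists_norm_sub_init_le
  obtain ⟨K₁, hK₁, hstab⟩ := H.exists_norm_sub_le
  obtain ⟨CF, hCF, hobj⟩ := hF.exists_objective_bounds hε hL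
  obtain ⟨CG, hCG⟩ := hGb
  rw [Metric.tendstoLocallyUniformlyOn_iff]
  rintro η hη p -
  -- For $|y|<|p_2|+1$ the endpoints of all state paths lie in this ball, as they stay within $K_0$
  -- of $y$.
  have hGu : UniformContinuousOn G (Metric.closedBall 0 (‖p.2‖ + 1 + K₀)) :=
    (isCompact_closedBall _ _).uniformContinuousOn_of_continuous hG.continuousOn
  obtain ⟨δ, hδ, hGδ⟩ := Metric.uniformContinuousOn_iff.1 hGu (η / 3) (by positivity)
  have l1 : Tendsto (fun n => K₁ * ϱ n) atTop (𝓝 0) := by simpa using hϱ.const_mul K₁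
  have l2 : Tendsto (fun n => CF * (K₁ * ϱ n) * T) atTop (𝓝 0) := by
    simpa using (l1.const_mul CF).mul_const T
  refine ⟨(Icc 0 T ×ˢ univ) ∩ {q | ‖q.2‖ < ‖p.2‖ + 1}, inter_mem self_mem_nhdsWithin
    (mem_nhdsWithin_of_mem_nhds
      ((isOpen_lt (by fun_prop) continuous_const).mem_nhds (by simp))), ?_⟩
  filter_upwards [eventually_ge_atTop k, l1.eventually_lt_const hδ,
    l2.eventually_lt_const (by positivity : 0 < η / 3)] with n hn hn1 hn2
  rintro ⟨s, y⟩ ⟨⟨hs, -⟩, hy⟩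
  obtain ⟨hAn, hclose⟩ := hAn n hn
  -- At most $\eta/3$ from the running reward and $\eta/3$ from $G$, for each control; the total
  -- $2\eta/3$ leaves room for a strict inequality after taking suprema.
  have hcompare : ∀ γ ∈ RoughControl.controls K ε L s T, ∀ x x',
      RoughControl.IsRoughSolution T α b σ ζ A s y γ x →
      RoughControl.IsClassicalSolution T b σ (ζn n) s y γ x' →
      |RoughControl.objective T F G s γ x - RoughControl.objective T F G s γ x'| ≤ 2 * η / 3 := by
    intro γ hγ x x' hx hx'
    have hd := hx.davieSolution
    have hd' := hdavie hs hγ hx'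
    have hxx : ∀ r ∈ Icc s T, ‖x r - x' r‖ ≤ K₁ * ϱ n := fun r hr => by
      have := hstab s _ (ζn n) _ x' ζ A x (ϱ n) hs.1 (hβ s hs γ hγ) (hAn.mono hs.1 le_rfl) hd'
        (hA.mono hs.1 le_rfl) hd (hϱ0 n)
        (fun r t hr hrt ht => hclose.path r t (hs.1.trans hr) hrt ht)
        (fun r t hr hrt ht => hclose.area r t (hs.1.trans hr) hrt ht) r hr.1 hr.2
      rwa [hx.1, hx'.init hs.2, sub_self, norm_zero, zero_add, norm_sub_rev] at this
    have hball : ∀ z : RoughControl.E m, ‖z - y‖ ≤ K₀ →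
        z ∈ Metric.closedBall (0 : RoughControl.E m) (‖p.2‖ + 1 + K₀) := fun z hz => by
      rw [mem_closedBall_zero_iff]
      have := norm_le_norm_add_norm_sub' z y
      have hy' : ‖y‖ < ‖p.2‖ + 1 := hy
      linarith
    have e := hinit s _ ζ A x hs.1 (hβ s hs γ hγ) (hA.mono hs.1 le_rfl) hd T hs.2 le_rfl
    have e' := hinit s _ _ _ x' hs.1 (hβ s hs γ hγ) (hAn.mono hs.1 le_rfl) hd' T hs.2 le_rfl
    rw [hx.1] at e
    rw [hx'.init hs.2] at e'
    have hGG : |G (x T) - G (x' T)| ≤ η / 3 := (hGδ _ (hball _ e) _ (hball _ e') (by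
      rw [dist_eq_norm]
      exact (hxx T ⟨hs.2, le_rfl⟩).trans_lt hn1)).le
    refine ((hobj s hs γ hγ G x).2 x' hd.cont hd'.cont _ _ hxx hGG).trans ?_
    linarith
  refine lt_of_le_of_lt (b := 2 * η / 3) ?_ (by linarith)
  rw [Real.dist_eq]
  refine RoughControl.abs_sSup_sub_sSup_le (by positivity) ⟨CF * T + CG, ?_⟩ ⟨CF * T + CG, ?_⟩ ?_ ?_
  · rintro _ ⟨γ, hγ, x, -, rfl⟩
    exact (hobj s hs γ hγ G x).1 CG (hCG _)
  · rintro _ ⟨γ, hγ, x, -, rfl⟩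
    exact (hobj s hs γ hγ G x).1 CG (hCG _)
  · rintro _ ⟨γ, hγ, x, hx, rfl⟩
    obtain ⟨x', hx', -⟩ := hclass s hs y γ hγ n
    exact ⟨_, ⟨γ, hγ, x', hx', rfl⟩, hcompare γ hγ x x' hx hx'⟩
  · rintro _ ⟨γ, hγ, x', hx', rfl⟩
    obtain ⟨x, hx⟩ := hrough s hs y γ hγ
    exact ⟨_, ⟨γ, hγ, x, hx, rfl⟩, hcompare γ hγ x x' hx hx'⟩
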